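/- **Setting.** A data space $\Omega$ is either a finite set $\{1,\dots,k\}$ with counting measure $\mu$, or $\mathbb R^d$ with Lebesgue measure $\mu$; its $n$-fold product $\Omega^{n}$ is again a data space. $\mathcal P(\Omega)$ is the set of probability densities in $L^1(\Omega,\mu)$. The tangent space $\mathcal T(\Omega)$ at every $p\in\mathcal P(\Omega)$ consists of the $\delta\in L^1(\Omega,\mu)$ with $\int\delta\,d\mu=0$ (equivalently, $\delta=c(p_1-p_2)$ with $p_1,p_2\in\mathcal P(\Omega)$, if $\mathcal P(\Omega)\neq\emptyset$). A channel $\Psi$ is a positive, integral-preserving linear map $L^1(\Omega)\to L^1(\Omega')$. Put $p^{\otimes n}(x_1,\dots,x_n)=\prod_i p(x_i)$ and $\delta^{(n)}=\sum_{i=1}^n p^{\otimes (i-1)}\otimes\delta\otimes p^{\otimes(n-i)}$. A *metric* $g$ assigns to every data space $\Omega$, every $p\in\mathcal P(\Omega)$ and $\delta\in\mathcal T(\Omega)$ a value $g_p(\delta)\in[0,\infty]$ such that, for each $p$, $g_p$ is the square of an extended norm $N$ on $\mathcal T(\Omega)$ ($N(\delta)=0\iff\delta=0$, $N(c\delta)=|c|N(\delta)$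 with $0\cdot\infty=0$, $N(\delta+\delta')\le N(\delta)+N(\delta')$; the value $\infty$ is allowed; $N$ need not come from an inner product). Consider the axioms - (M0) $g_{p}(\delta)\ge g_{\Psi(p)}(\Psi(\delta))$ for all $p,\delta$ and all channels $\Psi$; - (A0) $\lim_{n\to\infty}\frac1n g_{p^{\otimes n}}(\delta^{(n)})=g_p(\delta)$ for all $p,\delta$; - (C0) whenever $g_p(\delta)<\infty$, $q^n\in\mathcal P(\Omega^n)$, $\delta'^n\in\mathcal T(\Omega^n)$, $\|q^n-p^{\otimes n}\|_1\to0$ and $\frac1{\sqrt n}\|\delta'^n-\delta^{(n)}\|_1\to0$, then $\liminf_{n\to\infty}\frac1n\bigl(g_{q^n}(\delta'^n)-g_{p^{\otimes n}}(\delta^{(n)})\bigr)\ge0$; - (N0) $g_p(\delta)=1$ for $p(x)=\frac1{\sqrt{2\pi}}e^{-x^2/2}$ and $\delta(x)=x\,p(x)$ on $\mathbb R$. The Fisher information is $J_p(\delta)=\int\delta^2/p\,d\mu\in[0,\infty]$ (with $0/0=0$ and $a/0=\infty$ for $a>0$). **Theorem.** Let $g$ be a metric satisfying (M0), (A0), (C0)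 and (N0). Let $p\in\mathcal P(\Omega)$, $\delta\in\mathcal T(\Omega)$ be such that the score $L=\delta/p$ exists (i.e. $\delta=0$ almost everywhere on $\{p=0\}$) and $\mathbb E_p L^4<\infty$. Suppose that either (a) $\Omega$ is a finite set; or (b) $g_p(\delta)<\infty$ and the law of $L$ under $p$ has a density $\mathrm p_L$ with respect to Lebesgue measure on $\mathbb R$ with $$\mathbb E\left(\frac{\int_{-\infty}^{L}(-t)\,\mathrm p_L(t)\,dt}{J_p(\delta)\,\mathrm p_L(L)}\right)^2<\infty .$$ Then $g_p(\delta)=J_p(\delta)$. Conversely, the Fisher information $J$ is a metric in the above sense and satisfies (M0), (A0), (C0) and (N0). -/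

import Mathlib

open MeasureTheory ProbabilityTheory Filter Topology
open scoped ENNReal

noncomputable section

namespace InfoMetric

/-! ### Data spaces -/

/-- The underlying sets of probability distributions: a finite set with `k` elements, or `ℝ^d`. -/
inductive DataSpace : Type
  | finite (k : ℕ) : DataSpace
  | euclid (d : ℕ) : DataSpace

namespace DataSpace

/-- The points of a data space. -/
def Carrier : DataSpace → Type
  | finite k => Fin k
  | euclid d => Fin d → ℝ

instance instMeasurableSpaceCarrier : (Ω : DataSpace) → MeasurableSpace Ω.Carrier
  | finite k => inferInstanceAs (MeasurableSpace (Fin k))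
  | euclid d => inferInstanceAs (MeasurableSpace (Fin d → ℝ))

/-- The reference measure: counting measure on a finite set, Lebesgue measure on `ℝ^d`. -/
def refMeasure : (Ω : DataSpace) → Measure Ω.Carrier
  | finite k => (Measure.count : Measure (Fin k))
  | euclid d => (volume : Measure (Fin d → ℝ))

instance instSigmaFinite : (Ω : DataSpace) → SigmaFinite Ω.refMeasure
  | finite k => inferInstanceAs (SigmaFinite (Measure.count : Measure (Fin k)))
  | euclid d => inferInstanceAs (SigmaFinite (volume : Measure (Fin d → ℝ)))

/-- The `n`-fold product of a data space: `{1,…,k}^n` is listed as a set with `k ^ n` elements,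
and `(ℝ^d)^n` is `ℝ^(n * d)`. -/
def pow : DataSpace → ℕ → DataSpace
  | finite k, n => finite (k ^ n)
  | euclid d, n => euclid (n * d)

/-- Points of `{1,…,k}^n` as `n`-tuples. -/
def finTuple (k n : ℕ) : Fin (k ^ n) ≃ᵐ (Fin n → Fin k) where
  toEquiv := (finFunctionFinEquiv (m := k) (n := n)).symm
  measurable_toFun := measurable_from_top
  measurable_invFun := measurable_of_countable _

/-- Points of `ℝ^(n * d)` as `n`-tuples of points of `ℝ^d`. -/
def euclidTuple (d n : ℕ) : (Fin (n * d) → ℝ) ≃ᵐ (Fin n → Fin d → ℝ) where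
  toFun x i j := x (finProdFinEquiv (i, j))
  invFun y l := y (finProdFinEquiv.symm l).1 (finProdFinEquiv.symm l).2
  left_inv x := funext fun l => congrArg x (finProdFinEquiv.apply_symm_apply l)
  right_inv y := by
    funext i j
    simp only [Equiv.symm_apply_apply]
  measurable_toFun := by
    simp only [Equiv.coe_fn_mk]
    fun_prop
  measurable_invFun := by
    simp only [Equiv.coe_fn_symm_mk]
    fun_prop

/-- The identification of the points of `Ω.pow n` with `n`-tuples `(x₁,…,xₙ)` of points of `Ω`. -/
def tuple : (Ω : DataSpace) → (n : ℕ) → (Ω.pow n).Carrier ≃ᵐ (Fin n → Ω.Carrier)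
  | finite k, n => finTuple k n
  | euclid d, n => euclidTuple d n

theorem measurePreserving_finTuple (k n : ℕ) :
    MeasurePreserving (finTuple k n) Measure.count (Measure.pi fun _ => Measure.count) := by
  refine ⟨(finTuple k n).measurable, Measure.ext_of_singleton fun y => ?_⟩
  rw [MeasurableEquiv.map_apply]
  have h1 : (finTuple k n) ⁻¹' {y} = {finFunctionFinEquiv y} := by
    ext x
    exact (finFunctionFinEquiv (m := k) (n := n)).symm_apply_eq
  rw [h1, Measure.count_singleton, Measure.pi_singleton]
  simp

theorem measurePreserving_euclidTuple (d n : ℕ) :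
    MeasurePreserving (euclidTuple d n) volume (Measure.pi fun _ => volume) := by
  suffices h : MeasurePreserving (euclidTuple d n).symm (Measure.pi fun _ => volume) volume from
    h.symm
  refine ⟨(euclidTuple d n).symm.measurable, (Measure.pi_eq fun s _ => ?_).symm⟩
  have h1 : (euclidTuple d n).symm ⁻¹' (Set.univ.pi s) =
      Set.univ.pi fun i : Fin n => Set.univ.pi fun j : Fin d => s (finProdFinEquiv (i, j)) := by
    ext y
    constructor
    · intro hy i _ j _
      have := hy (finProdFinEquiv (i, j)) trivial
      change y (finProdFinEquiv.symm (finProdFinEquiv (i, j))).1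
        (finProdFinEquiv.symm (finProdFinEquiv (i, j))).2 ∈ _ at this
      simpa only [Equiv.symm_apply_apply] using this
    · intro hy l _
      have := hy (finProdFinEquiv.symm l).1 trivial (finProdFinEquiv.symm l).2 trivial
      simp only [Prod.mk.eta, Equiv.apply_symm_apply] at this
      exact this
  rw [MeasurableEquiv.map_apply, h1, Measure.pi_pi]
  simp_rw [volume_pi, Measure.pi_pi]
  rw [← Fintype.prod_prod_type' fun (i : Fin n) (j : Fin d) => volume (s (finProdFinEquiv (i, j)))]
  exact Fintype.prod_equiv finProdFinEquiv _ _ fun _ => rfl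

/-- The reference measure of `Ω.pow n` is the product of the reference measures of the factors. -/
theorem measurePreserving_tuple : (Ω : DataSpace) → (n : ℕ) →
    MeasurePreserving (Ω.tuple n) (Ω.pow n).refMeasure
      (Measure.pi fun _ : Fin n => Ω.refMeasure)
  | finite k, n => measurePreserving_finTuple k n
  | euclid d, n => measurePreserving_euclidTuple d n

end DataSpace

/-- `L₁(Ω)`: integrable functions modulo almost everywhere equality. -/
abbrev L1 (Ω : DataSpace) : Type := Lp ℝ 1 Ω.refMeasure

/-! ### Probability densities, tangent vectors and channels -/

/-- A probability density on `Ω`. -/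
structure Density (Ω : DataSpace) where
  val : L1 Ω
  nonneg : 0 ≤ val
  integral_eq_one : ∫ x, val x ∂Ω.refMeasure = 1

/-- The tangent space to the probability densities: the `L₁` functions with vanishing integral,
that is, the functions `c (p₁ - p₂)` with `p₁`, `p₂` probability densities. -/
def Tangent (Ω : DataSpace) : Submodule ℝ (L1 Ω) where
  carrier := {δ | ∫ x, δ x ∂Ω.refMeasure = 0}
  zero_mem' := by
    change ∫ x, (0 : L1 Ω) x ∂Ω.refMeasure = 0
    rw [integral_congr_ae (Lp.coeFn_zero ℝ 1 Ω.refMeasure)]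
    simp
  add_mem' := by
    intro f g hf hg
    change ∫ x, (f + g : L1 Ω) x ∂Ω.refMeasure = 0
    rw [integral_congr_ae (Lp.coeFn_add f g)]
    refine (integral_add (L1.integrable_coeFn f) (L1.integrable_coeFn g)).trans ?_
    rw [show ∫ x, f x ∂Ω.refMeasure = 0 from hf, show ∫ x, g x ∂Ω.refMeasure = 0 from hg, add_zero]
  smul_mem' := by
    intro c f hf
    change ∫ x, (c • f : L1 Ω) x ∂Ω.refMeasure = 0
    rw [integral_congr_ae (Lp.coeFn_smul c f)]
    refine (integral_smul c _).trans ?_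
    rw [show ∫ x, f x ∂Ω.refMeasure = 0 from hf, smul_zero]

/-- A channel (Markov map): a positive, integral preserving linear map between `L₁` spaces. -/
structure Channel (Ω Ω' : DataSpace) where
  toLinearMap : L1 Ω →ₗ[ℝ] L1 Ω'
  map_nonneg : ∀ f, 0 ≤ f → 0 ≤ toLinearMap f
  integral_map : ∀ f, ∫ x, toLinearMap f x ∂Ω'.refMeasure = ∫ x, f x ∂Ω.refMeasure

/-- The image of a probability density under a channel. -/
def Channel.density {Ω Ω' : DataSpace} (Ψ : Channel Ω Ω') (p : Density Ω) : Density Ω' where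
  val := Ψ.toLinearMap p.val
  nonneg := Ψ.map_nonneg _ p.nonneg
  integral_eq_one := (Ψ.integral_map _).trans p.integral_eq_one

/-- The image of a tangent vector under (the differential of) a channel. -/
def Channel.tangent {Ω Ω' : DataSpace} (Ψ : Channel Ω Ω') (δ : Tangent Ω) : Tangent Ω' :=
  ⟨Ψ.toLinearMap δ.1, (Ψ.integral_map _).trans δ.2⟩

/-! ### Tensor powers -/

theorem integrable_prod_tuple {Ω : DataSpace} {n : ℕ} (f : Fin n → L1 Ω) :
    Integrable (fun x => ∏ i, f i (Ω.tuple n x i)) (Ω.pow n).refMeasure :=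
  (Ω.measurePreserving_tuple n).integrable_comp_of_integrable
    (g := fun y : Fin n → Ω.Carrier => ∏ i, f i (y i))
    (Integrable.fintype_prod fun i => L1.integrable_coeFn (f i))

/-- The product `f₁ ⊗ ⋯ ⊗ fₙ`, i.e. the class of `(x₁,…,xₙ) ↦ f₁ x₁ ⋯ fₙ xₙ`. -/
def tensor {Ω : DataSpace} {n : ℕ} (f : Fin n → L1 Ω) : L1 (Ω.pow n) :=
  (integrable_prod_tuple f).toL1 _

theorem coeFn_tensor {Ω : DataSpace} {n : ℕ} (f : Fin n → L1 Ω) :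
    tensor f =ᵐ[(Ω.pow n).refMeasure] fun x => ∏ i, f i (Ω.tuple n x i) :=
  Integrable.coeFn_toL1 _

theorem integral_tensor {Ω : DataSpace} {n : ℕ} (f : Fin n → L1 Ω) :
    ∫ x, tensor f x ∂(Ω.pow n).refMeasure = ∏ i, ∫ x, f i x ∂Ω.refMeasure := by
  rw [integral_congr_ae (coeFn_tensor f),
    (Ω.measurePreserving_tuple n).integral_comp' (fun y : Fin n → Ω.Carrier => ∏ i, f i (y i)),
    integral_fintype_prod_eq_prod (fun i x => f i x)]

theorem tensor_nonneg {Ω : DataSpace} {n : ℕ} {f : Fin n → L1 Ω} (hf : ∀ i, 0 ≤ f i) :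
    0 ≤ tensor f := by
  rw [← Lp.coeFn_nonneg]
  have h : ∀ᵐ x ∂(Ω.pow n).refMeasure, ∀ i, 0 ≤ f i (Ω.tuple n x i) := by
    rw [ae_all_iff]
    intro i
    have hi : ∀ᵐ y ∂Ω.refMeasure, 0 ≤ f i y := (Lp.coeFn_nonneg (f i)).2 (hf i)
    exact ((Measure.quasiMeasurePreserving_eval (fun _ : Fin n => Ω.refMeasure) i).comp
      (Ω.measurePreserving_tuple n).quasiMeasurePreserving).ae hi
  filter_upwards [coeFn_tensor f, h] with x hx h
  rw [hx]
  exact Finset.prod_nonneg fun i _ => h i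

/-- The `n`-fold product density `p^{⊗n}`. -/
def Density.pow {Ω : DataSpace} (p : Density Ω) (n : ℕ) : Density (Ω.pow n) where
  val := tensor fun _ => p.val
  nonneg := tensor_nonneg fun _ => p.nonneg
  integral_eq_one := by
    rw [integral_tensor]
    simp [p.integral_eq_one]

/-- `δ^{(n)} = δ ⊗ p ⊗ ⋯ ⊗ p + p ⊗ δ ⊗ p ⊗ ⋯ ⊗ p + ⋯ + p ⊗ ⋯ ⊗ p ⊗ δ`, the tangent vector at
`p^{⊗n}` induced by the tangent vector `δ` at `p`. -/
def tangentPow {Ω : DataSpace} (p : Density Ω) (δ : Tangent Ω) (n : ℕ) : Tangent (Ω.pow n) :=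
  ∑ i : Fin n, ⟨tensor (Function.update (fun _ => p.val) i δ.1), by
    change ∫ x, tensor _ x ∂(Ω.pow n).refMeasure = 0
    rw [integral_tensor]
    refine Finset.prod_eq_zero (Finset.mem_univ i) ?_
    rw [Function.update_self]
    exact δ.2⟩

/-! ### The standard Gaussian shift -/

theorem measurePreserving_eval_zero :
    MeasurePreserving (fun x : (DataSpace.euclid 1).Carrier => (x : Fin 1 → ℝ) 0)
      (DataSpace.euclid 1).refMeasure volume :=
  volume_preserving_funUnique (Fin 1) ℝ

/-- The density of `N(0,1)`. -/
def gaussDensity : Density (.euclid 1) where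
  val := (measurePreserving_eval_zero.integrable_comp_of_integrable
    (integrable_gaussianPDFReal 0 1)).toL1 _
  nonneg := by
    rw [← Lp.coeFn_nonneg]
    filter_upwards [Integrable.coeFn_toL1 (measurePreserving_eval_zero.integrable_comp_of_integrable
      (integrable_gaussianPDFReal 0 1))] with x hx
    rw [hx]
    exact gaussianPDFReal_nonneg 0 1 _
  integral_eq_one := by
    rw [integral_congr_ae (Integrable.coeFn_toL1 _)]
    refine ((volume_preserving_funUnique (Fin 1) ℝ).integral_comp' (gaussianPDFReal 0 1)).trans ?_
    exact integral_gaussianPDFReal_eq_one 0 one_ne_zero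

theorem integrable_id_mul_gaussianPDFReal :
    Integrable (fun t : ℝ => t * gaussianPDFReal 0 1 t) := by
  have h := (memLp_id_gaussianReal (μ := 0) (v := 1) 1).integrable le_rfl
  rw [gaussianReal_of_var_ne_zero 0 one_ne_zero, gaussianPDF_def,
    integrable_withDensity_iff (by fun_prop) (by simp)] at h
  refine h.congr (ae_of_all _ fun t => ?_)
  simp [ENNReal.toReal_ofReal (gaussianPDFReal_nonneg 0 1 t)]

/-- `δN(0,1)`, with density `t ↦ t * (2π)^(-1/2) * exp (-t²/2)`: the derivative at `θ = 0` of the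
Gaussian shift family `N(θ,1)`. -/
def gaussTangent : Tangent (.euclid 1) :=
  ⟨(measurePreserving_eval_zero.integrable_comp_of_integrable
    integrable_id_mul_gaussianPDFReal).toL1 _, by
    change ∫ x, _ ∂_ = 0
    rw [integral_congr_ae (Integrable.coeFn_toL1 _)]
    refine ((volume_preserving_funUnique (Fin 1) ℝ).integral_comp'
      (fun t => t * gaussianPDFReal 0 1 t)).trans ?_
    have h := integral_gaussianReal_eq_integral_smul (μ := 0) (v := 1) (f := fun t : ℝ => t)
      one_ne_zero
    rw [integral_id_gaussianReal] at h
    refine Eq.trans ?_ h.symm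
    exact integral_congr_ae (ae_of_all _ fun t => mul_comm _ _)⟩

/-! ### Metrics and axioms -/

/-- A candidate metric: a number `g p δ` in `[0, ∞]` for every data space `Ω`, every density `p`
on `Ω` and every tangent vector `δ` at `p`. The value `∞` is allowed, as it has to be for Fisher
information, e.g. when `δ` is not supported by `p`. -/
abbrev Metric : Type := ∀ Ω : DataSpace, Density Ω → Tangent Ω → ℝ≥0∞

/-- An extended norm: it has all properties of a norm but may be infinite. -/
structure IsExtNorm {E : Type} [AddCommGroup E] [Module ℝ E] (N : E → ℝ≥0∞) : Prop where
  eq_zero_iff : ∀ v, N v = 0 ↔ v = 0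
  smul : ∀ (c : ℝ) (v : E), N (c • v) = ENNReal.ofReal |c| * N v
  add_le : ∀ v w, N (v + w) ≤ N v + N w

/-- At every `p`, the metric is the square of an (extended) norm on the tangent space. -/
def IsNormSq (g : Metric) : Prop :=
  ∀ (Ω : DataSpace) (p : Density Ω), ∃ N : Tangent Ω → ℝ≥0∞, IsExtNorm N ∧ ∀ δ, g Ω p δ = N δ ^ 2

/-- (M0): monotonicity under channels. -/
def AxiomM0 (g : Metric) : Prop :=
  ∀ (Ω Ω' : DataSpace) (Ψ : Channel Ω Ω') (p : Density Ω) (δ : Tangent Ω),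
    g Ω' (Ψ.density p) (Ψ.tangent δ) ≤ g Ω p δ

/-- (A0): weak asymptotic additivity. -/
def AxiomA0 (g : Metric) : Prop :=
  ∀ (Ω : DataSpace) (p : Density Ω) (δ : Tangent Ω),
    Tendsto (fun n : ℕ => g (Ω.pow n) (p.pow n) (tangentPow p δ n) / n) atTop (𝓝 (g Ω p δ))

/-- (C0): lower asymptotic continuity, at all `p`, `δ` with `g p δ < ∞`. (Under (A0), the
subtracted term is then finite for all large `n`.) -/
def AxiomC0 (g : Metric) : Prop :=
  ∀ (Ω : DataSpace) (p : Density Ω) (δ : Tangent Ω), g Ω p δ ≠ ∞ →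
    ∀ (q : ∀ n : ℕ, Density (Ω.pow n)) (δ' : ∀ n : ℕ, Tangent (Ω.pow n)),
      Tendsto (fun n : ℕ => ‖(q n).val - (p.pow n).val‖) atTop (𝓝 0) →
      Tendsto (fun n : ℕ => 1 / √(n : ℝ) * ‖δ' n - tangentPow p δ n‖) atTop (𝓝 0) →
      0 ≤ liminf (fun n : ℕ => ((g (Ω.pow n) (q n) (δ' n) : EReal) -
        (g (Ω.pow n) (p.pow n) (tangentPow p δ n) : EReal)) / (n : EReal)) atTop

/-- (N0): normalization at the standard Gaussian shift. -/
def AxiomN0 (g : Metric) : Prop :=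
  g (.euclid 1) gaussDensity gaussTangent = 1

/-- `g` is a metric (square of an extended norm) satisfying (M0), (A0), (C0) and (N0). -/
structure SatisfiesAxioms (g : Metric) : Prop where
  normSq : IsNormSq g
  m0 : AxiomM0 g
  a0 : AxiomA0 g
  c0 : AxiomC0 g
  n0 : AxiomN0 g

/-! ### Fisher information and the score -/

/-- Fisher information `J_p(δ) = ∫ δ² / p`, with the conventions `0 / 0 = 0` and `a / 0 = ∞`
for `a > 0` (these are the conventions of division in `ℝ≥0∞`). -/
def fisher : Metric := fun Ω p δ =>
  ∫⁻ x, ENNReal.ofReal ((δ.1 x) ^ 2) / ENNReal.ofReal (p.val x) ∂Ω.refMeasure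

variable {Ω : DataSpace}

/-- The score `L = δ / p` exists: `δ` vanishes almost everywhere where `p` does. -/
def HasScore (p : Density Ω) (δ : Tangent Ω) : Prop :=
  ∀ᵐ x ∂Ω.refMeasure, p.val x = 0 → δ.1 x = 0

/-- The score `L = δ / p`. -/
def score (p : Density Ω) (δ : Tangent Ω) (x : Ω.Carrier) : ℝ := δ.1 x / p.val x

/-- The probability distribution with density `p`. -/
def Density.toMeasure (p : Density Ω) : Measure Ω.Carrier :=
  Ω.refMeasure.withDensity fun x => ENNReal.ofReal (p.val x)

/-- The law of the score `L` under `p`. -/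
def scoreLaw (p : Density Ω) (δ : Tangent Ω) : Measure ℝ := p.toMeasure.map (score p δ)

/-- `E_p L^4 < ∞`. -/
def FiniteFourthMoment (p : Density Ω) (δ : Tangent Ω) : Prop :=
  ∫⁻ x, ENNReal.ofReal (score p δ x ^ 4) ∂p.toMeasure < ∞

/-- `f` is a probability density of the score `L` with respect to Lebesgue measure. -/
structure IsScoreDensity (p : Density Ω) (δ : Tangent Ω) (f : ℝ → ℝ) : Prop where
  measurable : Measurable f
  nonneg : ∀ t, 0 ≤ f t
  law_eq : scoreLaw p δ = volume.withDensity fun t => ENNReal.ofReal (f t)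

/-- The moment condition `E ((∫_{-∞}^L (-t) f(t) dt) / (J f(L)))² < ∞` for a density `f` of the
score `L`, with `J = J_p(δ)`. -/
def WVariance (p : Density Ω) (δ : Tangent Ω) (f : ℝ → ℝ) : Prop :=
  ∫⁻ l, ENNReal.ofReal
    (((∫ t in Set.Iic l, (-t) * f t) / ((fisher Ω p δ).toReal * f l)) ^ 2) ∂scoreLaw p δ < ∞

end InfoMetric

end

open InfoMetric

open scoped NNReal

noncomputable section

namespace InfoMetric

/-! ### Normalized sums -/

/-! Channels in both directions compare (p^{⊗n}, δ^{(n)}) with the Gaussian shift, and (A0) and (C0)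
turn approximate equality of pairs into an inequality for g. By homogeneity take J_p(δ) = 1: the
score L is centred with variance 1, and δ^{(n)} has score √n S_n, where S_n = n^{-1/2} Σ L(x_i) is
asymptotically standard Gaussian. The central limit theorem gives only weak convergence, whereas
(C0) asks for L₁. So Gaussian noise is mixed in: for 0 < a < 1, a S_n + √(1-a²) Z has an explicit
density, which converges pointwise by the central limit theorem and in L₁ by Scheffé's lemma.

Lower bound (`SatisfiesAxioms.sq_le`). Write φ for the standard Gaussian density. Reporting a S_n +
√(1-a²) Z is a channel to the line whose output is close to (φ, √n a y φ). The normalized sum is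
sufficient for the Gaussian shift, so a further channel (`exists_channel_lift`) turns this into a
pair close to the n-th power of (φ, a y φ). Monotonicity, (C0) at the Gaussian point, (A0) and (N0)
yield a² ≤ g_p(δ); let a → 1.

Upper bound. If L has itself the form a X + √(1-a²) Z in law, then S_n has a positive density r_n
close to φ, and a channel from the line to Ωⁿ maps (r_n, √n y r_n) exactly to (p^{⊗n}, δ^{(n)}). Fed
with (φ, √n y φ), which has g = n, it produces a pair close to (p^{⊗n}, δ^{(n)}), so g_p(δ) ≤ 1 by
(C0), provided g_p(δ) < ∞ (`SatisfiesAxioms.le_one_of_scoreLaw`). For general L on ℝ^d an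
independent Gaussian coordinate is adjoined and the direction is mixed with its shift, so that the
score becomes a L + √(1-a²) Z; forgetting the coordinate returns aδ. Thus a² g_p(δ) ≤ 1
(`SatisfiesAxioms.sq_mul_le_one`).

A finite set is a retract of the line, and finiteness of g is automatic there because the score is
bounded. For the converse, Fisher information is a weighted squared L₂ norm; (M0) is a
Cauchy–Schwarz inequality for positive maps, (A0) is additivity of variance, and (C0) follows from
the variational formula for J tested on truncations of S_n. -/

/-- The law of `(X₁ + ⋯ + Xₙ) / √n` for independent `Xᵢ` with law `lam`. -/
def stdSum (lam : Measure ℝ) (n : ℕ) : Measure ℝ :=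
  (Measure.pi fun _ : Fin n => lam).map fun x => (√(n : ℝ))⁻¹ * ∑ i, x i

/-- `lam` is a centered probability distribution with unit variance. -/
structure IsStandardized (lam : Measure ℝ) : Prop where
  isProb : IsProbabilityMeasure lam
  memLp : MemLp id 2 lam
  mean : ∫ x, x ∂lam = 0
  second : ∫ x, x ^ 2 ∂lam = 1

instance isProbabilityMeasure_stdSum (lam : Measure ℝ) [IsProbabilityMeasure lam] (n : ℕ) :
    IsProbabilityMeasure (stdSum lam n) :=
  Measure.isProbabilityMeasure_map (by fun_prop)

theorem charFun_stdSum (lam : Measure ℝ) [IsProbabilityMeasure lam] (n : ℕ) (t : ℝ) :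
    charFun (stdSum lam n) t = charFun lam ((√(n : ℝ))⁻¹ * t) ^ n := by
  rw [stdSum, charFun_map_mul_comp (by fun_prop), charFun_map_sum_pi_eq_prod]
  simp

/-- The central limit theorem, in the form in which it enters all later limits: pointwise
convergence of characteristic functions and Lévy's continuity theorem. -/
theorem tendsto_integral_stdSum {lam : Measure ℝ} (h : IsStandardized lam) {F : ℝ → ℝ}
    (hF : Continuous F) {C : ℝ} (hC : ∀ x, |F x| ≤ C) :
    Tendsto (fun n => ∫ x, F x ∂stdSum lam n) atTop (𝓝 (∫ x, F x ∂gaussianReal 0 1)) := by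
  have := h.isProb
  let ν : ℕ → ProbabilityMeasure ℝ := fun n => ⟨stdSum lam n, inferInstance⟩
  let γ : ProbabilityMeasure ℝ := ⟨gaussianReal 0 1, inferInstance⟩
  have key : Tendsto ν atTop (𝓝 γ) := by
    refine ProbabilityMeasure.tendsto_iff_tendsto_charFun.2 fun t => ?_
    have h2 := tendsto_charFun_inv_sqrt_mul_pow (P := lam) (X := id) aemeasurable_id
      (by simpa using h.mean) (by simpa using h.second) t
    rw [Measure.map_id] at h2
    change Tendsto (fun n => charFun (stdSum lam n) t) atTop (𝓝 (charFun (gaussianReal 0 1) t))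
    simp_rw [charFun_stdSum, charFun_gaussianReal]
    simpa [neg_div] using h2
  exact ProbabilityMeasure.tendsto_iff_forall_integral_tendsto.1 key
    (BoundedContinuousFunction.ofNormedAddCommGroup F hF C hC)

/-! ### Mean and variance of normalized sums -/

section Moments
variable {lam : Measure ℝ} (h : IsStandardized lam) (n : ℕ)
include h

theorem IsStandardized.memLp_stdSum : MemLp id 2 (stdSum lam n) := by
  have := h.isProb
  rw [stdSum, memLp_map_measure_iff (by fun_prop) (by fun_prop)]
  refine MemLp.const_mul ?_ _
  exact memLp_finsetSum _ fun i _ =>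
    h.memLp.comp_measurePreserving (measurePreserving_eval (fun _ : Fin n => lam) i)

theorem IsStandardized.integral_stdSum : ∫ x, x ∂stdSum lam n = 0 := by
  have := h.isProb
  rw [stdSum, integral_map (by fun_prop) (by fun_prop), integral_const_mul,
    integral_finsetSum]
  · have (i : Fin n) : ∫ x : Fin n → ℝ, x i ∂Measure.pi (fun _ => lam) = 0 := by
      rw [← h.mean]
      exact integral_comp_eval (μ := fun _ : Fin n => lam) (f := fun x => x) (by fun_prop)
    simp [this]
  · intro i _
    exact (h.memLp.comp_measurePreserving
      (measurePreserving_eval (fun _ : Fin n => lam) i)).integrable (by norm_num)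

theorem IsStandardized.integral_sq_stdSum (hn : n ≠ 0) : ∫ x, x ^ 2 ∂stdSum lam n = 1 := by
  have := h.isProb
  have h1 : Var[id; stdSum lam n] = 1 := by
    have e : Var[id; lam] = 1 := by
      rw [variance_of_integral_eq_zero (X := id) (by fun_prop) h.mean]; exact h.second
    have e2 := variance_sum_pi (μ := fun _ : Fin n => lam) (X := fun _ => id) fun _ => h.memLp
    rw [stdSum, variance_map (by fun_prop) (by fun_prop)]
    have e3 : (id ∘ fun x : Fin n → ℝ => (√(n : ℝ))⁻¹ * ∑ i, x i) =
        fun x => (√(n : ℝ))⁻¹ * (∑ i : Fin n, fun ω : Fin n → ℝ => id (ω i)) x := by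
      ext x; simp
    rw [e3, variance_const_mul, e2, e]
    simp [hn]
  rwa [variance_of_integral_eq_zero (X := id) (by fun_prop) (h.integral_stdSum n)] at h1

end Moments

theorem isStandardized_gaussianReal : IsStandardized (gaussianReal 0 1) where
  isProb := inferInstance
  memLp := memLp_id_gaussianReal 2
  mean := integral_id_gaussianReal
  second := by
    have := variance_id_gaussianReal (μ := 0) (v := 1)
    rwa [variance_of_integral_eq_zero (X := id) (by fun_prop) integral_id_gaussianReal] at this

theorem stdSum_gaussianReal {n : ℕ} (hn : n ≠ 0) :
    stdSum (gaussianReal 0 1) n = gaussianReal 0 1 := by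
  refine Measure.ext_of_charFun (funext fun t => ?_)
  rw [charFun_stdSum, charFun_gaussianReal, charFun_gaussianReal, ← Complex.exp_nat_mul]
  congr 1
  have h1 : ((√(n : ℝ) : ℝ) : ℂ) ^ 2 = n := by
    rw [← Complex.ofReal_pow, Real.sq_sqrt (Nat.cast_nonneg n)]; simp
  have h2 : (n : ℂ) ≠ 0 := by exact_mod_cast hn
  push_cast
  rw [mul_pow, inv_pow, h1]
  field_simp
  ring

/-! ### Scheffé's lemma -/

/-- The positive part of F - f_n is dominated by F, hence tends to 0 in L₁; equality of the
integrals makes the negative part equally small. Equality is required only eventually because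
`stdSum lam 0` is a point mass, without unit variance. -/
theorem tendsto_integral_abs_sub_of_integral_eq {α : Type*} [MeasurableSpace α] {μ : Measure α}
    {f : ℕ → α → ℝ} {F : α → ℝ} (hf : ∀ n, Integrable (f n) μ) (hF : Integrable F μ)
    (h0 : ∀ n x, 0 ≤ f n x) (hF0 : ∀ x, 0 ≤ F x)
    (heq : ∀ᶠ n in atTop, ∫ x, f n x ∂μ = ∫ x, F x ∂μ)
    (hlim : ∀ x, Tendsto (fun n => f n x) atTop (𝓝 (F x))) :
    Tendsto (fun n => ∫ x, |f n x - F x| ∂μ) atTop (𝓝 0) := by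
  have h1 : Tendsto (fun n => ∫ x, max (F x - f n x) 0 ∂μ) atTop (𝓝 (∫ _, (0 : ℝ) ∂μ)) := by
    refine tendsto_integral_of_dominated_convergence F
      (fun n => (hF.sub (hf n)).pos_part.aestronglyMeasurable) hF ?_ ?_
    · refine fun n => ae_of_all _ fun x => ?_
      rw [Real.norm_of_nonneg (le_max_right _ _)]
      exact max_le (by linarith [h0 n x]) (hF0 x)
    · refine ae_of_all _ fun x => ?_
      have : Tendsto (fun n => max (F x - f n x) 0) atTop (𝓝 (max (F x - F x) 0)) :=
        (tendsto_const_nhds.sub (hlim x)).max tendsto_const_nhds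
      simpa using this
  have h2 : ∀ᶠ n in atTop, ∫ x, |f n x - F x| ∂μ = 2 * ∫ x, max (F x - f n x) 0 ∂μ := by
    filter_upwards [heq] with n hn
    -- The last summand integrates to zero.
    have e : ∀ x, |f n x - F x| = 2 * max (F x - f n x) 0 + (f n x - F x) := fun x => by
      rcases le_total (F x) (f n x) with h | h
      · rw [abs_of_nonneg (by linarith), max_eq_right (by linarith)]; ring
      · rw [abs_of_nonpos (by linarith), max_eq_left (by linarith)]; ring
    simp_rw [e]
    have i1 : Integrable (fun x => max (F x - f n x) 0) μ := (hF.sub (hf n)).pos_part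
    have i2 : Integrable (fun x => f n x - F x) μ := (hf n).sub hF
    rw [integral_add (i1.const_mul 2) i2, integral_const_mul,
      integral_sub (hf n) hF, hn]
    ring
  rw [integral_zero] at h1
  have h3 := h1.const_mul 2
  rw [mul_zero] at h3
  exact h3.congr' (h2.mono fun n hn => hn.symm)

/-! ### The Gaussian kernel with correlation `a` -/

/-- Density at `y` of `a s + √(1 - a²) Z` with `Z` standard Gaussian. -/
def mehler (a s y : ℝ) : ℝ := gaussianPDFReal (a * s) (Real.toNNReal (1 - a ^ 2)) y

theorem measurable_mehler_comp (a : ℝ) {α : Type*} [MeasurableSpace α] {f h : α → ℝ}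
    (hf : Measurable f) (hh : Measurable h) : Measurable fun x => mehler a (f x) (h x) := by
  unfold mehler
  simp only [gaussianPDFReal]
  fun_prop

theorem measurable_mehler (a : ℝ) : Measurable fun x : ℝ × ℝ => mehler a x.1 x.2 :=
  measurable_mehler_comp a measurable_fst measurable_snd

theorem mehler_nonneg (a s y : ℝ) : 0 ≤ mehler a s y := gaussianPDFReal_nonneg _ _ _

section Mehler
variable {a : ℝ} (ha : a ^ 2 < 1)
include ha

theorem toNNReal_one_sub_sq_ne_zero : Real.toNNReal (1 - a ^ 2) ≠ 0 := by
  simpa using ha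

theorem mehler_pos (s y : ℝ) : 0 < mehler a s y :=
  gaussianPDFReal_pos _ _ _ (toNNReal_one_sub_sq_ne_zero ha)

theorem mehler_eq (s y : ℝ) : mehler a s y =
    (√(2 * Real.pi * (1 - a ^ 2)))⁻¹ * Real.exp (-(y - a * s) ^ 2 / (2 * (1 - a ^ 2))) := by
  rw [mehler, gaussianPDFReal, Real.coe_toNNReal _ (by linarith)]

theorem integral_mehler (s : ℝ) : ∫ y, mehler a s y = 1 :=
  integral_gaussianPDFReal_eq_one _ (toNNReal_one_sub_sq_ne_zero ha)

omit ha in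
theorem integrable_mehler (s : ℝ) : Integrable (mehler a s) := integrable_gaussianPDFReal _ _

theorem memLp_id_mehler (s : ℝ) : Integrable (fun y => y ^ 2 * mehler a s y) := by
  have h := (memLp_id_gaussianReal (μ := a * s) (v := Real.toNNReal (1 - a ^ 2)) 2).integrable_sq
  rw [gaussianReal_of_var_ne_zero _ (toNNReal_one_sub_sq_ne_zero ha), gaussianPDF_def,
    integrable_withDensity_iff (by fun_prop) (by simp)] at h
  refine h.congr (ae_of_all _ fun t => ?_)
  simp [ENNReal.toReal_ofReal (gaussianPDFReal_nonneg _ _ t), mehler]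

theorem integral_mul_mehler (s : ℝ) (F : ℝ → ℝ) : ∫ y, F y * mehler a s y =
    ∫ y, F y ∂gaussianReal (a * s) (Real.toNNReal (1 - a ^ 2)) := by
  rw [integral_gaussianReal_eq_integral_smul (toNNReal_one_sub_sq_ne_zero ha)]
  simp [mehler, mul_comm]

theorem integral_id_mul_mehler (s : ℝ) : ∫ y, y * mehler a s y = a * s := by
  rw [integral_mul_mehler ha, integral_id_gaussianReal]

theorem integral_sq_mul_mehler (s : ℝ) :
    ∫ y, y ^ 2 * mehler a s y = (a * s) ^ 2 + (1 - a ^ 2) := by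
  rw [integral_mul_mehler ha]
  have h1 := variance_id_gaussianReal (μ := a * s) (v := Real.toNNReal (1 - a ^ 2))
  rw [variance_eq_sub (memLp_id_gaussianReal 2)] at h1
  simp only [id, Pi.pow_apply, integral_id_gaussianReal, Real.coe_toNNReal _ (by linarith : 0 ≤ 1 - a ^ 2)] at h1
  linarith

/-- Detailed balance: (s, y) is a centred Gaussian pair with unit variances and correlation a, so
its joint density is symmetric. The Gaussian averages of the kernel are read off from this. -/
theorem gaussianPDFReal_mul_mehler (s y : ℝ) :
    gaussianPDFReal 0 1 s * mehler a s y = gaussianPDFReal 0 1 y * mehler a y s := by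
  rw [mehler_eq ha, mehler_eq ha]
  simp only [gaussianPDFReal]
  simp only [mul_mul_mul_comm _ (Real.exp _) _ (Real.exp _), ← Real.exp_add]
  congr 2
  have : 1 - a ^ 2 ≠ 0 := by linarith
  simp only [NNReal.coe_one]
  field_simp
  ring

theorem integral_mehler_gaussianReal (y : ℝ) :
    ∫ s, mehler a s y ∂gaussianReal 0 1 = gaussianPDFReal 0 1 y := by
  rw [integral_gaussianReal_eq_integral_smul one_ne_zero]
  simp_rw [smul_eq_mul, gaussianPDFReal_mul_mehler ha]
  rw [integral_const_mul, integral_mehler ha, mul_one]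

theorem integral_id_mul_mehler_gaussianReal (y : ℝ) :
    ∫ s, s * mehler a s y ∂gaussianReal 0 1 = a * (y * gaussianPDFReal 0 1 y) := by
  rw [integral_gaussianReal_eq_integral_smul one_ne_zero]
  have (s : ℝ) : gaussianPDFReal 0 1 s • (s * mehler a s y) =
      gaussianPDFReal 0 1 y * (s * mehler a y s) := by
    rw [smul_eq_mul, mul_left_comm, gaussianPDFReal_mul_mehler ha]; ring
  simp_rw [this]
  rw [integral_const_mul, integral_id_mul_mehler ha]
  ring

theorem continuous_mehler (y : ℝ) : Continuous fun s => mehler a s y := by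
  simp_rw [mehler_eq ha]
  fun_prop

theorem integrable_mehler_left {ν : Measure ℝ} [IsFiniteMeasure ν] (y : ℝ) :
    Integrable (fun s => mehler a s y) ν := by
  refine Integrable.of_bound (continuous_mehler ha y).aestronglyMeasurable
    (√(2 * Real.pi * (1 - a ^ 2)))⁻¹ (ae_of_all _ fun s => ?_)
  rw [Real.norm_of_nonneg (mehler_nonneg a s y), mehler_eq ha]
  refine mul_le_of_le_one_right (by positivity) (Real.exp_le_one_iff.2 ?_)
  exact div_nonpos_of_nonpos_of_nonneg (by nlinarith [sq_nonneg (y - a * s)]) (by linarith)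

/-- The kernel decays like a Gaussian in s when a > 0, which beats s². Hence weights of quadratic
growth times the kernel are bounded test functions for the central limit theorem. -/
theorem exists_bound_mehler (ha0 : 0 < a) (y : ℝ) : ∃ C, ∀ s, (1 + s ^ 2) * mehler a s y ≤ C := by
  set v := 1 - a ^ 2 with hv
  have hv0 : 0 < v := by linarith
  refine ⟨(√(2 * Real.pi * v))⁻¹ * (1 + (2 * y ^ 2 + 4 * v) / a ^ 2), fun s => ?_⟩
  rw [mehler_eq ha, ← hv, mul_left_comm]
  refine mul_le_mul_of_nonneg_left ?_ (by positivity)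
  set x := (y - a * s) ^ 2 / (2 * v) with hx
  have hx0 : 0 ≤ x := by positivity
  have e1 : (y - a * s) ^ 2 = 2 * v * x := by rw [hx]; field_simp
  have e2 : -(y - a * s) ^ 2 / (2 * v) = -x := by rw [hx]; ring
  rw [e2]
  have h1 : Real.exp (-x) ≤ 1 := by simpa using hx0
  have h2 : x * Real.exp (-x) ≤ 1 := by
    rw [Real.exp_neg, ← div_eq_mul_inv, div_le_one (Real.exp_pos x)]
    linarith [Real.add_one_le_exp x]
  have h3 : s ^ 2 ≤ (2 * y ^ 2 + 4 * v * x) / a ^ 2 := by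
    rw [le_div_iff₀ (by positivity)]
    -- This is (a s)² ≤ 2y² + 2(y - a s)².
    nlinarith [sq_nonneg (y + (y - a * s)), sq_nonneg (2 * y - a * s)]
  have h4 := (Real.exp_pos (-x)).le
  calc (1 + s ^ 2) * Real.exp (-x)
      ≤ (1 + (2 * y ^ 2 + 4 * v * x) / a ^ 2) * Real.exp (-x) := by gcongr
    _ = Real.exp (-x) + (2 * y ^ 2 * Real.exp (-x) + 4 * v * (x * Real.exp (-x))) / a ^ 2 := by
        ring
    _ ≤ 1 + (2 * y ^ 2 * 1 + 4 * v * 1) / a ^ 2 := by gcongr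
    _ = _ := by ring

end Mehler

/-! ### Smoothed densities of normalized sums -/

/-- The function `y ↦ ∫ w(s) k(s, y) dν(s)` for the Gaussian kernel `k` with correlation `a`. -/
def smooth (a : ℝ) (w : ℝ → ℝ) (ν : Measure ℝ) (y : ℝ) : ℝ := ∫ s, w s * mehler a s y ∂ν

section Smooth
variable {a : ℝ} (ha : a ^ 2 < 1) {w : ℝ → ℝ} {ν : Measure ℝ}

include ha in
theorem integrable_prod_mehler [SFinite ν] (hw : Integrable w ν) :
    Integrable (fun x : ℝ × ℝ => w x.1 * mehler a x.1 x.2) (ν.prod volume) := by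
  have hm : AEStronglyMeasurable (fun x : ℝ × ℝ => w x.1 * mehler a x.1 x.2) (ν.prod volume) :=
    (hw.aestronglyMeasurable.comp_fst).mul (measurable_mehler a).aestronglyMeasurable
  rw [integrable_prod_iff hm]
  refine ⟨ae_of_all _ fun s => (integrable_mehler (a := a) s).const_mul (w s), ?_⟩
  refine hw.norm.congr (ae_of_all _ fun s => ?_)
  simp only [norm_mul, Real.norm_of_nonneg (mehler_nonneg a s _)]
  rw [integral_const_mul, integral_mehler ha, mul_one]

include ha in
theorem integrable_smooth [SFinite ν] (hw : Integrable w ν) : Integrable (smooth a w ν) :=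
  (integrable_prod_mehler ha hw).integral_prod_right

include ha in
theorem integral_smooth [SFinite ν] (hw : Integrable w ν) :
    ∫ y, smooth a w ν y = ∫ s, w s ∂ν := by
  unfold smooth
  rw [← integral_integral_swap (integrable_prod_mehler ha hw)]
  simp_rw [integral_const_mul, integral_mehler ha, mul_one]

theorem smooth_nonneg (hw : ∀ s, 0 ≤ w s) (y : ℝ) : 0 ≤ smooth a w ν y :=
  integral_nonneg fun s => mul_nonneg (hw s) (mehler_nonneg a s y)

variable {lam : Measure ℝ} (h : IsStandardized lam)

include ha h in
theorem tendsto_smooth (ha0 : 0 < a) (hw : Continuous w) {C : ℝ} (hC : ∀ s, |w s| ≤ C * (1 + s ^ 2))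
    (y : ℝ) : Tendsto (fun n => smooth a w (stdSum lam n) y) atTop
      (𝓝 (smooth a w (gaussianReal 0 1) y)) := by
  obtain ⟨D, hD⟩ := exists_bound_mehler ha ha0 y
  refine tendsto_integral_stdSum h (hw.mul (continuous_mehler ha y)) (C := C * D) fun s => ?_
  have hC0 : 0 ≤ C := by have := (abs_nonneg _).trans (hC 0); simpa using this
  rw [abs_mul, abs_of_nonneg (mehler_nonneg a s y)]
  calc |w s| * mehler a s y ≤ C * (1 + s ^ 2) * mehler a s y :=
        mul_le_mul_of_nonneg_right (hC s) (mehler_nonneg a s y)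
    _ = C * ((1 + s ^ 2) * mehler a s y) := by ring
    _ ≤ C * D := by gcongr; exact hD s

end Smooth

/-! ### L₁ convergence of the smoothed densities -/

section Limits
variable {lam : Measure ℝ} (h : IsStandardized lam)
include h

theorem IsStandardized.stdSum {n : ℕ} (hn : n ≠ 0) : IsStandardized (stdSum lam n) := by
  have := h.isProb
  exact ⟨inferInstance, h.memLp_stdSum n, h.integral_stdSum n, h.integral_sq_stdSum n hn⟩

theorem IsStandardized.integrable_quadratic (b c d : ℝ) :
    Integrable (fun s => b + c * s + d * s ^ 2) lam := by
  have := h.isProb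
  exact (((integrable_const b).add ((h.memLp.integrable (by norm_num)).const_mul c))).add
    (h.memLp.integrable_sq.const_mul d)

theorem IsStandardized.integral_quadratic (b c d : ℝ) :
    ∫ s, (b + c * s + d * s ^ 2) ∂lam = b + d := by
  have := h.isProb
  have i1 : Integrable (fun s => c * s) lam := (h.memLp.integrable (by norm_num)).const_mul c
  have i2 : Integrable (fun s => d * s ^ 2) lam := h.memLp.integrable_sq.const_mul d
  have i3 : Integrable (fun s => b + c * s) lam := (integrable_const b).add i1
  rw [integral_add i3 i2, integral_add (integrable_const b) i1,
    integral_const_mul, integral_const_mul, h.mean, h.second]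
  simp

variable {a : ℝ} (ha : a ^ 2 < 1) (ha0 : 0 < a)
include ha ha0

theorem tendsto_smooth_quadratic (b c d y : ℝ) :
    Tendsto (fun n => smooth a (fun s => b + c * s + d * s ^ 2) (stdSum lam n) y) atTop
      (𝓝 (smooth a (fun s => b + c * s + d * s ^ 2) (gaussianReal 0 1) y)) := by
  refine tendsto_smooth ha h ha0 (by fun_prop) (C := |b| + |c| + |d|) (fun s => ?_) y
  have h1 : |b + c * s + d * s ^ 2| ≤ |b| + |c| * |s| + |d| * s ^ 2 := by
    calc _ ≤ |b| + |c * s| + |d * s ^ 2| := abs_add_three _ _ _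
      _ = _ := by rw [abs_mul, abs_mul, abs_of_nonneg (sq_nonneg s)]
  have h2 : |s| ≤ 1 + s ^ 2 := by
    rw [← sq_abs]; nlinarith [sq_nonneg (|s| - 1), abs_nonneg s]
  nlinarith [abs_nonneg b, abs_nonneg c, abs_nonneg d, sq_nonneg s,
    mul_le_mul_of_nonneg_left h2 (abs_nonneg c), mul_nonneg (abs_nonneg b) (sq_nonneg s)]

/-- Scheffé's lemma applies to nonnegative quadratic weights: smoothing preserves the total
integral, and for every standardized law that integral is b + d, so the masses agree with the
Gaussian one for n ≠ 0. -/
theorem tendsto_integral_abs_smooth_quadratic {b c d : ℝ} (hw : ∀ s, 0 ≤ b + c * s + d * s ^ 2) :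
    Tendsto (fun n => ∫ y, |smooth a (fun s => b + c * s + d * s ^ 2) (stdSum lam n) y -
      smooth a (fun s => b + c * s + d * s ^ 2) (gaussianReal 0 1) y|) atTop (𝓝 0) := by
  have := h.isProb
  have hγ := isStandardized_gaussianReal
  have hq (n : ℕ) : Integrable (fun s => b + c * s + d * s ^ 2) (stdSum lam n) := by
    have hm := h.memLp_stdSum n
    exact (((integrable_const b).add ((hm.integrable (by norm_num)).const_mul c))).add
      (hm.integrable_sq.const_mul d)
  refine tendsto_integral_abs_sub_of_integral_eq (fun n => integrable_smooth ha (hq n))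
    (integrable_smooth ha (hγ.integrable_quadratic b c d)) (fun n y => smooth_nonneg hw y)
    (fun y => smooth_nonneg hw y) ?_ (tendsto_smooth_quadratic h ha ha0 b c d)
  filter_upwards [eventually_ne_atTop 0] with n hn
  rw [integral_smooth ha (hq n), integral_smooth ha (hγ.integrable_quadratic b c d),
    (h.stdSum hn).integral_quadratic, hγ.integral_quadratic]

/-- The density of `a S + √(1 - a²) Z`, with `S` a normalized sum and `Z` an independent standard
Gaussian, converges in `L₁` to the Gaussian density. -/
theorem tendsto_smooth_one :
    Tendsto (fun n => ∫ y, |smooth a 1 (stdSum lam n) y - gaussianPDFReal 0 1 y|) atTop (𝓝 0) := by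
  have := tendsto_integral_abs_smooth_quadratic h ha ha0 (b := 1) (c := 0) (d := 0) (by simp)
  refine this.congr fun n => integral_congr_ae (ae_of_all _ fun y => ?_)
  simp only [smooth, zero_mul, add_zero, one_mul, Pi.one_apply, integral_mehler_gaussianReal ha]

/-- The weight s changes sign, so Scheffé's lemma is not directly available. Instead s = ((1 + s)² -
(1 + s²)) / 2 is a difference of nonnegative quadratic weights. -/
theorem tendsto_smooth_id :
    Tendsto (fun n => ∫ y, |smooth a id (stdSum lam n) y - a * (y * gaussianPDFReal 0 1 y)|) atTop
      (𝓝 0) := by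
  have := h.isProb
  have t1 := tendsto_integral_abs_smooth_quadratic h ha ha0 (b := 1) (c := 2) (d := 1)
    (fun s => by nlinarith [sq_nonneg (1 + s)])
  have t2 := tendsto_integral_abs_smooth_quadratic h ha ha0 (b := 1) (c := 0) (d := 1)
    (fun s => by nlinarith [sq_nonneg s])
  have t3 := t1.add t2
  rw [add_zero] at t3
  have hq (n : ℕ) (hn : n ≠ 0) (b c d : ℝ) := (h.stdSum hn).integrable_quadratic b c d
  have hγ := isStandardized_gaussianReal
  have key (ν : Measure ℝ) (hν : IsStandardized ν) (y : ℝ) : smooth a id ν y =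
      (smooth a (fun s => 1 + 2 * s + 1 * s ^ 2) ν y -
        smooth a (fun s => 1 + 0 * s + 1 * s ^ 2) ν y) / 2 := by
    have := hν.isProb
    obtain ⟨D, hD⟩ := exists_bound_mehler ha ha0 y
    have hm : AEStronglyMeasurable (fun s => mehler a s y) ν :=
      (continuous_mehler ha y).aestronglyMeasurable
    have hb : ∀ᵐ s ∂ν, ‖mehler a s y‖ ≤ D := ae_of_all _ fun s => by
      rw [Real.norm_of_nonneg (mehler_nonneg a s y)]
      nlinarith [hD s, mul_nonneg (sq_nonneg s) (mehler_nonneg a s y)]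
    have i1 := (hν.integrable_quadratic 1 2 1).mul_bdd hm hb
    have i2 := (hν.integrable_quadratic 1 0 1).mul_bdd hm hb
    unfold smooth
    rw [← integral_sub i1 i2, ← integral_div]
    refine integral_congr_ae (ae_of_all _ fun s => ?_)
    simp only [id]
    ring
  refine squeeze_zero' (.of_forall fun n => integral_nonneg fun y => abs_nonneg _) ?_ t3
  filter_upwards [eventually_ne_atTop 0] with n hn
  have j (b c d : ℝ) : Integrable (fun y => |smooth a (fun s => b + c * s + d * s ^ 2)
      (stdSum lam n) y - smooth a (fun s => b + c * s + d * s ^ 2) (gaussianReal 0 1) y|) :=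
    ((integrable_smooth ha (hq n hn b c d)).sub
      (integrable_smooth ha (hγ.integrable_quadratic b c d))).abs
  rw [← integral_add (j 1 2 1) (j 1 0 1)]
  refine integral_mono_of_nonneg (ae_of_all _ fun y => abs_nonneg _) ((j 1 2 1).add (j 1 0 1))
    (ae_of_all _ fun y => ?_)
  have e : a * (y * gaussianPDFReal 0 1 y) = smooth a id (gaussianReal 0 1) y :=
    (integral_id_mul_mehler_gaussianReal ha y).symm
  beta_reduce
  rw [e, key _ (h.stdSum hn), key _ hγ]
  set A := smooth a (fun s => 1 + 2 * s + 1 * s ^ 2) (stdSum lam n) y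
  set B := smooth a (fun s => 1 + 0 * s + 1 * s ^ 2) (stdSum lam n) y
  set A' := smooth a (fun s => 1 + 2 * s + 1 * s ^ 2) (gaussianReal 0 1) y
  set B' := smooth a (fun s => 1 + 0 * s + 1 * s ^ 2) (gaussianReal 0 1) y
  rw [abs_le]
  constructor <;> nlinarith [le_abs_self (A - A'), neg_abs_le (A - A'),
    le_abs_self (B - B'), neg_abs_le (B - B'), abs_nonneg (A - A'), abs_nonneg (B - B')]

end Limits

/-! ### Moments of the smoothed density -/

section SecondMoment
variable {a : ℝ} (ha : a ^ 2 < 1) {ν : Measure ℝ} (hν : IsStandardized ν)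
include ha hν

/-- The smoothed law is that of a S + √(1-a²) Z, again standardized since a² + (1 - a²) = 1. The
value therefore does not depend on ν, as Scheffé's lemma requires. -/
theorem integrable_quadratic_mul_smooth_one (b c d : ℝ) :
    Integrable (fun y => (b + c * y + d * y ^ 2) * smooth a 1 ν y) ∧
    ∫ y, (b + c * y + d * y ^ 2) * smooth a 1 ν y = b + d := by
  have := hν.isProb
  have i0 (s : ℝ) : Integrable fun y => y * mehler a s y := by
    refine ((integrable_mehler (a := a) s).add (memLp_id_mehler ha s)).mono'
      (by unfold mehler; fun_prop) (ae_of_all _ fun y => ?_)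
    rw [norm_mul, Real.norm_of_nonneg (mehler_nonneg a s y), Real.norm_eq_abs, Pi.add_apply]
    have h2 : |y| ≤ 1 + y ^ 2 := by
      rw [← sq_abs]; nlinarith [sq_nonneg (|y| - 1), abs_nonneg y]
    nlinarith [mul_le_mul_of_nonneg_right h2 (mehler_nonneg a s y)]
  have i1 (b c d s : ℝ) : Integrable fun y => (b + c * y + d * y ^ 2) * mehler a s y := by
    refine ((((integrable_mehler (a := a) s).const_mul b).add ((i0 s).const_mul c)).add
      ((memLp_id_mehler ha s).const_mul d)).congr (ae_of_all _ fun y => ?_)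
    simp only [Pi.add_apply]; ring
  have e1 (b c d s : ℝ) : ∫ y, (b + c * y + d * y ^ 2) * mehler a s y =
      (b + d * (1 - a ^ 2)) + (c * a) * s + (d * a ^ 2) * s ^ 2 := by
    have : ∀ y, (b + c * y + d * y ^ 2) * mehler a s y =
        b * mehler a s y + c * (y * mehler a s y) + d * (y ^ 2 * mehler a s y) :=
      fun y => by ring
    simp_rw [this]
    have i3 : Integrable fun y => b * mehler a s y + c * (y * mehler a s y) :=
      ((integrable_mehler s).const_mul b).add ((i0 s).const_mul c)
    rw [integral_add i3 ((memLp_id_mehler ha s).const_mul d), integral_add ((integrable_mehler s).const_mul b)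
      ((i0 s).const_mul c), integral_const_mul, integral_const_mul, integral_const_mul,
      integral_mehler ha, integral_id_mul_mehler ha, integral_sq_mul_mehler ha]
    ring
  have hm (b c d : ℝ) : AEStronglyMeasurable
      (fun x : ℝ × ℝ => (b + c * x.2 + d * x.2 ^ 2) * mehler a x.1 x.2) (ν.prod volume) :=
    (Measurable.mul (by fun_prop) (measurable_mehler a)).aestronglyMeasurable
  have i2 : Integrable (fun x : ℝ × ℝ => (b + c * x.2 + d * x.2 ^ 2) * mehler a x.1 x.2)
      (ν.prod volume) := by
    -- A nonnegative quadratic majorant, from |y| ≤ 1 + y², on which Tonelli's theorem can be used;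
    -- its linear coefficient is kept as 0 to match `e1`.
    have pos : Integrable (fun x : ℝ × ℝ =>
        ((|b| + |c|) + 0 * x.2 + (|c| + |d|) * x.2 ^ 2) * mehler a x.1 x.2) (ν.prod volume) := by
      rw [integrable_prod_iff (hm _ _ _)]
      refine ⟨ae_of_all _ fun s => i1 _ _ _ s, ?_⟩
      refine (hν.integrable_quadratic ((|b| + |c|) + (|c| + |d|) * (1 - a ^ 2)) (0 * a)
        ((|c| + |d|) * a ^ 2)).congr (ae_of_all _ fun s => ?_)
      refine (e1 (|b| + |c|) 0 (|c| + |d|) s).symm.trans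
        (integral_congr_ae (ae_of_all _ fun y => ?_))
      refine (Real.norm_of_nonneg (mul_nonneg ?_ (mehler_nonneg a s y))).symm
      simp only [zero_mul, add_zero]; positivity
    refine pos.mono' (hm b c d) (ae_of_all _ fun x => ?_)
    rw [norm_mul, Real.norm_of_nonneg (mehler_nonneg _ _ _), Real.norm_eq_abs]
    refine mul_le_mul_of_nonneg_right ?_ (mehler_nonneg _ _ _)
    have h1 : |b + c * x.2 + d * x.2 ^ 2| ≤ |b| + |c| * |x.2| + |d| * x.2 ^ 2 := by
      calc _ ≤ |b| + |c * x.2| + |d * x.2 ^ 2| := abs_add_three _ _ _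
        _ = _ := by rw [abs_mul, abs_mul, abs_of_nonneg (sq_nonneg x.2)]
    have h2 : |x.2| ≤ 1 + x.2 ^ 2 := by
      rw [← sq_abs x.2]; nlinarith [sq_nonneg (|x.2| - 1), abs_nonneg x.2]
    nlinarith [mul_le_mul_of_nonneg_left h2 (abs_nonneg c)]
  have e2 (y : ℝ) : (b + c * y + d * y ^ 2) * smooth a 1 ν y =
      ∫ s, (b + c * y + d * y ^ 2) * mehler a s y ∂ν := by
    rw [integral_const_mul]; simp [smooth]
  simp_rw [e2]
  refine ⟨i2.integral_prod_right, ?_⟩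
  rw [← integral_integral_swap (f := fun s y => (b + c * y + d * y ^ 2) * mehler a s y) i2]
  simp_rw [e1]
  rw [hν.integral_quadratic]
  ring

theorem integrable_id_mul_smooth_one : Integrable fun y => y * smooth a 1 ν y := by
  simpa using (integrable_quadratic_mul_smooth_one ha hν 0 1 0).1

theorem integral_id_mul_smooth_one : ∫ y, y * smooth a 1 ν y = 0 := by
  simpa using (integrable_quadratic_mul_smooth_one ha hν 0 1 0).2

end SecondMoment

theorem smooth_one_gaussianReal {a : ℝ} (ha : a ^ 2 < 1) (y : ℝ) :
    smooth a 1 (gaussianReal 0 1) y = gaussianPDFReal 0 1 y := by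
  simp [smooth, integral_mehler_gaussianReal ha]

/-- Here the factor y is outside the smoothing, so this is the tangent vector y r_n needed for the
upper bound, while `tendsto_smooth_id` concerns the channel output needed for the lower bound. Again
y is split as a difference of two nonnegative quadratics. The index n + 1 avoids the empty sum. -/
theorem tendsto_id_mul_smooth_one {lam : Measure ℝ} (h : IsStandardized lam) {a : ℝ}
    (ha : a ^ 2 < 1) (ha0 : 0 < a) :
    Tendsto (fun n => ∫ y, |y * smooth a 1 (stdSum lam (n + 1)) y - y * gaussianPDFReal 0 1 y|)
      atTop (𝓝 0) := by
  have hγ := isStandardized_gaussianReal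
  simp_rw [← smooth_one_gaussianReal ha]
  have t {b c d : ℝ} (hw : ∀ y, 0 ≤ b + c * y + d * y ^ 2) :
      Tendsto (fun n => ∫ y, |(b + c * y + d * y ^ 2) * smooth a 1 (stdSum lam (n + 1)) y -
        (b + c * y + d * y ^ 2) * smooth a 1 (gaussianReal 0 1) y|) atTop (𝓝 0) := by
    refine tendsto_integral_abs_sub_of_integral_eq
      (fun n => (integrable_quadratic_mul_smooth_one ha (h.stdSum n.succ_ne_zero) b c d).1)
      (integrable_quadratic_mul_smooth_one ha hγ b c d).1
      (fun n y => mul_nonneg (hw y) (smooth_nonneg (fun _ => zero_le_one) y))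
      (fun y => mul_nonneg (hw y) (smooth_nonneg (fun _ => zero_le_one) y)) ?_ fun y => ?_
    · refine .of_forall fun n => ?_
      rw [(integrable_quadratic_mul_smooth_one ha (h.stdSum n.succ_ne_zero) b c d).2,
        (integrable_quadratic_mul_smooth_one ha hγ b c d).2]
    · refine Tendsto.const_mul _ ?_
      exact (tendsto_smooth ha h ha0 continuous_one (C := 1)
        (fun s => by simp [sq_nonneg]) y).comp (tendsto_add_atTop_nat 1)
  have t3 := (t (b := 1) (c := 2) (d := 1) (fun s => by nlinarith [sq_nonneg (1 + s)])).add
    (t (b := 1) (c := 0) (d := 1) (fun s => by nlinarith [sq_nonneg s]))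
  rw [add_zero] at t3
  refine squeeze_zero (fun n => integral_nonneg fun y => abs_nonneg _) (fun n => ?_) t3
  have j (b c d : ℝ) := ((integrable_quadratic_mul_smooth_one ha (h.stdSum n.succ_ne_zero) b c d).1.sub
      (integrable_quadratic_mul_smooth_one ha hγ b c d).1).abs
  refine le_trans ?_ (integral_add (j 1 2 1) (j 1 0 1)).le
  refine integral_mono_of_nonneg (ae_of_all _ fun y => abs_nonneg _) ((j 1 2 1).add (j 1 0 1))
    (ae_of_all _ fun y => ?_)
  simp only [Pi.sub_apply, ← mul_sub, abs_mul]
  rw [← add_mul]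
  refine mul_le_mul_of_nonneg_right ?_ (abs_nonneg _)
  refine le_trans ?_ (add_le_add (le_abs_self _) (le_abs_self _))
  rw [abs_le]
  constructor <;> nlinarith [sq_nonneg (y + 1), sq_nonneg y]

/-! ### Adding an independent Gaussian -/

theorem map_conv_gaussianReal_eq_withDensity {a : ℝ} (ha : a ^ 2 < 1) (ν : Measure ℝ)
    [IsProbabilityMeasure ν] :
    (ν.map (a * ·)) ∗ gaussianReal 0 (Real.toNNReal (1 - a ^ 2)) =
      volume.withDensity fun y => ENNReal.ofReal (smooth a 1 ν y) := by
  have hν : Measurable fun x : ℝ => a * x := by fun_prop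
  have : IsProbabilityMeasure (ν.map (a * ·)) := Measure.isProbabilityMeasure_map hν.aemeasurable
  ext S hS
  rw [withDensity_apply _ hS, Measure.conv, Measure.map_apply (by fun_prop) hS,
    Measure.prod_apply (by measurability), lintegral_map (measurable_measure_prodMk_left
      (by measurability)) hν]
  have e1 (s : ℝ) : gaussianReal 0 (Real.toNNReal (1 - a ^ 2))
      (Prod.mk (a * s) ⁻¹' ((fun x : ℝ × ℝ => x.1 + x.2) ⁻¹' S)) =
      ∫⁻ y in S, ENNReal.ofReal (mehler a s y) := by
    have := gaussianReal_map_const_add (μ := 0) (v := Real.toNNReal (1 - a ^ 2)) (a * s)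
    rw [zero_add] at this
    have h2 := congrArg (fun m => m S) this
    simp only [Measure.map_apply (measurable_const_add (a * s)) hS] at h2
    rw [gaussianReal_apply (a * s) (toNNReal_one_sub_sq_ne_zero ha) S] at h2
    exact h2
  simp_rw [e1]
  rw [lintegral_lintegral_swap (measurable_mehler a).ennreal_ofReal.aemeasurable]
  refine lintegral_congr fun y => ?_
  rw [smooth, ofReal_integral_eq_lintegral_ofReal]
  · simp
  · exact (integrable_mehler_left ha y).const_mul 1
  · exact ae_of_all _ fun s => by simpa using mehler_nonneg a s y

/-- Normalized sums commute with the mixing: the Gaussian parts of the summands combine to a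
Gaussian of the same variance. Compared through characteristic functions. -/
theorem stdSum_conv_gaussianReal {a : ℝ} (ha : a ^ 2 < 1) (lam : Measure ℝ)
    [IsProbabilityMeasure lam] {n : ℕ} (hn : n ≠ 0) :
    stdSum ((lam.map (a * ·)) ∗ gaussianReal 0 (Real.toNNReal (1 - a ^ 2))) n =
      volume.withDensity fun y => ENNReal.ofReal (smooth a 1 (stdSum lam n) y) := by
  have hν : Measurable fun x : ℝ => a * x := by fun_prop
  have h1 : IsProbabilityMeasure (lam.map (a * ·)) :=
    Measure.isProbabilityMeasure_map hν.aemeasurable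
  have h2 : IsProbabilityMeasure ((stdSum lam n).map (a * ·)) :=
    Measure.isProbabilityMeasure_map hν.aemeasurable
  rw [← map_conv_gaussianReal_eq_withDensity ha]
  refine Measure.ext_of_charFun (funext fun t => ?_)
  rw [charFun_stdSum, charFun_conv, charFun_conv, charFun_map_mul, charFun_map_mul, charFun_stdSum,
    charFun_gaussianReal, charFun_gaussianReal, mul_pow, ← Complex.exp_nat_mul]
  congr 2
  · rw [mul_left_comm]
  · have h1 : ((√(n : ℝ) : ℝ) : ℂ) ^ 2 = n := by
      rw [← Complex.ofReal_pow, Real.sq_sqrt (Nat.cast_nonneg n)]; simp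
    have h2 : (n : ℂ) ≠ 0 := by exact_mod_cast hn
    push_cast
    rw [mul_pow, inv_pow, h1]
    field_simp
    ring

/-! ### Channels -/

theorem Density.ext {Ω : DataSpace} {p q : Density Ω} (h : p.val = q.val) : p = q := by
  cases p; cases q; simpa using h

theorem norm_L1_eq_integral_abs {Ω : DataSpace} (f : L1 Ω) :
    ‖f‖ = ∫ x, |f x| ∂Ω.refMeasure := by
  simp [L1.norm_eq_integral_norm]

namespace Channel
variable {Ω Ω' : DataSpace}

theorem mono (Ψ : Channel Ω Ω') {f g : L1 Ω} (h : f ≤ g) : Ψ.toLinearMap f ≤ Ψ.toLinearMap g := by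
  have := Ψ.map_nonneg (g - f) (sub_nonneg.2 h)
  rwa [map_sub, sub_nonneg] at this

/-- Channels are contractions. -/
theorem norm_map_le (Ψ : Channel Ω Ω') (f : L1 Ω) : ‖Ψ.toLinearMap f‖ ≤ ‖f‖ := by
  -- Positivity gives |Ψf| ≤ Ψ|f|, and Ψ preserves the integral of |f|.
  have h1 : Ψ.toLinearMap f ≤ Ψ.toLinearMap |f| := Ψ.mono (le_abs_self f)
  have h2 : -Ψ.toLinearMap f ≤ Ψ.toLinearMap |f| := by
    rw [← map_neg]; exact Ψ.mono (neg_le_abs f)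
  have h3 := (Lp.coeFn_le _ _).2 (abs_le'.2 ⟨h1, h2⟩)
  rw [norm_L1_eq_integral_abs, norm_L1_eq_integral_abs,
    ← integral_congr_ae (Lp.coeFn_abs f), ← Ψ.integral_map |f|]
  refine integral_mono_ae (L1.integrable_coeFn _).abs (L1.integrable_coeFn _) ?_
  filter_upwards [h3, Lp.coeFn_abs (Ψ.toLinearMap f)] with x hx hx2
  exact hx2 ▸ hx

end Channel

section OfMap
variable {Ω Ω' : DataSpace} {Z : Type} [MeasurableSpace Z] {ν : Measure Z} [SFinite ν]
  {a : Ω'.Carrier × Z → Ω.Carrier} {K : Ω'.Carrier × Z → ℝ≥0}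

omit [SFinite ν] in
theorem integrable_mul_comp (ha : Measurable a) (hK : Measurable K)
    (h : ((Ω'.refMeasure.prod ν).withDensity fun x => (K x : ℝ≥0∞)).map a = Ω.refMeasure)
    {f : Ω.Carrier → ℝ} (hf : Integrable f Ω.refMeasure) :
    Integrable (fun x => (K x : ℝ) * f (a x)) (Ω'.refMeasure.prod ν) := by
  have h1 := (MeasurePreserving.mk ha h).integrable_comp_of_integrable hf
  rw [integrable_withDensity_iff_integrable_smul hK] at h1
  exact h1

theorem integral_mul_comp (ha : Measurable a) (hK : Measurable K)
    (h : ((Ω'.refMeasure.prod ν).withDensity fun x => (K x : ℝ≥0∞)).map a = Ω.refMeasure)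
    {f : Ω.Carrier → ℝ} (hf : Integrable f Ω.refMeasure) :
    ∫ x', ∫ z, (K (x', z) : ℝ) * f (a (x', z)) ∂ν ∂Ω'.refMeasure = ∫ x, f x ∂Ω.refMeasure := by
  rw [← integral_prod _ (integrable_mul_comp ha hK h hf)]
  have h1 := integral_withDensity_eq_integral_smul (μ := Ω'.refMeasure.prod ν) hK (fun x => f (a x))
  refine h1.symm.trans ?_
  conv_rhs => rw [← h]
  rw [integral_map ha.aemeasurable]
  rw [h]; exact hf.aestronglyMeasurable

theorem ae_integral_mul_comp_congr (ha : Measurable a) (hK : Measurable K)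
    (h : ((Ω'.refMeasure.prod ν).withDensity fun x => (K x : ℝ≥0∞)).map a = Ω.refMeasure)
    {f F : Ω.Carrier → ℝ} (hf : f =ᵐ[Ω.refMeasure] F) :
    (fun x' => ∫ z, (K (x', z) : ℝ) * f (a (x', z)) ∂ν) =ᵐ[Ω'.refMeasure]
      fun x' => ∫ z, (K (x', z) : ℝ) * F (a (x', z)) ∂ν := by
  have h1 := (MeasurePreserving.mk ha h).quasiMeasurePreserving.ae hf
  rw [ae_withDensity_iff (by fun_prop)] at h1
  filter_upwards [Measure.ae_ae_of_ae_prod h1] with x' hx'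
  refine integral_congr_ae (hx'.mono fun z hz => ?_)
  -- The a.e. equality is known only on {K ≠ 0}; elsewhere both integrands vanish.
  by_cases hk : K (x', z) = 0
  · simp [hk]
  · simp only [hz (by simpa using hk)]

/-- If `a` maps the measure with density `K` to the reference measure, then
`f ↦ ∫ K(·, z) f(a(·, z)) dν(z)` is a channel. -/
theorem exists_channel (ha : Measurable a) (hK : Measurable K)
    (h : ((Ω'.refMeasure.prod ν).withDensity fun x => (K x : ℝ≥0∞)).map a = Ω.refMeasure) :
    ∃ Ψ : Channel Ω Ω', ∀ (f : L1 Ω) (F : Ω.Carrier → ℝ), f =ᵐ[Ω.refMeasure] F →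
      Ψ.toLinearMap f =ᵐ[Ω'.refMeasure] fun x' => ∫ z, (K (x', z) : ℝ) * F (a (x', z)) ∂ν := by
  have hi (f : L1 Ω) := (integrable_mul_comp ha hK h (L1.integrable_coeFn f)).integral_prod_left
  let φ : L1 Ω → L1 Ω' := fun f => (hi f).toL1 _
  have hφ (f : L1 Ω) (F : Ω.Carrier → ℝ) (hf : f =ᵐ[Ω.refMeasure] F) :
      φ f =ᵐ[Ω'.refMeasure] fun x' => ∫ z, (K (x', z) : ℝ) * F (a (x', z)) ∂ν :=
    (Integrable.coeFn_toL1 (hi f)).trans (ae_integral_mul_comp_congr ha hK h hf)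
  let L : L1 Ω →ₗ[ℝ] L1 Ω' :=
    { toFun := φ
      map_add' := fun f g => by
        refine Lp.ext ?_
        have hint (f : L1 Ω) :=
          (integrable_mul_comp ha hK h (L1.integrable_coeFn f)).prod_right_ae
        filter_upwards [hφ _ _ (Lp.coeFn_add f g), Lp.coeFn_add (φ f) (φ g), hφ f f ae_eq_rfl,
          hφ g g ae_eq_rfl, hint f, hint g] with x h1 h2 h3 h4 h5 h6
        rw [h1, h2, Pi.add_apply, h3, h4, ← integral_add h5 h6]
        simp only [Pi.add_apply, mul_add]
      map_smul' := fun c f => by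
        refine Lp.ext ?_
        filter_upwards [hφ _ _ (Lp.coeFn_smul c f), Lp.coeFn_smul c (φ f), hφ f f ae_eq_rfl]
          with x h1 h2 h3
        rw [h1, RingHom.id_apply, h2, Pi.smul_apply, h3, smul_eq_mul, ← integral_const_mul]
        simp only [Pi.smul_apply, smul_eq_mul, mul_left_comm] }
  refine ⟨⟨L, fun f hf => ?_, fun f => ?_⟩, hφ⟩
  · rw [← Lp.coeFn_nonneg]
    have h0 : f =ᵐ[Ω.refMeasure] fun x => |f x| := by
      filter_upwards [(Lp.coeFn_nonneg f).2 hf] with x hx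
      exact (abs_of_nonneg hx).symm
    filter_upwards [hφ _ _ h0] with x hx
    refine le_of_le_of_eq (integral_nonneg fun z => ?_) hx.symm
    exact mul_nonneg (NNReal.coe_nonneg _) (abs_nonneg _)
  · exact (integral_congr_ae (hφ f f ae_eq_rfl)).trans
      (integral_mul_comp ha hK h (L1.integrable_coeFn f))

theorem map_withDensity_prod_eq (ha : Measurable a) (hK : Measurable K)
    (h : ∀ S, MeasurableSet S → ∫⁻ x', ∫⁻ z, (K (x', z) : ℝ≥0∞) * S.indicator 1 (a (x', z)) ∂ν
      ∂Ω'.refMeasure = Ω.refMeasure S) :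
    ((Ω'.refMeasure.prod ν).withDensity fun x => (K x : ℝ≥0∞)).map a = Ω.refMeasure := by
  ext S hS
  have hm : Measurable fun x => (K x : ℝ≥0∞) * S.indicator 1 (a x) :=
    (by fun_prop : Measurable fun x => (K x : ℝ≥0∞)).mul
      ((measurable_one.indicator hS).comp ha)
  rw [Measure.map_apply ha hS, withDensity_apply _ (ha hS), ← h S hS,
    ← lintegral_prod _ hm.aemeasurable, ← lintegral_indicator (ha hS)]
  refine lintegral_congr fun x => ?_
  by_cases hx : a x ∈ S
  · simp [Set.indicator, hx]
  · simp [Set.indicator, hx]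

end OfMap

/-! ### Pullback channels and transition densities -/

section Special
variable {Ω Ω' : DataSpace}

/-- A weighted pullback `f ↦ K · (f ∘ T)` as a channel. -/
theorem exists_channel_pullback {T : Ω'.Carrier → Ω.Carrier} {K : Ω'.Carrier → ℝ≥0}
    (hT : Measurable T) (hK : Measurable K)
    (h : ∀ S, MeasurableSet S →
      ∫⁻ x', (K x' : ℝ≥0∞) * S.indicator 1 (T x') ∂Ω'.refMeasure = Ω.refMeasure S) :
    ∃ Ψ : Channel Ω Ω', ∀ (f : L1 Ω) (F : Ω.Carrier → ℝ), f =ᵐ[Ω.refMeasure] F →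
      Ψ.toLinearMap f =ᵐ[Ω'.refMeasure] fun x' => (K x' : ℝ) * F (T x') := by
  have ha : Measurable fun x : Ω'.Carrier × Unit => T x.1 := by fun_prop
  have hK' : Measurable fun x : Ω'.Carrier × Unit => K x.1 := by fun_prop
  simpa using exists_channel (ν := Measure.dirac ()) ha hK'
    (map_withDensity_prod_eq ha hK' (by simpa using h))

/-- The channel with transition density `k`. -/
theorem exists_channel_kernel {k : Ω.Carrier → Ω'.Carrier → ℝ≥0}
    (hk : Measurable fun x : Ω.Carrier × Ω'.Carrier => k x.1 x.2)
    (h : ∀ z, ∫⁻ x', (k z x' : ℝ≥0∞) ∂Ω'.refMeasure = 1) :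
    ∃ Ψ : Channel Ω Ω', ∀ (f : L1 Ω) (F : Ω.Carrier → ℝ), f =ᵐ[Ω.refMeasure] F →
      Ψ.toLinearMap f =ᵐ[Ω'.refMeasure] fun x' => ∫ z, (k z x' : ℝ) * F z ∂Ω.refMeasure := by
  have hK' : Measurable fun x : Ω'.Carrier × Ω.Carrier => k x.2 x.1 := hk.comp measurable_swap
  refine exists_channel (ν := Ω.refMeasure) (a := Prod.snd) measurable_snd hK'
    (map_withDensity_prod_eq measurable_snd hK' fun S hS => ?_)
  have hm : Measurable fun x : Ω'.Carrier × Ω.Carrier =>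
      (k x.2 x.1 : ℝ≥0∞) * S.indicator 1 x.2 :=
    (by fun_prop : Measurable fun x : Ω'.Carrier × Ω.Carrier => (k x.2 x.1 : ℝ≥0∞)).mul
      ((measurable_one.indicator hS).comp measurable_snd)
  rw [lintegral_lintegral_swap hm.aemeasurable]
  have e (z : Ω.Carrier) : ∫⁻ x', (k z x' : ℝ≥0∞) * S.indicator 1 z ∂Ω'.refMeasure =
      S.indicator 1 z := by
    rw [lintegral_mul_const _ (by fun_prop), h, one_mul]
  simp_rw [e]
  rw [lintegral_indicator_one hS]

end Special

/-! ### Densities as probability measures -/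

section ToMeasure
variable {Ω : DataSpace} (p : Density Ω) (δ : Tangent Ω)

theorem Density.nonneg_ae : ∀ᵐ x ∂Ω.refMeasure, 0 ≤ p.val x := (Lp.coeFn_nonneg p.val).2 p.nonneg

theorem measurable_coeFn_L1 (f : L1 Ω) : Measurable f := (Lp.stronglyMeasurable f).measurable

theorem Density.toMeasure_apply {S : Set Ω.Carrier} (hS : MeasurableSet S) :
    p.toMeasure S = ENNReal.ofReal (∫ x in S, p.val x ∂Ω.refMeasure) := by
  rw [Density.toMeasure, withDensity_apply _ hS, ofReal_integral_eq_lintegral_ofReal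
    (L1.integrable_coeFn p.val).integrableOn (ae_restrict_of_ae p.nonneg_ae)]

instance Density.isProbabilityMeasure_toMeasure : IsProbabilityMeasure p.toMeasure :=
  ⟨by rw [p.toMeasure_apply MeasurableSet.univ, setIntegral_univ, p.integral_eq_one,
    ENNReal.ofReal_one]⟩

theorem Density.toMeasure_eq {r : Ω.Carrier → ℝ} (h : p.val =ᵐ[Ω.refMeasure] r) :
    p.toMeasure = Ω.refMeasure.withDensity fun x => ENNReal.ofReal (r x) :=
  withDensity_congr_ae (h.mono fun x hx => by simp only [hx])

theorem Density.lintegral_toMeasure {F : Ω.Carrier → ℝ≥0∞} (hF : Measurable F) :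
    ∫⁻ x, F x ∂p.toMeasure = ∫⁻ x, ENNReal.ofReal (p.val x) * F x ∂Ω.refMeasure :=
  lintegral_withDensity_eq_lintegral_mul _ (measurable_coeFn_L1 p.val).ennreal_ofReal hF

theorem Density.integral_toMeasure (F : Ω.Carrier → ℝ) :
    ∫ x, F x ∂p.toMeasure = ∫ x, p.val x * F x ∂Ω.refMeasure := by
  rw [Density.toMeasure, integral_withDensity_eq_integral_toReal_smul
    (measurable_coeFn_L1 p.val).ennreal_ofReal (by simp)]
  refine integral_congr_ae (p.nonneg_ae.mono fun x hx => ?_)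
  simp [ENNReal.toReal_ofReal hx]

theorem Density.ae_toMeasure_iff {P : Ω.Carrier → Prop} :
    (∀ᵐ x ∂p.toMeasure, P x) ↔ ∀ᵐ x ∂Ω.refMeasure, p.val x ≠ 0 → P x := by
  rw [Density.toMeasure, ae_withDensity_iff (measurable_coeFn_L1 p.val).ennreal_ofReal]
  refine Filter.eventually_congr (p.nonneg_ae.mono fun x hx => ?_)
  rw [Ne, ENNReal.ofReal_eq_zero, not_le]
  exact ⟨fun h h2 => h (lt_of_le_of_ne hx (Ne.symm h2)), fun h h2 => h h2.ne'⟩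

theorem measurable_score : Measurable (score p δ) :=
  (measurable_coeFn_L1 δ.1).div (measurable_coeFn_L1 p.val)

instance isProbabilityMeasure_scoreLaw : IsProbabilityMeasure (scoreLaw p δ) :=
  Measure.isProbabilityMeasure_map (measurable_score p δ).aemeasurable

variable {p δ}

theorem HasScore.ae_eq (h : HasScore p δ) :
    δ.1 =ᵐ[Ω.refMeasure] fun x => score p δ x * p.val x := by
  filter_upwards [h] with x hx
  by_cases h0 : p.val x = 0
  · simp [h0, hx h0]
  · simp [score, h0]

theorem hasScore_of_ae_eq {l : Ω.Carrier → ℝ} (h : δ.1 =ᵐ[Ω.refMeasure] fun x => l x * p.val x) :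
    HasScore p δ := h.mono fun x hx h0 => by simp [hx, h0]

theorem score_ae_eq {l : Ω.Carrier → ℝ} (h : δ.1 =ᵐ[Ω.refMeasure] fun x => l x * p.val x) :
    score p δ =ᵐ[p.toMeasure] l :=
  p.ae_toMeasure_iff.2 (h.mono fun x hx h0 => by rw [score, hx, mul_div_cancel_right₀ _ h0])

theorem scoreLaw_eq {l : Ω.Carrier → ℝ} (h : δ.1 =ᵐ[Ω.refMeasure] fun x => l x * p.val x) :
    scoreLaw p δ = p.toMeasure.map l := Measure.map_congr (score_ae_eq h)

theorem hasScore_of_fisher_ne_top (h : fisher Ω p δ ≠ ∞) : HasScore p δ := by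
  have hm : Measurable fun x => ENNReal.ofReal ((δ.1 x) ^ 2) / ENNReal.ofReal (p.val x) :=
    ((measurable_coeFn_L1 δ.1).pow_const 2).ennreal_ofReal.div
      (measurable_coeFn_L1 p.val).ennreal_ofReal
  filter_upwards [ae_lt_top hm h] with x hx h0
  by_contra h1
  rw [h0, ENNReal.ofReal_zero, ENNReal.div_zero] at hx
  · exact lt_irrefl _ hx
  · simpa using h1

theorem HasScore.fisher_eq (h : HasScore p δ) :
    fisher Ω p δ = ∫⁻ x, ENNReal.ofReal (δ.1 x ^ 2 / p.val x) ∂Ω.refMeasure := by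
  refine lintegral_congr_ae ?_
  filter_upwards [h, p.nonneg_ae] with x h1 h2
  rcases h2.eq_or_lt with h3 | h3
  · simp [← h3, h1 h3.symm]
  · rw [ENNReal.ofReal_div_of_pos h3]

/-- Fisher information is the second moment of the score. It thus depends only on the law of L, and
J = 1 makes this law standardized. -/
theorem HasScore.fisher_eq_scoreLaw (h : HasScore p δ) :
    fisher Ω p δ = ∫⁻ x, ENNReal.ofReal (x ^ 2) ∂scoreLaw p δ := by
  rw [h.fisher_eq, scoreLaw, lintegral_map (by fun_prop) (measurable_score p δ),
    p.lintegral_toMeasure ((measurable_score p δ).pow_const 2).ennreal_ofReal]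
  refine lintegral_congr_ae ?_
  filter_upwards [h.ae_eq, p.nonneg_ae] with x h1 h2
  rw [← ENNReal.ofReal_mul h2, h1]
  rcases eq_or_ne (p.val x) 0 with h3 | h3
  · simp [h3]
  · congr 1; field_simp

theorem HasScore.integral_scoreLaw (h : HasScore p δ) : ∫ x, x ∂scoreLaw p δ = 0 := by
  rw [scoreLaw, integral_map (measurable_score p δ).aemeasurable (by fun_prop),
    Density.integral_toMeasure]
  refine (integral_congr_ae (h.ae_eq.trans (.of_forall fun x => ?_))).symm.trans δ.2
  simp [mul_comm]

theorem isStandardized_scoreLaw (h : fisher Ω p δ = 1) : IsStandardized (scoreLaw p δ) := by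
  have hs := hasScore_of_fisher_ne_top (h ▸ ENNReal.one_ne_top)
  have h2 : ∫⁻ x, ENNReal.ofReal (x ^ 2) ∂scoreLaw p δ = 1 := hs.fisher_eq_scoreLaw ▸ h
  have i2 : Integrable (fun x : ℝ => x ^ 2) (scoreLaw p δ) := by
    refine ⟨by fun_prop, ?_⟩
    rw [hasFiniteIntegral_iff_ofReal (.of_forall fun x => sq_nonneg x), h2]
    exact ENNReal.one_lt_top
  refine ⟨inferInstance, (memLp_two_iff_integrable_sq (by fun_prop)).2 i2, hs.integral_scoreLaw, ?_⟩
  rw [integral_eq_lintegral_of_nonneg_ae (.of_forall fun x => sq_nonneg x) (by fun_prop), h2,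
    ENNReal.toReal_one]

end ToMeasure

/-! ### Fisher information is monotone and the square of an extended norm -/

/-- Nonnegativity extends to real t by density, and then the discriminant is nonpositive. Rational t
are used because an a.e. statement survives only countably many parameters. -/
theorem sq_le_mul_of_quadratic_nonneg {a b c : ℝ}
    (h : ∀ t : ℚ, 0 ≤ a * (t : ℝ) ^ 2 - 2 * b * t + c) : b ^ 2 ≤ a * c := by
  have h1 : ∀ t : ℝ, 0 ≤ a * t ^ 2 - 2 * b * t + c := by
    have hc : IsClosed {t : ℝ | 0 ≤ a * t ^ 2 - 2 * b * t + c} :=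
      isClosed_le continuous_const (by fun_prop)
    intro t
    have := hc.closure_subset_iff.2 (Set.range_subset_iff.2 h)
    exact this (Rat.isDenseEmbedding_coe_real.dense t)
  have h2 := discrim_le_zero (a := a) (b := -2 * b) (c := c) fun t => by
    have := h1 t
    nlinarith
  rw [discrim] at h2
  nlinarith

/-- With U = δ²/p, the functions t²p - 2tδ + U = (tp - δ)²/p are nonnegative, hence so are their
images under Ψ. Optimizing over t gives (Ψδ)² ≤ Ψp · ΨU pointwise, and integrating gives the claim,
as Ψ preserves ∫ U = J. No kernel representation of the channel is needed. -/
theorem axiomM0_fisher : AxiomM0 fisher := by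
  intro Ω Ω' Ψ p δ
  by_cases htop : fisher Ω p δ = ∞
  · rw [htop]; exact le_top
  have hs := hasScore_of_fisher_ne_top htop
  have hm : Measurable fun x => δ.1 x ^ 2 / p.val x :=
    ((measurable_coeFn_L1 δ.1).pow_const 2).div (measurable_coeFn_L1 p.val)
  have h0 : ∀ᵐ x ∂Ω.refMeasure, 0 ≤ δ.1 x ^ 2 / p.val x :=
    p.nonneg_ae.mono fun x hx => div_nonneg (sq_nonneg _) hx
  have hi : Integrable (fun x => δ.1 x ^ 2 / p.val x) Ω.refMeasure := by
    refine ⟨hm.aestronglyMeasurable, ?_⟩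
    rw [hasFiniteIntegral_iff_ofReal h0, ← hs.fisher_eq]
    exact lt_top_iff_ne_top.2 htop
  set U : L1 Ω := hi.toL1 _ with hU
  have hUc : U =ᵐ[Ω.refMeasure] fun x => δ.1 x ^ 2 / p.val x := Integrable.coeFn_toL1 hi
  have hU0 : 0 ≤ U := by
    rw [← Lp.coeFn_nonneg]
    filter_upwards [hUc, h0] with x h1 h2
    rw [h1]; exact h2
  have key (t : ℚ) : 0 ≤ ((t : ℝ) ^ 2) • p.val - (2 * (t : ℝ)) • δ.1 + U := by
    rw [← Lp.coeFn_nonneg]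
    filter_upwards [hUc, p.nonneg_ae, hs, Lp.coeFn_smul ((t : ℝ) ^ 2) p.val,
      Lp.coeFn_smul (2 * (t : ℝ)) δ.1, Lp.coeFn_add (((t : ℝ) ^ 2) • p.val - (2 * (t : ℝ)) • δ.1) U,
      Lp.coeFn_sub (((t : ℝ) ^ 2) • p.val) ((2 * (t : ℝ)) • δ.1)] with x h1 h2 h3 h4 h5 h6 h7
    rw [h6, Pi.add_apply, h7, Pi.sub_apply, h4, h5, h1]
    simp only [Pi.smul_apply, Pi.zero_apply, smul_eq_mul]
    rcases h2.eq_or_lt with h | h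
    · simp [← h, h3 h.symm]
    · have : (t : ℝ) ^ 2 * p.val x - 2 * t * δ.1 x + δ.1 x ^ 2 / p.val x =
          (t * p.val x - δ.1 x) ^ 2 / p.val x := by field_simp; ring
      rw [this]; positivity
  have key2 : ∀ᵐ x ∂Ω'.refMeasure, (Ψ.toLinearMap δ.1 x) ^ 2 ≤
      Ψ.toLinearMap p.val x * Ψ.toLinearMap U x := by
    have h1 : ∀ᵐ x ∂Ω'.refMeasure, ∀ t : ℚ, 0 ≤ Ψ.toLinearMap p.val x * (t : ℝ) ^ 2 -
        2 * Ψ.toLinearMap δ.1 x * t + Ψ.toLinearMap U x := by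
      rw [ae_all_iff]
      intro t
      have h2 := Ψ.map_nonneg _ (key t)
      rw [map_add, map_sub, map_smul, map_smul, ← Lp.coeFn_nonneg] at h2
      filter_upwards [h2, Lp.coeFn_smul ((t : ℝ) ^ 2) (Ψ.toLinearMap p.val),
        Lp.coeFn_smul (2 * (t : ℝ)) (Ψ.toLinearMap δ.1),
        Lp.coeFn_add (((t : ℝ) ^ 2) • Ψ.toLinearMap p.val - (2 * (t : ℝ)) • Ψ.toLinearMap δ.1)
          (Ψ.toLinearMap U),
        Lp.coeFn_sub (((t : ℝ) ^ 2) • Ψ.toLinearMap p.val) ((2 * (t : ℝ)) • Ψ.toLinearMap δ.1)]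
        with x h3 h4 h5 h6 h7
      rw [h6, Pi.add_apply, h7, Pi.sub_apply, h4, h5] at h3
      simp only [Pi.smul_apply, Pi.zero_apply, smul_eq_mul] at h3
      linarith
    exact h1.mono fun x hx => sq_le_mul_of_quadratic_nonneg hx
  have hΨU : ∀ᵐ x ∂Ω'.refMeasure, 0 ≤ Ψ.toLinearMap U x :=
    (Lp.coeFn_nonneg _).2 (Ψ.map_nonneg U hU0)
  calc fisher Ω' (Ψ.density p) (Ψ.tangent δ)
      ≤ ∫⁻ x, ENNReal.ofReal (Ψ.toLinearMap U x) ∂Ω'.refMeasure := by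
        refine lintegral_mono_ae ?_
        filter_upwards [key2, (Ψ.density p).nonneg_ae, hΨU] with x h1 h2 h3
        change ENNReal.ofReal ((Ψ.toLinearMap δ.1 x) ^ 2) /
          ENNReal.ofReal (Ψ.toLinearMap p.val x) ≤ _
        refine ENNReal.div_le_of_le_mul ?_
        rw [← ENNReal.ofReal_mul h3, mul_comm]
        exact ENNReal.ofReal_le_ofReal h1
    _ = ENNReal.ofReal (∫ x, U x ∂Ω.refMeasure) := by
        rw [← ofReal_integral_eq_lintegral_ofReal (L1.integrable_coeFn _) hΨU, Ψ.integral_map]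
    _ = fisher Ω p δ := by
        rw [integral_congr_ae hUc, ofReal_integral_eq_lintegral_ofReal hi h0, hs.fisher_eq]

theorem isNormSq_fisher : IsNormSq fisher := by
  intro Ω p
  -- The weight p^{-1/2}, infinite where p vanishes; with 0 · ∞ = 0 this reproduces the conventions
  -- of `fisher`, and Minkowski's inequality holds for such weights.
  set c : Ω.Carrier → ℝ≥0∞ := fun x => (ENNReal.ofReal (p.val x))⁻¹ ^ (1 / 2 : ℝ) with hc
  have hcm : Measurable c := (measurable_coeFn_L1 p.val).ennreal_ofReal.inv.pow_const _
  have e (δ : Tangent Ω) : fisher Ω p δ = ∫⁻ x, (‖δ.1 x‖ₑ * c x) ^ (2 : ℝ) ∂Ω.refMeasure := by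
    refine lintegral_congr fun x => ?_
    rw [ENNReal.mul_rpow_of_nonneg _ _ zero_le_two, hc, ← ENNReal.rpow_mul,
      one_div, inv_mul_cancel₀ two_ne_zero, ENNReal.rpow_one, div_eq_mul_inv]
    congr 1
    rw [ENNReal.rpow_two, Real.enorm_eq_ofReal_abs, ← ENNReal.ofReal_pow (abs_nonneg _), sq_abs]
  have hsq (δ : Tangent Ω) : fisher Ω p δ = (fisher Ω p δ ^ (1 / 2 : ℝ)) ^ 2 := by
    rw [← ENNReal.rpow_two, ← ENNReal.rpow_mul, one_div, inv_mul_cancel₀ two_ne_zero,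
      ENNReal.rpow_one]
  refine ⟨fun δ => fisher Ω p δ ^ (1 / 2 : ℝ), ⟨fun δ => ?_, fun k δ => ?_, fun δ δ' => ?_⟩, hsq⟩
  · have hm : Measurable fun x => ENNReal.ofReal ((δ.1 x) ^ 2) / ENNReal.ofReal (p.val x) :=
      ((measurable_coeFn_L1 δ.1).pow_const 2).ennreal_ofReal.div
        (measurable_coeFn_L1 p.val).ennreal_ofReal
    rw [ENNReal.rpow_eq_zero_iff_of_pos (by norm_num), fisher, lintegral_eq_zero_iff hm]
    constructor
    · intro h
      refine Subtype.ext (Lp.ext ?_)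
      filter_upwards [h, Lp.coeFn_zero ℝ 1 Ω.refMeasure] with x hx h0
      rw [Pi.zero_apply, ENNReal.div_eq_zero_iff] at hx
      refine Eq.trans ?_ h0.symm
      rcases hx with hx | hx
      · rw [ENNReal.ofReal_eq_zero] at hx
        exact pow_eq_zero_iff two_ne_zero |>.1 (le_antisymm hx (sq_nonneg _))
      · exact absurd hx ENNReal.ofReal_ne_top
    · rintro rfl
      filter_upwards [Lp.coeFn_zero ℝ 1 Ω.refMeasure] with x h0
      have : ((0 : Tangent Ω) : L1 Ω) x = 0 := h0
      change ENNReal.ofReal (((0 : Tangent Ω) : L1 Ω) x ^ 2) / _ = 0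
      simp only [this]
      simp
  · have : fisher Ω p (k • δ) = ENNReal.ofReal |k| ^ (2 : ℝ) * fisher Ω p δ := by
      rw [e, e, ← lintegral_const_mul _ (by fun_prop)]
      refine lintegral_congr_ae ?_
      filter_upwards [Lp.coeFn_smul k δ.1] with x hx
      rw [← ENNReal.mul_rpow_of_nonneg _ _ zero_le_two, ← mul_assoc]
      congr 2
      rw [Submodule.coe_smul, hx, Pi.smul_apply, smul_eq_mul, enorm_mul,
        Real.enorm_eq_ofReal_abs k]
    simp only [this]
    rw [ENNReal.mul_rpow_of_nonneg _ _ (by norm_num), ← ENNReal.rpow_mul]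
    norm_num
  · simp only [e]
    refine le_trans (ENNReal.rpow_le_rpow (lintegral_mono_ae ?_) (by norm_num))
      (ENNReal.lintegral_Lp_add_le (p := 2) (f := fun x => ‖δ.1 x‖ₑ * c x)
        (g := fun x => ‖δ'.1 x‖ₑ * c x) (by fun_prop) (by fun_prop) one_le_two)
    filter_upwards [Lp.coeFn_add δ.1 δ'.1] with x hx
    refine ENNReal.rpow_le_rpow ?_ zero_le_two
    rw [Submodule.coe_add, hx, Pi.add_apply, Pi.add_apply, ← add_mul]
    gcongr
    exact enorm_add_le _ _

/-! ### Product densities -/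

section Pow
variable {Ω : DataSpace} (p : Density Ω) (δ : Tangent Ω) (n : ℕ)

theorem ae_tuple {P : Ω.Carrier → Prop} (h : ∀ᵐ x ∂Ω.refMeasure, P x) :
    ∀ᵐ x ∂(Ω.pow n).refMeasure, ∀ i, P (Ω.tuple n x i) := by
  rw [ae_all_iff]
  exact fun i => ((Measure.quasiMeasurePreserving_eval (fun _ : Fin n => Ω.refMeasure) i).comp
    (Ω.measurePreserving_tuple n).quasiMeasurePreserving).ae h

theorem map_tuple_toMeasure_pow :
    (p.pow n).toMeasure.map (Ω.tuple n) = Measure.pi fun _ => p.toMeasure := by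
  refine (Measure.pi_eq fun s hs => ?_).symm
  have hS : MeasurableSet (Set.univ.pi s) := MeasurableSet.univ_pi hs
  rw [Measure.map_apply (Ω.tuple n).measurable hS,
    (p.pow n).toMeasure_apply ((Ω.tuple n).measurable hS),
    ← integral_indicator ((Ω.tuple n).measurable hS)]
  have e : (Ω.tuple n ⁻¹' Set.univ.pi s).indicator (p.pow n).val =ᵐ[(Ω.pow n).refMeasure]
      fun x => ∏ i, (s i).indicator p.val (Ω.tuple n x i) := by
    filter_upwards [coeFn_tensor (fun _ : Fin n => p.val)] with x hx
    by_cases h : Ω.tuple n x ∈ Set.univ.pi s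
    · rw [Set.indicator_of_mem (show x ∈ Ω.tuple n ⁻¹' Set.univ.pi s from h)]
      refine hx.trans (Finset.prod_congr rfl fun i _ => ?_)
      rw [Set.indicator_of_mem (h i trivial)]
    · rw [Set.indicator_of_notMem (show x ∉ Ω.tuple n ⁻¹' Set.univ.pi s from h)]
      simp only [Set.mem_univ_pi, not_forall] at h
      obtain ⟨i, hi⟩ := h
      exact (Finset.prod_eq_zero (Finset.mem_univ i) (Set.indicator_of_notMem hi _)).symm
  rw [integral_congr_ae e, (Ω.measurePreserving_tuple n).integral_comp'
    (fun y : Fin n → Ω.Carrier => ∏ i, (s i).indicator p.val (y i)),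
    integral_fintype_prod_eq_prod (fun i x => (s i).indicator p.val x),
    ENNReal.ofReal_prod_of_nonneg]
  · refine Finset.prod_congr rfl fun i _ => ?_
    rw [integral_indicator (hs i), p.toMeasure_apply (hs i)]
  · intro i _
    refine integral_nonneg_of_ae (p.nonneg_ae.mono fun x hx => ?_)
    exact Set.indicator_apply_nonneg fun _ => hx

theorem coeFn_sum_L1 {ι : Type*} (s : Finset ι) (f : ι → L1 Ω) :
    ⇑(∑ i ∈ s, f i) =ᵐ[Ω.refMeasure] fun x => ∑ i ∈ s, f i x := by
  classical
  induction s using Finset.induction_on with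
  | empty =>
    filter_upwards [Lp.coeFn_zero ℝ 1 Ω.refMeasure] with x hx
    simpa using hx
  | insert a s ha ih =>
    rw [Finset.sum_insert ha]
    filter_upwards [Lp.coeFn_add (f a) (∑ i ∈ s, f i), ih] with x h1 h2
    rw [h1, Pi.add_apply, h2, Finset.sum_insert ha]

theorem coe_tangentPow :
    (tangentPow p δ n).1 = ∑ i, tensor (Function.update (fun _ => p.val) i δ.1) := by
  rw [tangentPow]
  exact Submodule.coe_sum _ _ _

variable {p δ}

/-- Logarithmic differentiation of a product: replacing one factor p by δ = L p multiplies the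
product by L at that coordinate. -/
theorem tangentPow_ae_eq (h : HasScore p δ) : (tangentPow p δ n).1 =ᵐ[(Ω.pow n).refMeasure]
    fun x => (∑ i, score p δ (Ω.tuple n x i)) * (p.pow n).val x := by
  rw [coe_tangentPow]
  have h1 : ∀ᵐ x ∂(Ω.pow n).refMeasure, ∀ i : Fin n,
      tensor (Function.update (fun _ => p.val) i δ.1) x =
        ∏ j, (Function.update (fun _ => p.val) i δ.1 j : L1 Ω) (Ω.tuple n x j) :=
    ae_all_iff.2 fun i => coeFn_tensor _
  filter_upwards [coeFn_sum_L1 Finset.univ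
    fun i : Fin n => tensor (Function.update (fun _ => p.val) i δ.1), h1, ae_tuple n h.ae_eq,
    coeFn_tensor (fun _ : Fin n => p.val)] with x h2 h3 h4 h5
  have h5' : (p.pow n).val x = ∏ i, p.val (Ω.tuple n x i) := h5
  rw [h2, Finset.sum_mul, h5']
  refine Finset.sum_congr rfl fun i _ => ?_
  rw [h3, ← Finset.mul_prod_erase _ _ (Finset.mem_univ i),
    ← Finset.mul_prod_erase _ (fun i => p.val (Ω.tuple n x i)) (Finset.mem_univ i),
    Function.update_self, h4 i, mul_assoc]
  congr 2
  refine Finset.prod_congr rfl fun j hj => ?_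
  rw [Function.update_of_ne (Finset.ne_of_mem_erase hj)]

variable (p δ) in
/-- The normalized sum `(L(x₁) + ⋯ + L(xₙ)) / √n` of the scores. -/
def sumScore (x : (Ω.pow n).Carrier) : ℝ := (√(n : ℝ))⁻¹ * ∑ i, score p δ (Ω.tuple n x i)

theorem measurable_tuple_apply (i : Fin n) : Measurable fun x => Ω.tuple n x i :=
  (measurable_pi_apply i).comp (Ω.tuple n).measurable

variable (p δ) in
theorem measurable_sumScore : Measurable (sumScore p δ n) :=
  (Finset.measurable_sum _ fun i _ =>
    (measurable_score p δ).comp (measurable_tuple_apply n i)).const_mul _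

variable (p δ) in
theorem map_sumScore : (p.pow n).toMeasure.map (sumScore p δ n) = stdSum (scoreLaw p δ) n := by
  have h1 : Measurable fun y : Fin n → Ω.Carrier => fun i => score p δ (y i) :=
    measurable_pi_lambda _ fun i => (measurable_score p δ).comp (measurable_pi_apply i)
  have h2 := Measure.pi_map_pi (μ := fun _ : Fin n => p.toMeasure) (f := fun _ => score p δ)
    fun _ => (measurable_score p δ).aemeasurable
  rw [stdSum]
  change _ = Measure.map _ (Measure.pi fun _ => p.toMeasure.map (score p δ))
  rw [← h2, ← map_tuple_toMeasure_pow, Measure.map_map h1 (Ω.tuple n).measurable,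
    Measure.map_map (by fun_prop) (h1.comp (Ω.tuple n).measurable)]
  rfl

theorem tangentPow_ae_eq_sumScore (h : HasScore p δ) (hn : n ≠ 0) :
    (tangentPow p δ n).1 =ᵐ[(Ω.pow n).refMeasure]
      fun x => (√(n : ℝ) * sumScore p δ n x) * (p.pow n).val x := by
  refine (tangentPow_ae_eq n h).trans (.of_forall fun x => ?_)
  have : √(n : ℝ) ≠ 0 := by positivity
  simp only [sumScore]
  rw [mul_inv_cancel_left₀ this]

end Pow

/-- The line as a data space. -/
def lineEquiv : (DataSpace.euclid 1).Carrier ≃ᵐ ℝ := MeasurableEquiv.funUnique (Fin 1) ℝ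

theorem measurePreserving_lineEquiv :
    MeasurePreserving lineEquiv (DataSpace.euclid 1).refMeasure volume :=
  volume_preserving_funUnique (Fin 1) ℝ

/-- If the normalized score sum of `(p, δ)` has the positive density `r`, there is a channel from
`ℝ` to `Ωⁿ` that reconstructs `(p^{⊗n}, δ⁽ⁿ⁾)` from `(r, y r)`. -/
theorem exists_channel_lift {Ω : DataSpace} {p : Density Ω} {δ : Tangent Ω} (h : HasScore p δ)
    {n : ℕ} (hn : n ≠ 0) {r : ℝ → ℝ} (hr : Measurable r) (hr0 : ∀ y, 0 < r y)
    (hlaw : stdSum (scoreLaw p δ) n = volume.withDensity fun y => ENNReal.ofReal (r y))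
    {q : Density (.euclid 1)} {ρ : Tangent (.euclid 1)}
    (hq : q.val =ᵐ[(DataSpace.euclid 1).refMeasure] fun x => r (lineEquiv x))
    (hρ : ρ.1 =ᵐ[(DataSpace.euclid 1).refMeasure] fun x => lineEquiv x * r (lineEquiv x)) :
    ∃ Φ : Channel (.euclid 1) (Ω.pow n), Φ.density q = p.pow n ∧
      √(n : ℝ) • Φ.tangent ρ = tangentPow p δ n := by
  let T : (Ω.pow n).Carrier → (DataSpace.euclid 1).Carrier :=
    fun x => lineEquiv.symm (sumScore p δ n x)
  have hT : Measurable T := lineEquiv.symm.measurable.comp (measurable_sumScore p δ n)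
  have hTl (x) : lineEquiv (T x) = sumScore p δ n x := lineEquiv.apply_symm_apply _
  -- Conditional density of x given its score sum: f on the line goes to f(S_n) p^{⊗n} / r(S_n).
  -- This preserves integrals because S_n has law r; positivity of r makes the division harmless.
  let K : (Ω.pow n).Carrier → ℝ≥0 := fun x =>
    ((p.pow n).val x).toNNReal / (r (sumScore p δ n x)).toNNReal
  have hK : Measurable K := (measurable_coeFn_L1 _).real_toNNReal.div
    (hr.comp (measurable_sumScore p δ n)).real_toNNReal
  have hr1 (y : ℝ) : (r y).toNNReal ≠ 0 := by simpa using hr0 y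
  obtain ⟨Φ, hΦ⟩ := exists_channel_pullback hT hK (Ω := .euclid 1) (Ω' := Ω.pow n) fun S hS => by
    have hS' : MeasurableSet (lineEquiv.symm ⁻¹' S) := lineEquiv.symm.measurable hS
    have hm : Measurable fun y : ℝ =>
        (lineEquiv.symm ⁻¹' S).indicator (1 : ℝ → ℝ≥0∞) y / ENNReal.ofReal (r y) :=
      (measurable_one.indicator hS').div hr.ennreal_ofReal
    have e (x : (Ω.pow n).Carrier) : (K x : ℝ≥0∞) * S.indicator 1 (T x) =
        ENNReal.ofReal ((p.pow n).val x) * (fun y => (lineEquiv.symm ⁻¹' S).indicator 1 y /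
          ENNReal.ofReal (r y)) (sumScore p δ n x) := by
      simp only [K]
      rw [ENNReal.coe_div (hr1 _), div_eq_mul_inv, div_eq_mul_inv, mul_assoc, mul_comm (_⁻¹)]
      rfl
    simp_rw [e]
    rw [← (p.pow n).lintegral_toMeasure (F := fun x => (fun y =>
        (lineEquiv.symm ⁻¹' S).indicator (1 : ℝ → ℝ≥0∞) y / ENNReal.ofReal (r y))
          (sumScore p δ n x)) (hm.comp (measurable_sumScore p δ n)),
      ← lintegral_map hm (measurable_sumScore p δ n), map_sumScore, hlaw,
      lintegral_withDensity_eq_lintegral_mul _ hr.ennreal_ofReal hm]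
    have e2 (y : ℝ) : ((fun y => ENNReal.ofReal (r y)) * fun y : ℝ =>
        (lineEquiv.symm ⁻¹' S).indicator (1 : ℝ → ℝ≥0∞) y / ENNReal.ofReal (r y)) y =
        (lineEquiv.symm ⁻¹' S).indicator 1 y := by
      rw [Pi.mul_apply, ENNReal.mul_div_cancel (by simpa using hr0 y) ENNReal.ofReal_ne_top]
    simp_rw [e2]
    rw [lintegral_indicator_one hS']
    exact measurePreserving_lineEquiv.symm.measure_preimage hS.nullMeasurableSet
  have hKr (x : (Ω.pow n).Carrier) (hx : 0 ≤ (p.pow n).val x) :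
      (K x : ℝ) * r (sumScore p δ n x) = (p.pow n).val x := by
    simp only [K]
    rw [NNReal.coe_div, Real.coe_toNNReal _ hx, Real.coe_toNNReal _ (hr0 _).le,
      div_mul_cancel₀ _ (hr0 _).ne']
  refine ⟨Φ, Density.ext (Lp.ext ?_), Subtype.ext (Lp.ext ?_)⟩
  · filter_upwards [hΦ _ _ hq, (p.pow n).nonneg_ae] with x h1 h2
    rw [hTl] at h1
    exact h1.trans (hKr x h2)
  · filter_upwards [hΦ _ _ hρ, (p.pow n).nonneg_ae, tangentPow_ae_eq_sumScore n h hn,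
      Lp.coeFn_smul (√(n : ℝ)) (Φ.toLinearMap ρ.1)] with x h1 h2 h3 h4
    change (√(n : ℝ) • Φ.toLinearMap ρ.1) x = _
    rw [h3, h4, Pi.smul_apply, h1, hTl, smul_eq_mul]
    conv_rhs => rw [← hKr x h2]
    ring

/-! ### The Gaussian shift -/

theorem gaussDensity_ae_eq : gaussDensity.val =ᵐ[(DataSpace.euclid 1).refMeasure]
    fun x => gaussianPDFReal 0 1 (lineEquiv x) :=
  Integrable.coeFn_toL1 (measurePreserving_eval_zero.integrable_comp_of_integrable
    (integrable_gaussianPDFReal 0 1))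

theorem gaussTangent_ae_eq : gaussTangent.1 =ᵐ[(DataSpace.euclid 1).refMeasure]
    fun x => lineEquiv x * gaussianPDFReal 0 1 (lineEquiv x) :=
  Integrable.coeFn_toL1 (measurePreserving_eval_zero.integrable_comp_of_integrable
    integrable_id_mul_gaussianPDFReal)

theorem gaussTangent_ae_eq_mul : gaussTangent.1 =ᵐ[(DataSpace.euclid 1).refMeasure]
    fun x => lineEquiv x * gaussDensity.val x := by
  filter_upwards [gaussDensity_ae_eq, gaussTangent_ae_eq] with x h1 h2
  rw [h2, h1]

theorem hasScore_gauss : HasScore gaussDensity gaussTangent :=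
  hasScore_of_ae_eq gaussTangent_ae_eq_mul

theorem map_lineEquiv_gaussDensity : gaussDensity.toMeasure.map lineEquiv = gaussianReal 0 1 := by
  rw [gaussDensity.toMeasure_eq gaussDensity_ae_eq, gaussianReal_of_var_ne_zero 0 one_ne_zero]
  ext S hS
  rw [Measure.map_apply lineEquiv.measurable hS, withDensity_apply _ (lineEquiv.measurable hS),
    withDensity_apply _ hS]
  exact measurePreserving_lineEquiv.setLIntegral_comp_preimage hS (measurable_gaussianPDF 0 1)

theorem scoreLaw_gauss : scoreLaw gaussDensity gaussTangent = gaussianReal 0 1 := by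
  rw [scoreLaw_eq gaussTangent_ae_eq_mul, map_lineEquiv_gaussDensity]

theorem axiomN0_fisher : AxiomN0 fisher := by
  have h : Integrable (fun x : ℝ => x ^ 2) (gaussianReal 0 1) :=
    isStandardized_gaussianReal.memLp.integrable_sq
  rw [AxiomN0, hasScore_gauss.fisher_eq_scoreLaw, scoreLaw_gauss,
    ← ofReal_integral_eq_lintegral_ofReal h (.of_forall fun x => sq_nonneg x)]
  simp [isStandardized_gaussianReal.second]

/-! ### Scaling -/

theorem IsNormSq.smul {g : Metric} (hg : IsNormSq g) {Ω : DataSpace} (p : Density Ω) (c : ℝ)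
    (δ : Tangent Ω) : g Ω p (c • δ) = ENNReal.ofReal (c ^ 2) * g Ω p δ := by
  obtain ⟨N, hN, hgN⟩ := hg Ω p
  rw [hgN, hgN, hN.smul, mul_pow, ← ENNReal.ofReal_pow (abs_nonneg c), sq_abs]

theorem IsNormSq.eq_zero_iff {g : Metric} (hg : IsNormSq g) {Ω : DataSpace} {p : Density Ω}
    {δ : Tangent Ω} : g Ω p δ = 0 ↔ δ = 0 := by
  obtain ⟨N, hN, hgN⟩ := hg Ω p
  rw [hgN, pow_eq_zero_iff two_ne_zero, hN.eq_zero_iff]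

theorem tensor_update_smul {Ω : DataSpace} {n : ℕ} (f : Fin n → L1 Ω) (i : Fin n) (c : ℝ)
    (h : L1 Ω) : tensor (Function.update f i (c • h)) = c • tensor (Function.update f i h) := by
  refine Lp.ext ?_
  filter_upwards [coeFn_tensor (Function.update f i (c • h)), coeFn_tensor (Function.update f i h),
    Lp.coeFn_smul c (tensor (Function.update f i h)), ae_tuple n (Lp.coeFn_smul c h)]
    with x h1 h2 h3 h4
  rw [h1, h3, Pi.smul_apply, h2, smul_eq_mul, ← Finset.mul_prod_erase _ _ (Finset.mem_univ i),
    ← Finset.mul_prod_erase Finset.univ (fun j => (Function.update f i h j : L1 Ω) _)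
      (Finset.mem_univ i), Function.update_self, Function.update_self, h4 i, Pi.smul_apply,
    smul_eq_mul, mul_assoc]
  congr 2
  refine Finset.prod_congr rfl fun j hj => ?_
  rw [Function.update_of_ne (Finset.ne_of_mem_erase hj),
    Function.update_of_ne (Finset.ne_of_mem_erase hj)]

/-- With the quadratic homogeneity of g and J, this reduces the arguments to Fisher information one.
-/
theorem tangentPow_smul {Ω : DataSpace} (p : Density Ω) (c : ℝ) (δ : Tangent Ω) (n : ℕ) :
    tangentPow p (c • δ) n = c • tangentPow p δ n := by
  refine Subtype.ext ?_
  rw [Submodule.coe_smul, coe_tangentPow, coe_tangentPow, Finset.smul_sum]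
  exact Finset.sum_congr rfl fun i _ => tensor_update_smul _ i c δ.1

/-- A nonzero tangent vector of finite Fisher information is a multiple of one with Fisher
information one. -/
theorem exists_smul_fisher_eq_one {Ω : DataSpace} {p : Density Ω} {δ : Tangent Ω}
    (h : fisher Ω p δ ≠ ∞) (h0 : δ ≠ 0) :
    ∃ δ₁ : Tangent Ω, fisher Ω p δ₁ = 1 ∧ δ = √(fisher Ω p δ).toReal • δ₁ := by
  have h1 : 0 < (fisher Ω p δ).toReal :=
    ENNReal.toReal_pos (fun h2 => h0 (isNormSq_fisher.eq_zero_iff.1 h2)) h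
  have h2 : √(fisher Ω p δ).toReal ≠ 0 := (Real.sqrt_pos.2 h1).ne'
  refine ⟨(√(fisher Ω p δ).toReal)⁻¹ • δ, ?_, (smul_inv_smul₀ h2 δ).symm⟩
  rw [isNormSq_fisher.smul, inv_pow, Real.sq_sqrt h1.le, ENNReal.ofReal_inv_of_pos h1,
    ENNReal.ofReal_toReal h, ENNReal.inv_mul_cancel _ h]
  exact fun h2 => h0 (isNormSq_fisher.eq_zero_iff.1 h2)

/-! ### Asymptotic additivity of Fisher information -/

/-- For J = 1 the score of the product is √n times a normalized sum of variance one; the general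
case follows by scaling. -/
theorem fisher_tangentPow {Ω : DataSpace} {p : Density Ω} {δ : Tangent Ω} (h : fisher Ω p δ ≠ ∞)
    {n : ℕ} (hn : n ≠ 0) :
    fisher (Ω.pow n) (p.pow n) (tangentPow p δ n) = n * fisher Ω p δ := by
  have key (δ : Tangent Ω) (h1 : fisher Ω p δ = 1) :
      fisher (Ω.pow n) (p.pow n) (tangentPow p δ n) = n := by
    have hs := hasScore_of_fisher_ne_top (h1 ▸ ENNReal.one_ne_top)
    have hae := tangentPow_ae_eq_sumScore n hs hn
    have hst := (isStandardized_scoreLaw h1).stdSum hn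
    have hi : Integrable (fun x : ℝ => x ^ 2) (stdSum (scoreLaw p δ) n) := hst.memLp.integrable_sq
    have hm := measurable_sumScore p δ n
    rw [(hasScore_of_ae_eq hae).fisher_eq_scoreLaw, scoreLaw_eq hae,
      lintegral_map (by fun_prop) (by fun_prop)]
    simp_rw [mul_pow, Real.sq_sqrt (Nat.cast_nonneg (α := ℝ) n),
      ENNReal.ofReal_mul (Nat.cast_nonneg (α := ℝ) n)]
    rw [lintegral_const_mul _ (by fun_prop),
      ← lintegral_map (f := fun y : ℝ => ENNReal.ofReal (y ^ 2)) (by fun_prop) hm, map_sumScore,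
      ← ofReal_integral_eq_lintegral_ofReal hi (.of_forall fun x => sq_nonneg x), hst.second]
    simp
  by_cases h0 : δ = 0
  · have e1 : tangentPow p δ n = 0 := by
      rw [h0, ← zero_smul ℝ (0 : Tangent Ω), tangentPow_smul, zero_smul]
    rw [e1, isNormSq_fisher.eq_zero_iff.2 rfl, isNormSq_fisher.eq_zero_iff.2 h0, mul_zero]
  · obtain ⟨δ₁, h1, h2⟩ := exists_smul_fisher_eq_one h h0
    rw [h2, tangentPow_smul, isNormSq_fisher.smul, isNormSq_fisher.smul, key δ₁ h1, h1, mul_one,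
      mul_comm]

/-- The channel that forgets all but the first component. -/
theorem exists_channel_first (Ω : DataSpace) (m : ℕ) : ∃ Ψ : Channel (Ω.pow (m + 1)) Ω,
    ∀ f : Fin (m + 1) → L1 Ω, Ψ.toLinearMap (tensor f) =
      (∏ j : Fin m, ∫ x, f j.succ x ∂Ω.refMeasure) • f 0 := by
  let e := MeasurableEquiv.piFinSuccAbove (fun _ : Fin (m + 1) => Ω.Carrier) 0
  have h1 : MeasurePreserving e.symm (Ω.refMeasure.prod (Measure.pi fun _ : Fin m => Ω.refMeasure))
      (Measure.pi fun _ => Ω.refMeasure) :=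
    (measurePreserving_piFinSuccAbove (fun _ : Fin (m + 1) => Ω.refMeasure) 0).symm
  have h2 := (Ω.measurePreserving_tuple (m + 1)).symm.comp h1
  obtain ⟨Ψ, hΨ⟩ := exists_channel (Ω := Ω.pow (m + 1)) (Ω' := Ω) (K := fun _ => 1)
    (ν := Measure.pi fun _ : Fin m => Ω.refMeasure) h2.measurable measurable_const (by
      simpa using h2.map_eq)
  refine ⟨Ψ, fun f => Lp.ext ?_⟩
  filter_upwards [hΨ _ _ (coeFn_tensor f),
    Lp.coeFn_smul (∏ j : Fin m, ∫ x, f j.succ x ∂Ω.refMeasure) (f 0)] with x h3 h4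
  rw [h3, h4, Pi.smul_apply, smul_eq_mul,
    ← integral_fintype_prod_eq_prod (fun (j : Fin m) x => f j.succ x), ← integral_mul_const]
  refine integral_congr_ae (.of_forall fun z => ?_)
  simp only [Function.comp_apply, MeasurableEquiv.apply_symm_apply, NNReal.coe_one, one_mul]
  rw [Fin.prod_univ_succ, mul_comm]
  rfl

/-- The first marginal of δ^{(n)} is δ, since the summands carrying δ in another coordinate
integrate to zero. This settles (A0) when J = ∞, where no score need exist. -/
theorem fisher_le_fisher_tangentPow {Ω : DataSpace} (p : Density Ω) (δ : Tangent Ω) (m : ℕ) :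
    fisher Ω p δ ≤ fisher (Ω.pow (m + 1)) (p.pow (m + 1)) (tangentPow p δ (m + 1)) := by
  obtain ⟨Ψ, hΨ⟩ := exists_channel_first Ω m
  have h1 : Ψ.density (p.pow (m + 1)) = p := by
    refine Density.ext ((hΨ _).trans ?_)
    simp [p.integral_eq_one]
  have h2 : Ψ.tangent (tangentPow p δ (m + 1)) = δ := by
    refine Subtype.ext ?_
    change Ψ.toLinearMap (tangentPow p δ (m + 1)).1 = _
    rw [coe_tangentPow, map_sum, Fin.sum_univ_succ, Finset.sum_eq_zero]
    · rw [hΨ, Function.update_self]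
      simp [p.integral_eq_one]
    · intro i _
      rw [hΨ, Finset.prod_eq_zero (Finset.mem_univ i), zero_smul]
      rw [Function.update_self]
      exact δ.2
  have := axiomM0_fisher _ _ Ψ (p.pow (m + 1)) (tangentPow p δ (m + 1))
  rwa [h1, h2] at this

theorem axiomA0_fisher : AxiomA0 fisher := by
  intro Ω p δ
  refine (tendsto_congr' ?_).2 tendsto_const_nhds
  filter_upwards [eventually_ne_atTop 0] with n hn
  have h0 : (n : ℝ≥0∞) ≠ 0 := by exact_mod_cast hn
  by_cases h : fisher Ω p δ = ∞
  · obtain ⟨m, rfl⟩ := Nat.exists_eq_succ_of_ne_zero hn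
    have := fisher_le_fisher_tangentPow p δ m
    rw [h, top_le_iff] at this
    rw [this, h, ENNReal.top_div_of_ne_top (ENNReal.natCast_ne_top _)]
  · rw [fisher_tangentPow h hn, ENNReal.mul_div_right_comm,
      ENNReal.div_self h0 (ENNReal.natCast_ne_top n), one_mul]

/-! ### Lower asymptotic continuity of Fisher information -/

theorem ofReal_integral_le_lintegral_ofReal {α : Type*} [MeasurableSpace α] {μ : Measure α}
    {F : α → ℝ} (hF : Integrable F μ) :
    ENNReal.ofReal (∫ x, F x ∂μ) ≤ ∫⁻ x, ENNReal.ofReal (F x) ∂μ := by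
  refine (ENNReal.ofReal_le_ofReal ?_).trans ENNReal.ofReal_toReal_le
  rw [integral_eq_lintegral_pos_part_sub_lintegral_neg_part hF]
  exact sub_le_self _ ENNReal.toReal_nonneg

theorem integrable_bdd_mul {Ω : DataSpace} (f : L1 Ω) {h : Ω.Carrier → ℝ} (hm : Measurable h)
    {M : ℝ} (hM : ∀ x, |h x| ≤ M) : Integrable (fun x => h x * f x) Ω.refMeasure :=
  (L1.integrable_coeFn f).bdd_mul (c := M) hm.aestronglyMeasurable (.of_forall hM)

theorem abs_integral_mul_sub_le {Ω : DataSpace} (f f' : L1 Ω) {h : Ω.Carrier → ℝ}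
    (hm : Measurable h) {M : ℝ} (hM : ∀ x, |h x| ≤ M) :
    |∫ x, h x * f x ∂Ω.refMeasure - ∫ x, h x * f' x ∂Ω.refMeasure| ≤ M * ‖f - f'‖ := by
  rw [← integral_sub (integrable_bdd_mul f hm hM) (integrable_bdd_mul f' hm hM),
    norm_L1_eq_integral_abs, ← integral_const_mul]
  refine (abs_integral_le_integral_abs).trans (integral_mono_ae ?_ ?_ ?_)
  · exact ((integrable_bdd_mul f hm hM).sub (integrable_bdd_mul f' hm hM)).abs
  · exact (L1.integrable_coeFn (f - f')).abs.const_mul M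
  · filter_upwards [Lp.coeFn_sub f f'] with x hx
    rw [hx, Pi.sub_apply, ← mul_sub, abs_mul]
    exact mul_le_mul_of_nonneg_right (hM x) (abs_nonneg _)

/-- The variational lower bound for Fisher information. -/
theorem ofReal_le_fisher {Ω : DataSpace} (q : Density Ω) (δ : Tangent Ω) {h : Ω.Carrier → ℝ}
    (hm : Measurable h) {M : ℝ} (hM : ∀ x, |h x| ≤ M) :
    ENNReal.ofReal (2 * ∫ x, h x * δ.1 x ∂Ω.refMeasure - ∫ x, h x ^ 2 * q.val x ∂Ω.refMeasure) ≤
      fisher Ω q δ := by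
  have i1 := (integrable_bdd_mul δ.1 hm hM).const_mul 2
  have i2 : Integrable (fun x => h x ^ 2 * q.val x) Ω.refMeasure :=
    integrable_bdd_mul q.val (hm.pow_const 2) (M := M ^ 2) fun x => by
      rw [abs_pow]; exact pow_le_pow_left₀ (abs_nonneg _) (hM x) 2
  rw [← integral_const_mul, ← integral_sub i1 i2]
  refine (ofReal_integral_le_lintegral_ofReal (i1.sub i2)).trans (lintegral_mono_ae ?_)
  filter_upwards [q.nonneg_ae] with x hx
  rcases hx.eq_or_lt with h0 | h0
  · rw [Pi.sub_apply]
    by_cases h1 : δ.1 x = 0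
    · simp [← h0, h1]
    · rw [← h0, ENNReal.ofReal_zero, ENNReal.div_zero]
      · exact le_top
      · simpa using h1
  · rw [← ENNReal.ofReal_div_of_pos h0]
    refine ENNReal.ofReal_le_ofReal ?_
    rw [Pi.sub_apply, le_div_iff₀ h0]
    -- Pointwise, 2hδ - h²q ≤ δ²/q by completing the square.
    nlinarith [sq_nonneg (h x * q.val x - δ.1 x)]

/-! ### Truncated score sums as test functions -/

/-- Truncation to `[-M, M]`. -/
def clip (M y : ℝ) : ℝ := max (-M) (min y M)

theorem continuous_clip (M : ℝ) : Continuous (clip M) := by unfold clip; fun_prop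

theorem abs_clip_le {M : ℝ} (hM : 0 ≤ M) (y : ℝ) : |clip M y| ≤ M :=
  abs_le.2 ⟨le_max_left _ _, max_le (by linarith) (min_le_right _ _)⟩

theorem sq_clip_le {M : ℝ} (hM : 0 ≤ M) (y : ℝ) : clip M y ^ 2 ≤ clip M y * y := by
  unfold clip
  rcases le_total y M with h | h
  · rw [min_eq_left h]
    rcases le_total (-M) y with h2 | h2
    · rw [max_eq_right h2]; nlinarith
    · rw [max_eq_left h2]; nlinarith
  · rw [min_eq_right h, max_eq_right (by linarith)]; nlinarith

theorem tendsto_integral_sq_clip :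
    Tendsto (fun M : ℕ => ∫ y, clip M y ^ 2 ∂gaussianReal 0 1) atTop (𝓝 1) := by
  rw [← isStandardized_gaussianReal.second]
  refine tendsto_integral_of_dominated_convergence (fun y => y ^ 2)
    (fun M => ((continuous_clip M).pow 2).aestronglyMeasurable)
    isStandardized_gaussianReal.memLp.integrable_sq (fun M => .of_forall fun y => ?_)
    (.of_forall fun y => ?_)
  · have h1 := sq_clip_le (Nat.cast_nonneg (α := ℝ) M) y
    rw [Real.norm_of_nonneg (sq_nonneg _)]
    nlinarith [sq_nonneg (clip M y - y)]
  · refine tendsto_const_nhds.congr' ?_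
    filter_upwards [eventually_ge_atTop ⌈|y|⌉₊] with M hM
    have h1 : |y| ≤ M := (Nat.le_ceil _).trans (by exact_mod_cast hM)
    rw [abs_le] at h1
    rw [clip, min_eq_left h1.2, max_eq_right h1.1]

/-- Test the variational bound with h = √n · clip(S_n). Being bounded, h integrates stably against
the perturbed pair, and by the central limit theorem the unperturbed value is at least about n times
the truncated Gaussian second moment, which is close to n. -/
theorem eventually_le_fisher {Ω : DataSpace} {p : Density Ω} {δ : Tangent Ω}
    (h : fisher Ω p δ = 1) {q : ∀ n : ℕ, Density (Ω.pow n)} {δ' : ∀ n : ℕ, Tangent (Ω.pow n)}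
    (hq : Tendsto (fun n : ℕ => ‖(q n).val - (p.pow n).val‖) atTop (𝓝 0))
    (hδ : Tendsto (fun n : ℕ => 1 / √(n : ℝ) * ‖δ' n - tangentPow p δ n‖) atTop (𝓝 0))
    {c : ℝ} (hc : c < 1) :
    ∀ᶠ n : ℕ in atTop, ENNReal.ofReal (n * c) ≤ fisher (Ω.pow n) (q n) (δ' n) := by
  have hs := hasScore_of_fisher_ne_top (h ▸ ENNReal.one_ne_top)
  obtain ⟨M, hM⟩ := (tendsto_integral_sq_clip.eventually (lt_mem_nhds hc)).exists
  have hM0 : (0 : ℝ) ≤ M := Nat.cast_nonneg M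
  have hcl (y : ℝ) := abs_clip_le hM0 y
  have hcl2 (y : ℝ) : |clip M y ^ 2| ≤ (M : ℝ) ^ 2 := by
    rw [abs_pow]; exact pow_le_pow_left₀ (abs_nonneg _) (hcl y) 2
  have hlim : Tendsto (fun n : ℕ => ∫ y, clip M y ^ 2 ∂stdSum (scoreLaw p δ) n -
      2 * M * (1 / √(n : ℝ) * ‖δ' n - tangentPow p δ n‖) -
      (M : ℝ) ^ 2 * ‖(q n).val - (p.pow n).val‖) atTop
      (𝓝 (∫ y, clip M y ^ 2 ∂gaussianReal 0 1 - 2 * M * 0 - (M : ℝ) ^ 2 * 0)) :=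
    ((tendsto_integral_stdSum (isStandardized_scoreLaw h) ((continuous_clip M).pow 2) hcl2).sub
      (hδ.const_mul _)).sub (hq.const_mul _)
  rw [mul_zero, mul_zero, sub_zero, sub_zero] at hlim
  filter_upwards [hlim.eventually (lt_mem_nhds hM), eventually_ne_atTop 0] with n hn hn0
  have hst := (isStandardized_scoreLaw h).stdSum hn0
  have hsq : 0 < √(n : ℝ) := by positivity
  have hmS := measurable_sumScore p δ n
  have hmψ : Measurable fun x => clip M (sumScore p δ n x) := (continuous_clip M).measurable.comp hmS
  have hψ (x) := hcl (sumScore p δ n x)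
  have hcc : Continuous fun y => clip M y * y := (continuous_clip M).mul continuous_id
  have hcc2 : Continuous fun y => clip M y ^ 2 := (continuous_clip M).pow 2
  have e1 : ∫ x, clip M (sumScore p δ n x) * (tangentPow p δ n).1 x ∂(Ω.pow n).refMeasure =
      √(n : ℝ) * ∫ y, clip M y * y ∂stdSum (scoreLaw p δ) n := by
    rw [← map_sumScore, integral_map hmS.aemeasurable
      hcc.aestronglyMeasurable,
      (p.pow n).integral_toMeasure, ← integral_const_mul]
    refine integral_congr_ae ?_
    filter_upwards [tangentPow_ae_eq_sumScore n hs hn0] with x hx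
    rw [hx]; ring
  have e2 : ∫ x, clip M (sumScore p δ n x) ^ 2 * (p.pow n).val x ∂(Ω.pow n).refMeasure =
      ∫ y, clip M y ^ 2 ∂stdSum (scoreLaw p δ) n := by
    rw [← map_sumScore, integral_map hmS.aemeasurable
      hcc2.aestronglyMeasurable, (p.pow n).integral_toMeasure]
    simp_rw [mul_comm]
  -- This replaces the unbounded integrand clip(y) · y, to which weak convergence does not apply, by
  -- the bounded clip(y)².
  have i1 : ∫ y, clip M y ^ 2 ∂stdSum (scoreLaw p δ) n ≤
      ∫ y, clip M y * y ∂stdSum (scoreLaw p δ) n := by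
    have := hst.isProb
    refine integral_mono ?_ ?_ fun y => sq_clip_le hM0 y
    · exact Integrable.of_bound ((continuous_clip M).pow 2).aestronglyMeasurable _
        (.of_forall hcl2)
    · exact (hst.memLp.integrable (by norm_num)).bdd_mul (c := M)
        (continuous_clip M).aestronglyMeasurable (.of_forall hcl)
  have i2 := abs_le.1 (abs_integral_mul_sub_le (δ' n).1 (tangentPow p δ n).1 hmψ hψ)
  have i3 := abs_le.1 (abs_integral_mul_sub_le (q n).val (p.pow n).val (hmψ.pow_const 2)
    (M := (M : ℝ) ^ 2) fun x => hcl2 _)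
  have key := ofReal_le_fisher (q n) (δ' n) (h := fun x => √(n : ℝ) * clip M (sumScore p δ n x))
    (hmψ.const_mul _) (M := √(n : ℝ) * M) fun x => by
      rw [abs_mul, abs_of_pos hsq]; exact mul_le_mul_of_nonneg_left (hψ x) hsq.le
  refine (ENNReal.ofReal_le_ofReal ?_).trans key
  simp_rw [mul_pow, Real.sq_sqrt (Nat.cast_nonneg (α := ℝ) n), mul_assoc, integral_const_mul]
  rw [e1] at i2
  rw [e2] at i3
  set X := ∫ x, clip M (sumScore p δ n x) * (δ' n).1 x ∂(Ω.pow n).refMeasure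
  set Y := ∫ x, clip M (sumScore p δ n x) ^ 2 * (q n).val x ∂(Ω.pow n).refMeasure
  set A := ∫ y, clip M y ^ 2 ∂stdSum (scoreLaw p δ) n
  set B := ∫ y, clip M y * y ∂stdSum (scoreLaw p δ) n
  have hD : ‖(δ' n).1 - (tangentPow p δ n).1‖ = ‖δ' n - tangentPow p δ n‖ := rfl
  rw [hD] at i2
  set D := ‖δ' n - tangentPow p δ n‖
  set E := ‖(q n).val - (p.pow n).val‖
  have hn' : (n : ℝ) = √(n : ℝ) * √(n : ℝ) := (Real.mul_self_sqrt (Nat.cast_nonneg n)).symm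
  have h1 : √(n : ℝ) * B - M * D ≤ X := by linarith [i2.1]
  have h2 : Y ≤ A + (M : ℝ) ^ 2 * E := by linarith [i3.2]
  -- The tangent perturbation costs 2√n M D, which is n times 2M D/√n; this is the scaling in (C0).
  calc (n : ℝ) * c ≤ n * (A - 2 * M * (1 / √(n : ℝ) * D) - (M : ℝ) ^ 2 * E) := by gcongr
    _ = 2 * (√(n : ℝ) * (√(n : ℝ) * A - M * D)) - n * (A + (M : ℝ) ^ 2 * E) := by
        rw [hn', Real.sqrt_mul_self hsq.le]; field_simp; ring
    _ ≤ 2 * (√(n : ℝ) * X) - n * Y := by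
        gcongr
        exact le_trans (by gcongr) h1

theorem axiomC0_fisher : AxiomC0 fisher := by
  intro Ω p δ hfin q δ' hq hδ
  have key (c : ℝ) (hc : c < (fisher Ω p δ).toReal) :
      ∀ᶠ n : ℕ in atTop, ENNReal.ofReal (n * c) ≤ fisher (Ω.pow n) (q n) (δ' n) := by
    by_cases h0 : δ = 0
    · rw [isNormSq_fisher.eq_zero_iff.2 h0, ENNReal.toReal_zero] at hc
      refine .of_forall fun n => ?_
      rw [ENNReal.ofReal_of_nonpos (mul_nonpos_of_nonneg_of_nonpos (Nat.cast_nonneg n) hc.le)]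
      exact zero_le
    obtain ⟨δ₁, h1, h2⟩ := exists_smul_fisher_eq_one hfin h0
    have hJ : 0 < (fisher Ω p δ).toReal :=
      ENNReal.toReal_pos (fun h2 => h0 (isNormSq_fisher.eq_zero_iff.1 h2)) hfin
    set s := √(fisher Ω p δ).toReal with hs
    have hs0 : 0 < s := Real.sqrt_pos.2 hJ
    have hδ1 : Tendsto (fun n : ℕ => 1 / √(n : ℝ) * ‖s⁻¹ • δ' n - tangentPow p δ₁ n‖) atTop
        (𝓝 0) := by
      have := hδ.const_mul s⁻¹
      rw [mul_zero] at this
      refine this.congr fun n => ?_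
      have e : s⁻¹ • δ' n - tangentPow p δ₁ n = s⁻¹ • (δ' n - tangentPow p δ n) := by
        rw [smul_sub, h2, tangentPow_smul, inv_smul_smul₀ hs0.ne']
      rw [e, norm_smul, Real.norm_of_nonneg (inv_nonneg.2 hs0.le)]
      ring
    have hc1 : c / (fisher Ω p δ).toReal < 1 := (div_lt_one hJ).2 hc
    filter_upwards [eventually_le_fisher h1 hq hδ1 hc1] with n hn
    rw [isNormSq_fisher.smul] at hn
    have h3 := mul_le_mul_right hn (ENNReal.ofReal (s ^ 2))
    rw [← mul_assoc, ← ENNReal.ofReal_mul (sq_nonneg s), ← ENNReal.ofReal_mul (sq_nonneg s),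
      ← mul_pow, mul_inv_cancel₀ hs0.ne', one_pow, ENNReal.ofReal_one, one_mul, hs,
      Real.sq_sqrt hJ.le] at h3
    convert h3 using 2
    field_simp
  refine le_of_forall_lt_imp_le_of_dense fun c hc => ?_
  induction c with
  | bot => exact bot_le
  | top => simp at hc
  | coe c =>
    have hc' : c < 0 := by exact_mod_cast hc
    refine le_liminf_of_le (by isBoundedDefault) ?_
    filter_upwards [key (c + (fisher Ω p δ).toReal) (by linarith), eventually_ne_atTop 0]
      with n hn hn0
    have hn1 : (0 : ℝ) < n := by positivity
    rw [fisher_tangentPow hfin hn0]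
    set J := (fisher Ω p δ).toReal with hJ
    have e1 : ((n * fisher Ω p δ : ℝ≥0∞) : EReal) = ((n * J : ℝ) : EReal) := by
      rw [← ENNReal.ofReal_toReal hfin, ← hJ, ← ENNReal.ofReal_natCast,
        ← ENNReal.ofReal_mul (Nat.cast_nonneg n), EReal.coe_ennreal_ofReal,
        max_eq_left (mul_nonneg (Nat.cast_nonneg n) ENNReal.toReal_nonneg)]
    -- If c + J < 0, then `ENNReal.ofReal` truncates to 0, which is still an upper bound for the
    -- left side.
    have e2 : ((n * (c + J) : ℝ) : EReal) ≤ (fisher (Ω.pow n) (q n) (δ' n) : EReal) := by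
      refine le_trans ?_ (EReal.coe_ennreal_le_coe_ennreal_iff.2 hn)
      rw [EReal.coe_ennreal_ofReal]
      exact_mod_cast le_max_left _ _
    have e3 : (n : EReal) = ((n : ℝ) : EReal) := rfl
    rw [e1, e3, EReal.le_div_iff_mul_le (by exact_mod_cast hn1) (EReal.coe_ne_top _)]
    refine le_trans (le_of_eq ?_) (EReal.sub_le_sub e2 le_rfl)
    rw [← EReal.coe_mul, ← EReal.coe_sub]
    congr 1
    ring

theorem satisfiesAxioms_fisher : SatisfiesAxioms fisher :=
  ⟨isNormSq_fisher, axiomM0_fisher, axiomA0_fisher, axiomC0_fisher, axiomN0_fisher⟩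

/-! ### Consequences of the axioms -/

/-- The only use of (C0) for a general g: the values along an approximating sequence, divided by n,
cannot eventually drop below those along the exact powers, which tend to g_p(δ) by (A0). -/
theorem SatisfiesAxioms.le_of_tendsto {g : Metric} (hg : SatisfiesAxioms g) {Ω : DataSpace}
    {p : Density Ω} {δ : Tangent Ω} (hfin : g Ω p δ ≠ ∞) {q : ∀ n : ℕ, Density (Ω.pow n)}
    {δ' : ∀ n : ℕ, Tangent (Ω.pow n)}
    (hq : Tendsto (fun n : ℕ => ‖(q n).val - (p.pow n).val‖) atTop (𝓝 0))
    (hδ : Tendsto (fun n : ℕ => 1 / √(n : ℝ) * ‖δ' n - tangentPow p δ n‖) atTop (𝓝 0))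
    {u : ℕ → ℝ≥0∞} {U : ℝ≥0∞} (hu : Tendsto (fun n : ℕ => u n / n) atTop (𝓝 U))
    (hle : ∀ᶠ n : ℕ in atTop, g (Ω.pow n) (q n) (δ' n) ≤ u n) : g Ω p δ ≤ U := by
  by_contra! hlt
  -- Choose U < c < d < g_p(δ). Then the perturbed values are eventually at most c n and the exact
  -- ones at least d n, so the liminf in (C0) is at most c - d < 0.
  obtain ⟨c, hUc, hcG⟩ := ENNReal.lt_iff_exists_nnreal_btwn.1 hlt
  obtain ⟨d, hcd, hdG⟩ := ENNReal.lt_iff_exists_nnreal_btwn.1 hcG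
  have h0 := hg.c0 Ω p δ hfin q δ' hq hδ
  have hcd' : c < d := by exact_mod_cast hcd
  have h1 : liminf (fun n : ℕ => ((g (Ω.pow n) (q n) (δ' n) : EReal) -
      (g (Ω.pow n) (p.pow n) (tangentPow p δ n) : EReal)) / (n : EReal)) atTop ≤
      ((c - d : ℝ) : EReal) := by
    refine liminf_le_of_frequently_le (Eventually.frequently ?_) (by isBoundedDefault)
    filter_upwards [hle, hu.eventually (gt_mem_nhds hUc),
      (hg.a0 Ω p δ).eventually (lt_mem_nhds hdG), eventually_ne_atTop 0] with n h2 h3 h4 hn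
    have hn0 : (n : ℝ≥0∞) ≠ 0 := by exact_mod_cast hn
    have hnt : (n : ℝ≥0∞) ≠ ∞ := ENNReal.natCast_ne_top n
    have hn1 : (0 : ℝ) < n := by positivity
    have e1 : (g (Ω.pow n) (q n) (δ' n) : EReal) ≤ ((c * n : ℝ) : EReal) := by
      have : g (Ω.pow n) (q n) (δ' n) ≤ ((c * n : ℝ≥0) : ℝ≥0∞) := by
        push_cast
        exact h2.trans ((ENNReal.div_le_iff hn0 hnt).1 h3.le)
      exact (EReal.coe_ennreal_le_coe_ennreal_iff.2 this).trans (le_of_eq (by simp; rfl))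
    have e2 : ((d * n : ℝ) : EReal) ≤ (g (Ω.pow n) (p.pow n) (tangentPow p δ n) : EReal) := by
      have : ((d * n : ℝ≥0) : ℝ≥0∞) ≤ g (Ω.pow n) (p.pow n) (tangentPow p δ n) := by
        push_cast
        exact (ENNReal.le_div_iff_mul_le (.inl hn0) (.inl hnt)).1 h4.le
      exact le_trans (le_of_eq (by simp; rfl)) (EReal.coe_ennreal_le_coe_ennreal_iff.2 this)
    have e3 : (n : EReal) = ((n : ℝ) : EReal) := rfl
    rw [e3, EReal.div_le_iff_le_mul (by exact_mod_cast hn1) (EReal.coe_ne_top _)]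
    refine (EReal.sub_le_sub e1 e2).trans (le_of_eq ?_)
    rw [← EReal.coe_sub, ← EReal.coe_mul]
    congr 1
    ring
  have h2 : (0 : EReal) ≤ ((c - d : ℝ) : EReal) := h0.trans h1
  have h3 : (0 : ℝ) ≤ c - d := by exact_mod_cast h2
  have h4 : (c : ℝ) < d := by exact_mod_cast hcd'
  linarith

theorem norm_sub_eq_of_lineEquiv {f f' : L1 (.euclid 1)} {F F' : ℝ → ℝ}
    (h : f =ᵐ[(DataSpace.euclid 1).refMeasure] fun x => F (lineEquiv x))
    (h' : f' =ᵐ[(DataSpace.euclid 1).refMeasure] fun x => F' (lineEquiv x)) :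
    ‖f - f'‖ = ∫ y, |F y - F' y| := by
  rw [norm_L1_eq_integral_abs,
    ← measurePreserving_lineEquiv.integral_comp' (fun y => |F y - F' y|)]
  refine integral_congr_ae ?_
  filter_upwards [h, h', Lp.coeFn_sub f f'] with x h1 h2 h3
  rw [h3, Pi.sub_apply, h1, h2]

/-! ### The lower bound -/

section Lower
variable {Ω : DataSpace} {p : Density Ω} {δ : Tangent Ω}

theorem smooth_stdSum_scoreLaw {a : ℝ} {w : ℝ → ℝ} (hw : Measurable w) (n : ℕ) (y : ℝ) :
    smooth a w (stdSum (scoreLaw p δ) n) y = ∫ z, mehler a (sumScore p δ n z) y *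
      (w (sumScore p δ n z) * (p.pow n).val z) ∂(Ω.pow n).refMeasure := by
  have hm : Measurable fun s => w s * mehler a s y :=
    hw.mul (measurable_mehler_comp a measurable_id measurable_const)
  rw [smooth, ← map_sumScore, integral_map (measurable_sumScore p δ n).aemeasurable
    hm.aestronglyMeasurable, (p.pow n).integral_toMeasure]
  refine integral_congr_ae (.of_forall fun z => ?_)
  simp only
  ring

/-- The channel that reports the normalized score sum, contracted by `a` and with Gaussian noise
of variance `1 - a²` added. -/
theorem exists_channel_sumScore {a : ℝ} (ha : a ^ 2 < 1) (h : HasScore p δ) {n : ℕ} (hn : n ≠ 0) :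
    ∃ Ψ : Channel (Ω.pow n) (.euclid 1),
      (Ψ.density (p.pow n)).val =ᵐ[(DataSpace.euclid 1).refMeasure]
        (fun x => smooth a 1 (stdSum (scoreLaw p δ) n) (lineEquiv x)) ∧
      (Ψ.tangent (tangentPow p δ n)).1 =ᵐ[(DataSpace.euclid 1).refMeasure]
        (fun x => √(n : ℝ) * smooth a id (stdSum (scoreLaw p δ) n) (lineEquiv x)) := by
  have hm : Measurable fun x : (Ω.pow n).Carrier × (DataSpace.euclid 1).Carrier =>
      mehler a (sumScore p δ n x.1) (lineEquiv x.2) :=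
    measurable_mehler_comp a ((measurable_sumScore p δ n).comp measurable_fst)
      (lineEquiv.measurable.comp measurable_snd)
  obtain ⟨Ψ, hΨ⟩ := exists_channel_kernel (Ω := Ω.pow n) (Ω' := .euclid 1)
    (k := fun z x => (mehler a (sumScore p δ n z) (lineEquiv x)).toNNReal) hm.real_toNNReal
    fun z => by
      have h1 : Measurable fun y => ENNReal.ofReal (mehler a (sumScore p δ n z) y) :=
        (measurable_gaussianPDFReal _ _).ennreal_ofReal
      refine (measurePreserving_lineEquiv.lintegral_comp h1).trans ?_
      exact lintegral_gaussianPDFReal_eq_one _ (toNNReal_one_sub_sq_ne_zero ha)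
  refine ⟨Ψ, (hΨ _ _ ae_eq_rfl).trans (.of_forall fun x => ?_),
    (hΨ _ _ (tangentPow_ae_eq_sumScore n h hn)).trans (.of_forall fun x => ?_)⟩
  · simp only [Real.coe_toNNReal _ (mehler_nonneg _ _ _)]
    rw [smooth_stdSum_scoreLaw measurable_one]
    simp
  · simp only [Real.coe_toNNReal _ (mehler_nonneg _ _ _)]
    rw [smooth_stdSum_scoreLaw measurable_id, ← integral_const_mul]
    refine integral_congr_ae (.of_forall fun z => ?_)
    simp only [id]
    ring

/-- Sufficiency of the sum in the Gaussian shift: its score is the coordinate itself and normalized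
Gaussian sums are exactly standard Gaussian. -/
theorem exists_channel_lift_gauss {n : ℕ} (hn : n ≠ 0) :
    ∃ Φ : Channel (.euclid 1) ((DataSpace.euclid 1).pow n),
      Φ.density gaussDensity = gaussDensity.pow n ∧
      √(n : ℝ) • Φ.tangent gaussTangent = tangentPow gaussDensity gaussTangent n := by
  refine exists_channel_lift hasScore_gauss hn (measurable_gaussianPDFReal 0 1)
    (fun y => gaussianPDFReal_pos 0 1 y one_ne_zero) ?_ gaussDensity_ae_eq gaussTangent_ae_eq
  rw [scoreLaw_gauss, stdSum_gaussianReal hn, gaussianReal_of_var_ne_zero 0 one_ne_zero]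
  rfl

theorem Channel.norm_density_sub_le {Ω' : DataSpace} (Φ : Channel Ω Ω') (p q : Density Ω) :
    ‖(Φ.density p).val - (Φ.density q).val‖ ≤ ‖p.val - q.val‖ := by
  have := Φ.norm_map_le (p.val - q.val)
  rwa [map_sub] at this

theorem Channel.tangent_smul {Ω' : DataSpace} (Φ : Channel Ω Ω') (c : ℝ) (δ : Tangent Ω) :
    Φ.tangent (c • δ) = c • Φ.tangent δ := Subtype.ext (map_smul Φ.toLinearMap c δ.1)

theorem Channel.norm_tangent_sub_le {Ω' : DataSpace} (Φ : Channel Ω Ω') (δ δ' : Tangent Ω) :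
    ‖Φ.tangent δ - Φ.tangent δ'‖ ≤ ‖δ - δ'‖ := by
  have := Φ.norm_map_le (δ.1 - δ'.1)
  rwa [map_sub] at this

theorem tendsto_inv_sqrt_mul_of_le {v w : ℕ → ℝ} (hw : Tendsto w atTop (𝓝 0))
    (h0 : ∀ n, 0 ≤ v n) (h : ∀ n : ℕ, n ≠ 0 → v n ≤ √(n : ℝ) * w n) :
    Tendsto (fun n : ℕ => 1 / √(n : ℝ) * v n) atTop (𝓝 0) := by
  refine squeeze_zero' (.of_forall fun n => mul_nonneg (by positivity) (h0 n)) ?_ hw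
  filter_upwards [eventually_ne_atTop 0] with n hn
  have : 0 < √(n : ℝ) := by positivity
  calc 1 / √(n : ℝ) * v n ≤ 1 / √(n : ℝ) * (√(n : ℝ) * w n) := by gcongr; exact h n hn
    _ = w n := by field_simp

theorem tendsto_zero_of_le_of_ne_zero {v w : ℕ → ℝ} (hw : Tendsto w atTop (𝓝 0))
    (h0 : ∀ n, 0 ≤ v n) (h : ∀ n : ℕ, n ≠ 0 → v n ≤ w n) : Tendsto v atTop (𝓝 0) :=
  squeeze_zero' (.of_forall h0) ((eventually_ne_atTop 0).mono h) hw

/-- Here (C0) is applied at the Gaussian shift scaled by a, where g is finite by (N0). The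
approximating pair is the image of (p^{⊗n}, δ^{(n)}) under compression to the line followed by the
lift; channels being contractions, the L₁ errors can be measured on the line. -/
theorem SatisfiesAxioms.sq_le {g : Metric} (hg : SatisfiesAxioms g) (h : fisher Ω p δ = 1) {a : ℝ}
    (ha : a ^ 2 < 1) (ha0 : 0 < a) : ENNReal.ofReal (a ^ 2) ≤ g Ω p δ := by
  have hs := hasScore_of_fisher_ne_top (h ▸ ENNReal.one_ne_top)
  have hst := isStandardized_scoreLaw h
  have hG : g _ gaussDensity (a • gaussTangent) = ENNReal.ofReal (a ^ 2) := by
    rw [hg.normSq.smul, show g _ gaussDensity gaussTangent = 1 from hg.n0, mul_one]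
  have key (n : ℕ) : ∃ (q : Density ((DataSpace.euclid 1).pow n))
      (δ' : Tangent ((DataSpace.euclid 1).pow n)), n ≠ 0 →
      g _ q δ' ≤ g _ (p.pow n) (tangentPow p δ n) ∧
      ‖q.val - (gaussDensity.pow n).val‖ ≤
        ∫ y, |smooth a 1 (stdSum (scoreLaw p δ) n) y - gaussianPDFReal 0 1 y| ∧
      ‖δ' - tangentPow gaussDensity (a • gaussTangent) n‖ ≤ √(n : ℝ) *
        ∫ y, |smooth a id (stdSum (scoreLaw p δ) n) y - a * (y * gaussianPDFReal 0 1 y)| := by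
    by_cases hn : n = 0
    -- A dummy value, since sequences must be defined for every n.
    · exact ⟨gaussDensity.pow n, 0, fun h => absurd hn h⟩
    obtain ⟨Ψ, hΨp, hΨδ⟩ := exists_channel_sumScore ha hs hn
    obtain ⟨Φ, hΦp, hΦδ⟩ := exists_channel_lift_gauss hn
    refine ⟨Φ.density (Ψ.density (p.pow n)), Φ.tangent (Ψ.tangent (tangentPow p δ n)),
      fun _ => ⟨(hg.m0 _ _ Φ _ _).trans (hg.m0 _ _ Ψ _ _), ?_, ?_⟩⟩
    · rw [← hΦp, ← norm_sub_eq_of_lineEquiv hΨp gaussDensity_ae_eq]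
      exact Φ.norm_density_sub_le _ _
    · rw [tangentPow_smul, ← hΦδ, ← Φ.tangent_smul, ← Φ.tangent_smul]
      refine (Φ.norm_tangent_sub_le _ _).trans (le_of_eq ?_)
      have e : (a • √(n : ℝ) • gaussTangent).1 =ᵐ[(DataSpace.euclid 1).refMeasure]
          fun x => √(n : ℝ) * (a * (lineEquiv x * gaussianPDFReal 0 1 (lineEquiv x))) := by
        rw [smul_smul]
        filter_upwards [Lp.coeFn_smul (a * √(n : ℝ)) gaussTangent.1, gaussTangent_ae_eq]
          with x h1 h2
        rw [Submodule.coe_smul, h1, Pi.smul_apply, h2, smul_eq_mul]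
        ring
      refine (norm_sub_eq_of_lineEquiv (F := fun y =>
        √(n : ℝ) * smooth a id (stdSum (scoreLaw p δ) n) y) (F' := fun y =>
        √(n : ℝ) * (a * (y * gaussianPDFReal 0 1 y))) hΨδ e).trans ?_
      simp_rw [← mul_sub, abs_mul, abs_of_nonneg (Real.sqrt_nonneg (n : ℝ))]
      rw [integral_const_mul]
  choose q δ' hqδ using key
  rw [← hG]
  refine hg.le_of_tendsto (hG ▸ ENNReal.ofReal_ne_top) (q := q) (δ' := δ')
    (tendsto_zero_of_le_of_ne_zero (tendsto_smooth_one hst ha ha0) (fun n => norm_nonneg _)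
      fun n hn => (hqδ n hn).2.1)
    (tendsto_inv_sqrt_mul_of_le (tendsto_smooth_id hst ha ha0) (fun n => norm_nonneg _)
      -- The comparison sequence is g along the powers of (p, δ), with limit g_p(δ).
      fun n hn => (hqδ n hn).2.2) (hg.a0 Ω p δ) ?_
  filter_upwards [eventually_ne_atTop 0] with n hn using (hqδ n hn).1

theorem tendsto_one_sub_inv : Tendsto (fun k : ℕ => 1 - 1 / ((k : ℝ) + 2)) atTop (𝓝 1) := by
  have h1 : Tendsto (fun k : ℕ => 1 / ((k : ℝ) + 2)) atTop (𝓝 0) :=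
    tendsto_const_nhds.div_atTop (tendsto_natCast_atTop_atTop.atTop_add tendsto_const_nhds)
  simpa using h1.const_sub 1

theorem one_sub_inv_mem (k : ℕ) :
    0 < 1 - 1 / ((k : ℝ) + 2) ∧ (1 - 1 / ((k : ℝ) + 2)) ^ 2 < 1 := by
  have h1 : 0 < 1 / ((k : ℝ) + 2) := by positivity
  have h2 : 1 / ((k : ℝ) + 2) < 1 := by rw [div_lt_one (by positivity)]; linarith
  exact ⟨by linarith, by nlinarith⟩

theorem SatisfiesAxioms.one_le {g : Metric} (hg : SatisfiesAxioms g) (h : fisher Ω p δ = 1) :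
    1 ≤ g Ω p δ := by
  have h1 : Tendsto (fun k : ℕ => ENNReal.ofReal ((1 - 1 / ((k : ℝ) + 2)) ^ 2)) atTop (𝓝 1) := by
    have := ENNReal.tendsto_ofReal (tendsto_one_sub_inv.pow 2)
    simpa using this
  exact le_of_tendsto' h1 fun k => hg.sq_le h (one_sub_inv_mem k).2 (one_sub_inv_mem k).1

end Lower

/-! ### Adding a Gaussian coordinate -/

section Upper

theorem exists_density {Ω : DataSpace} {r : Ω.Carrier → ℝ} (hr : Integrable r Ω.refMeasure)
    (h0 : ∀ x, 0 ≤ r x) (h1 : ∫ x, r x ∂Ω.refMeasure = 1) :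
    ∃ q : Density Ω, q.val =ᵐ[Ω.refMeasure] r := by
  have e := hr.coeFn_toL1
  refine ⟨⟨hr.toL1 r, ?_, (integral_congr_ae e).trans h1⟩, e⟩
  rw [← Lp.coeFn_nonneg]
  filter_upwards [e] with x hx
  rw [hx]; exact h0 x

theorem exists_tangent {Ω : DataSpace} {r : Ω.Carrier → ℝ} (hr : Integrable r Ω.refMeasure)
    (h1 : ∫ x, r x ∂Ω.refMeasure = 0) : ∃ δ : Tangent Ω, δ.1 =ᵐ[Ω.refMeasure] r :=
  ⟨⟨hr.toL1 r, (integral_congr_ae hr.coeFn_toL1).trans h1⟩, hr.coeFn_toL1⟩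

variable {d : ℕ}

/-- `ℝ^(d+1)` as `ℝ × ℝ^d`. -/
def consEquiv (d : ℕ) : (DataSpace.euclid (d + 1)).Carrier ≃ᵐ ℝ × (DataSpace.euclid d).Carrier :=
  MeasurableEquiv.piFinSuccAbove (fun _ : Fin (d + 1) => ℝ) 0

theorem measurePreserving_consEquiv (d : ℕ) :
    MeasurePreserving (consEquiv d) (DataSpace.euclid (d + 1)).refMeasure
      ((volume : Measure ℝ).prod (DataSpace.euclid d).refMeasure) :=
  volume_preserving_piFinSuccAbove (fun _ : Fin (d + 1) => ℝ) 0

theorem measurable_consEquiv_fst : Measurable fun x => (consEquiv d x).1 :=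
  measurable_fst.comp (consEquiv d).measurable

theorem measurable_consEquiv_snd : Measurable fun x => (consEquiv d x).2 :=
  measurable_snd.comp (consEquiv d).measurable

theorem lintegral_consEquiv {F : ℝ × (DataSpace.euclid d).Carrier → ℝ≥0∞} (hF : Measurable F) :
    ∫⁻ x, F (consEquiv d x) ∂(DataSpace.euclid (d + 1)).refMeasure =
      ∫⁻ z, ∫⁻ t, F (t, z) ∂volume ∂(DataSpace.euclid d).refMeasure := by
  rw [(measurePreserving_consEquiv d).lintegral_comp hF, lintegral_prod_symm _ hF.aemeasurable]

theorem exists_channel_tensor_gauss (d : ℕ) :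
    ∃ Ψ : Channel (.euclid d) (.euclid (d + 1)), ∀ (f : L1 (.euclid d)) (F),
      f =ᵐ[(DataSpace.euclid d).refMeasure] F →
      Ψ.toLinearMap f =ᵐ[(DataSpace.euclid (d + 1)).refMeasure]
        fun x => gaussianPDFReal 0 1 (consEquiv d x).1 * F (consEquiv d x).2 := by
  have hφ : Measurable fun t : ℝ => (gaussianPDFReal 0 1 t).toNNReal :=
    (measurable_gaussianPDFReal 0 1).real_toNNReal
  obtain ⟨Ψ, hΨ⟩ := exists_channel_pullback (Ω := .euclid d) (Ω' := .euclid (d + 1))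
    measurable_consEquiv_snd (hφ.comp measurable_consEquiv_fst) fun S hS => by
      have hm : Measurable fun y : ℝ × (DataSpace.euclid d).Carrier =>
          ((gaussianPDFReal 0 1 y.1).toNNReal : ℝ≥0∞) * S.indicator 1 y.2 :=
        ((hφ.comp measurable_fst).coe_nnreal_ennreal).mul
          ((measurable_one.indicator hS).comp measurable_snd)
      refine (lintegral_consEquiv hm).trans ?_
      simp_rw [lintegral_mul_const _ hφ.coe_nnreal_ennreal]
      have e : ∫⁻ t, ((gaussianPDFReal 0 1 t).toNNReal : ℝ≥0∞) = 1 :=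
        lintegral_gaussianPDFReal_eq_one 0 one_ne_zero
      simp_rw [e, one_mul]
      exact lintegral_indicator_one hS
  refine ⟨Ψ, fun f F hf => (hΨ f F hf).trans (.of_forall fun x => ?_)⟩
  simp only [Function.comp_apply, Real.coe_toNNReal _ (gaussianPDFReal_nonneg 0 1 _)]

theorem exists_channel_tensor_density (p : Density (.euclid d)) :
    ∃ Ψ : Channel (.euclid 1) (.euclid (d + 1)), ∀ (f : L1 (.euclid 1)) (F),
      f =ᵐ[(DataSpace.euclid 1).refMeasure] F →
      Ψ.toLinearMap f =ᵐ[(DataSpace.euclid (d + 1)).refMeasure]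
        fun x => p.val (consEquiv d x).2 * F (lineEquiv.symm (consEquiv d x).1) := by
  have hp : Measurable fun z => (p.val z).toNNReal := (measurable_coeFn_L1 p.val).real_toNNReal
  obtain ⟨Ψ, hΨ⟩ := exists_channel_pullback (Ω := .euclid 1) (Ω' := .euclid (d + 1))
    (lineEquiv.symm.measurable.comp measurable_consEquiv_fst)
    (hp.comp measurable_consEquiv_snd) fun S hS => by
      have hS' : MeasurableSet (lineEquiv.symm ⁻¹' S) := lineEquiv.symm.measurable hS
      have hm : Measurable fun y : ℝ × (DataSpace.euclid d).Carrier =>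
          ((p.val y.2).toNNReal : ℝ≥0∞) * (lineEquiv.symm ⁻¹' S).indicator 1 y.1 :=
        ((hp.comp measurable_snd).coe_nnreal_ennreal).mul
          ((measurable_one.indicator hS').comp measurable_fst)
      refine (lintegral_consEquiv hm).trans ?_
      have e1 : ∫⁻ z, ((p.val z).toNNReal : ℝ≥0∞) ∂(DataSpace.euclid d).refMeasure = 1 := by
        have := p.toMeasure_apply MeasurableSet.univ
        rw [Density.toMeasure, withDensity_apply _ MeasurableSet.univ, Measure.restrict_univ,
          p.integral_eq_one, ENNReal.ofReal_one] at this
        exact this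
      have e2 (z : (DataSpace.euclid d).Carrier) : ∫⁻ t, ((p.val z).toNNReal : ℝ≥0∞) *
          (lineEquiv.symm ⁻¹' S).indicator 1 t =
          ((p.val z).toNNReal : ℝ≥0∞) * (DataSpace.euclid 1).refMeasure S := by
        rw [lintegral_const_mul _ (measurable_one.indicator hS'), lintegral_indicator_one hS',
          measurePreserving_lineEquiv.symm.measure_preimage hS.nullMeasurableSet]
      simp_rw [e2]
      rw [lintegral_mul_const _ hp.coe_nnreal_ennreal, e1, one_mul]
  refine ⟨Ψ, fun f F hf => (hΨ f F hf).trans ?_⟩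
  have h0 : ∀ᵐ x ∂(DataSpace.euclid (d + 1)).refMeasure, 0 ≤ p.val (consEquiv d x).2 :=
    (Measure.quasiMeasurePreserving_snd.comp
      (measurePreserving_consEquiv d).quasiMeasurePreserving).ae p.nonneg_ae
  filter_upwards [h0] with x hx
  simp only [Function.comp_apply, Real.coe_toNNReal _ hx]

theorem exists_channel_marginal (d : ℕ) :
    ∃ Ψ : Channel (.euclid (d + 1)) (.euclid d), ∀ (f : L1 (.euclid (d + 1)))
      (F : ℝ → (DataSpace.euclid d).Carrier → ℝ),
      f =ᵐ[(DataSpace.euclid (d + 1)).refMeasure]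
        (fun x => F (consEquiv d x).1 (consEquiv d x).2) →
      Ψ.toLinearMap f =ᵐ[(DataSpace.euclid d).refMeasure] fun z => ∫ t, F t z := by
  have h1 : MeasurePreserving (fun y : (DataSpace.euclid d).Carrier × ℝ =>
      (consEquiv d).symm (y.2, y.1)) ((DataSpace.euclid d).refMeasure.prod volume)
      (DataSpace.euclid (d + 1)).refMeasure :=
    (measurePreserving_consEquiv d).symm.comp Measure.measurePreserving_swap
  obtain ⟨Ψ, hΨ⟩ := exists_channel (Ω := .euclid (d + 1)) (Ω' := .euclid d) (K := fun _ => 1)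
    (ν := (volume : Measure ℝ)) h1.measurable measurable_const (by simpa using h1.map_eq)
  refine ⟨Ψ, fun f F hf => (hΨ f _ hf).trans (.of_forall fun z => ?_)⟩
  simp

theorem map_consEquiv_toMeasure {p : Density (.euclid d)} {p' : Density (.euclid (d + 1))}
    (h : p'.val =ᵐ[(DataSpace.euclid (d + 1)).refMeasure]
      fun x => gaussianPDFReal 0 1 (consEquiv d x).1 * p.val (consEquiv d x).2) :
    p'.toMeasure.map (consEquiv d) = (gaussianReal 0 1).prod p.toMeasure := by
  rw [p'.toMeasure_eq h, gaussianReal_of_var_ne_zero 0 one_ne_zero, Density.toMeasure,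
    prod_withDensity (measurable_gaussianPDF 0 1) (measurable_coeFn_L1 p.val).ennreal_ofReal]
  have hm : Measurable fun y : ℝ × (DataSpace.euclid d).Carrier =>
      gaussianPDF 0 1 y.1 * ENNReal.ofReal (p.val y.2) :=
    ((measurable_gaussianPDF 0 1).comp measurable_fst).mul
      ((measurable_coeFn_L1 p.val).ennreal_ofReal.comp measurable_snd)
  ext S hS
  rw [Measure.map_apply (consEquiv d).measurable hS,
    withDensity_apply _ ((consEquiv d).measurable hS), withDensity_apply _ hS,
    ← (measurePreserving_consEquiv d).setLIntegral_comp_preimage hS hm]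
  refine lintegral_congr fun x => ?_
  rw [ENNReal.ofReal_mul (gaussianPDFReal_nonneg 0 1 _)]
  rfl

/-! ### The upper bound for scores with a Gaussian component -/

theorem measurable_smooth_one (a : ℝ) (ν : Measure ℝ) [SFinite ν] : Measurable (smooth a 1 ν) := by
  have h : Measurable fun x : ℝ × ℝ => (1 : ℝ → ℝ) x.2 * mehler a x.2 x.1 :=
    measurable_const.mul (measurable_mehler_comp a measurable_snd measurable_fst)
  exact (h.stronglyMeasurable.integral_prod_right (ν := ν)).measurable

theorem smooth_one_pos {a : ℝ} (ha : a ^ 2 < 1) (ν : Measure ℝ) [IsProbabilityMeasure ν] (y : ℝ) :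
    0 < smooth a 1 ν y := by
  have hi := (integrable_mehler_left ha (ν := ν) y).const_mul 1
  refine (integral_pos_iff_support_of_nonneg (fun s => ?_) hi).2 ?_
  · simpa using mehler_nonneg a s y
  · have : Function.support (fun s => 1 * mehler a s y) = Set.univ := by
      ext s; simpa using (mehler_pos ha s y).ne'
    rw [this]; simp

/-- The Gaussian component gives every normalized score sum a positive density close to φ, so
(p^{⊗n}, δ^{(n)}) can be simulated approximately from one Gaussian observation, at cost n. -/
theorem SatisfiesAxioms.le_one_of_scoreLaw {g : Metric} (hg : SatisfiesAxioms g) {Ω : DataSpace}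
    {p : Density Ω} {δ : Tangent Ω} (hs : HasScore p δ) (hfin : g Ω p δ ≠ ∞) {a : ℝ}
    (ha : a ^ 2 < 1) (ha0 : 0 < a) {lam : Measure ℝ} (hlam : IsStandardized lam)
    (hlaw : scoreLaw p δ = (lam.map (a * ·)) ∗ gaussianReal 0 (Real.toNNReal (1 - a ^ 2))) :
    g Ω p δ ≤ 1 := by
  have := hlam.isProb
  have key (n : ℕ) : ∃ (q : Density (Ω.pow n)) (δ' : Tangent (Ω.pow n)), n ≠ 0 →
      g _ q δ' ≤ n ∧
      ‖q.val - (p.pow n).val‖ ≤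
        ∫ y, |smooth a 1 (stdSum lam n) y - gaussianPDFReal 0 1 y| ∧
      ‖δ' - tangentPow p δ n‖ ≤ √(n : ℝ) *
        ∫ y, |y * smooth a 1 (stdSum lam n) y - y * gaussianPDFReal 0 1 y| := by
    by_cases hn : n = 0
    · exact ⟨p.pow n, 0, fun h => absurd hn h⟩
    have hst := hlam.stdSum hn
    have hpos := smooth_one_pos ha (stdSum lam n)
    have i1 : Integrable (smooth a 1 (stdSum lam n)) := integrable_smooth ha (integrable_const 1)
    have e1 : ∫ y, smooth a 1 (stdSum lam n) y = 1 := by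
      rw [integral_smooth ha (w := 1) (integrable_const 1)]; simp
    obtain ⟨r, hr⟩ := exists_density (Ω := .euclid 1)
      (r := fun x => smooth a 1 (stdSum lam n) (lineEquiv x))
      (measurePreserving_lineEquiv.integrable_comp_of_integrable i1) (fun x => (hpos _).le)
      ((measurePreserving_lineEquiv.integral_comp' _).trans e1)
    obtain ⟨ρ, hρ⟩ := exists_tangent (Ω := .euclid 1)
      (r := fun x => lineEquiv x * smooth a 1 (stdSum lam n) (lineEquiv x))
      (measurePreserving_lineEquiv.integrable_comp_of_integrable
        (integrable_id_mul_smooth_one ha hst))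
      ((measurePreserving_lineEquiv.integral_comp'
        (fun y => y * smooth a 1 (stdSum lam n) y)).trans (integral_id_mul_smooth_one ha hst))
    obtain ⟨Φ, hΦp, hΦδ⟩ := exists_channel_lift hs hn (measurable_smooth_one a (stdSum lam n))
      hpos (by rw [hlaw, stdSum_conv_gaussianReal ha lam hn]) hr hρ
    -- Φ is exact on (r, y r); it is applied to the Gaussian pair instead, whose cost √n² = n is
    -- known from (N0).
    refine ⟨Φ.density gaussDensity, Φ.tangent (√(n : ℝ) • gaussTangent), fun _ => ⟨?_, ?_, ?_⟩⟩
    · refine (hg.m0 _ _ Φ _ _).trans ?_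
      rw [hg.normSq.smul, show g _ gaussDensity gaussTangent = 1 from hg.n0, mul_one,
        Real.sq_sqrt (Nat.cast_nonneg n), ENNReal.ofReal_natCast]
    · rw [← hΦp, ← norm_sub_eq_of_lineEquiv hr gaussDensity_ae_eq, norm_sub_rev r.val]
      exact Φ.norm_density_sub_le _ _
    · rw [← hΦδ, Φ.tangent_smul, ← smul_sub, norm_smul, Real.norm_of_nonneg (Real.sqrt_nonneg _)]
      refine mul_le_mul_of_nonneg_left ((Φ.norm_tangent_sub_le _ _).trans (le_of_eq ?_))
        (Real.sqrt_nonneg _)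
      rw [norm_sub_rev]
      exact norm_sub_eq_of_lineEquiv (F := fun y => y * smooth a 1 (stdSum lam n) y)
        (F' := fun y => y * gaussianPDFReal 0 1 y) hρ gaussTangent_ae_eq
  choose q δ' hqδ using key
  have ht := (tendsto_add_atTop_iff_nat
    (f := fun n => ∫ y, |y * smooth a 1 (stdSum lam n) y - y * gaussianPDFReal 0 1 y|) 1).1
    (tendsto_id_mul_smooth_one hlam ha ha0)
  refine hg.le_of_tendsto hfin (q := q) (δ' := δ')
    (tendsto_zero_of_le_of_ne_zero (tendsto_smooth_one hlam ha ha0) (fun n => norm_nonneg _)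
      fun n hn => (hqδ n hn).2.1)
    (tendsto_inv_sqrt_mul_of_le ht (fun n => norm_nonneg _) fun n hn => (hqδ n hn).2.2)
    (u := fun n => n) ?_ ?_
  · refine tendsto_const_nhds.congr' ?_
    filter_upwards [eventually_ne_atTop 0] with n hn
    rw [ENNReal.div_self (by exact_mod_cast hn) (ENNReal.natCast_ne_top n)]
  · filter_upwards [eventually_ne_atTop 0] with n hn using (hqδ n hn).1

/-! ### The upper bound for general scores on ℝ^d -/

theorem IsNormSq.add_ne_top {g : Metric} (hg : IsNormSq g) {Ω : DataSpace} {p : Density Ω}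
    {δ δ' : Tangent Ω} (h : g Ω p δ ≠ ∞) (h' : g Ω p δ' ≠ ∞) : g Ω p (δ + δ') ≠ ∞ := by
  obtain ⟨N, hN, hgN⟩ := hg Ω p
  rw [hgN] at h h' ⊢
  rw [Ne, ENNReal.pow_eq_top_iff] at h h' ⊢
  simp only [ne_eq, OfNat.ofNat_ne_zero, not_false_eq_true, and_true] at h h' ⊢
  exact ne_top_of_le_ne_top (ENNReal.add_ne_top.2 ⟨h, h'⟩) (hN.add_le _ _)

theorem IsNormSq.smul_ne_top {g : Metric} (hg : IsNormSq g) {Ω : DataSpace} {p : Density Ω}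
    {δ : Tangent Ω} (h : g Ω p δ ≠ ∞) (c : ℝ) : g Ω p (c • δ) ≠ ∞ := by
  rw [hg.smul]
  exact ENNReal.mul_ne_top ENNReal.ofReal_ne_top h

/-- Pass to φ ⊗ p on ℝ^(d+1) in the direction a(φ ⊗ δ) + b(yφ ⊗ p): its score aL + bZ has a Gaussian
component, so the previous bound applies. Taking the marginal gives back aδ. -/
theorem SatisfiesAxioms.sq_mul_le_one {g : Metric} (hg : SatisfiesAxioms g)
    {p : Density (.euclid d)} {δ : Tangent (.euclid d)} (h : fisher _ p δ = 1)
    (hfin : g _ p δ ≠ ∞) {a : ℝ} (ha : a ^ 2 < 1) (ha0 : 0 < a) :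
    ENNReal.ofReal (a ^ 2) * g _ p δ ≤ 1 := by
  have hs := hasScore_of_fisher_ne_top (h ▸ ENNReal.one_ne_top)
  have hst := isStandardized_scoreLaw h
  set b := √(1 - a ^ 2) with hb
  have hb2 : b ^ 2 = 1 - a ^ 2 := Real.sq_sqrt (by linarith)
  obtain ⟨Ψ₁, hΨ₁⟩ := exists_channel_tensor_gauss d
  obtain ⟨Ψ₂, hΨ₂⟩ := exists_channel_tensor_density p
  obtain ⟨Ψ₃, hΨ₃⟩ := exists_channel_marginal d
  have hp : (Ψ₁.density p).val =ᵐ[(DataSpace.euclid (d + 1)).refMeasure]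
      fun x => gaussianPDFReal 0 1 (consEquiv d x).1 * p.val (consEquiv d x).2 :=
    hΨ₁ p.val p.val ae_eq_rfl
  -- Both embeddings land at the same density φ ⊗ p, so the two directions can be added there.
  have hp2 : Ψ₂.density gaussDensity = Ψ₁.density p := by
    refine Density.ext (Lp.ext ?_)
    filter_upwards [hp, hΨ₂ _ _ gaussDensity_ae_eq] with x h1 h2
    rw [h1]
    refine h2.trans ?_
    rw [lineEquiv.apply_symm_apply, mul_comm]
  have hδ₁ : (Ψ₁.tangent δ).1 =ᵐ[(DataSpace.euclid (d + 1)).refMeasure] fun x =>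
      gaussianPDFReal 0 1 (consEquiv d x).1 *
        (score p δ (consEquiv d x).2 * p.val (consEquiv d x).2) := hΨ₁ _ _ hs.ae_eq
  have hδ₂ : (Ψ₂.tangent gaussTangent).1 =ᵐ[(DataSpace.euclid (d + 1)).refMeasure] fun x =>
      p.val (consEquiv d x).2 * ((consEquiv d x).1 * gaussianPDFReal 0 1 (consEquiv d x).1) := by
    refine (hΨ₂ _ _ gaussTangent_ae_eq).trans (.of_forall fun x => ?_)
    simp only [lineEquiv.apply_symm_apply]
  set δ' := a • Ψ₁.tangent δ + b • Ψ₂.tangent gaussTangent with hδ'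
  have hδ'_ae : δ'.1 =ᵐ[(DataSpace.euclid (d + 1)).refMeasure] fun x =>
      (a * score p δ (consEquiv d x).2 + b * (consEquiv d x).1) *
        (gaussianPDFReal 0 1 (consEquiv d x).1 * p.val (consEquiv d x).2) := by
    filter_upwards [hδ₁, hδ₂, Lp.coeFn_add (a • (Ψ₁.tangent δ).1) (b • (Ψ₂.tangent gaussTangent).1),
      Lp.coeFn_smul a (Ψ₁.tangent δ).1, Lp.coeFn_smul b (Ψ₂.tangent gaussTangent).1]
      with x h1 h2 h3 h4 h5
    refine h3.trans ?_
    rw [Pi.add_apply, h4, h5, Pi.smul_apply, Pi.smul_apply, h1, h2, smul_eq_mul, smul_eq_mul]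
    ring
  have hδ'_ae2 : δ'.1 =ᵐ[(DataSpace.euclid (d + 1)).refMeasure] fun x =>
      (a * score p δ (consEquiv d x).2 + b * (consEquiv d x).1) * (Ψ₁.density p).val x := by
    filter_upwards [hδ'_ae, hp] with x h1 h2
    rw [h1, h2]
  have hlaw : scoreLaw (Ψ₁.density p) δ' =
      ((scoreLaw p δ).map (a * ·)) ∗ gaussianReal 0 (Real.toNNReal (1 - a ^ 2)) := by
    have hps : Measurable (Prod.map (fun x : ℝ => b * x) ((fun x : ℝ => a * x) ∘ score p δ)) :=
      (measurable_const_mul b).prodMap ((measurable_const_mul a).comp (measurable_score p δ))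
    have hadd : Measurable fun x : ℝ × ℝ => x.1 + x.2 := measurable_fst.add measurable_snd
    have hb3 : gaussianReal 0 (Real.toNNReal (1 - a ^ 2)) = (gaussianReal 0 1).map (b * ·) := by
      rw [gaussianReal_map_const_mul, mul_zero, mul_one]
      congr 1
      ext
      rw [Real.coe_toNNReal _ (by linarith)]
      exact hb2.symm
    rw [scoreLaw_eq hδ'_ae2, Measure.conv_comm, hb3, scoreLaw,
      Measure.map_map (by fun_prop) (measurable_score p δ), Measure.conv,
      Measure.map_prod_map _ _ (measurable_const_mul b)
        ((measurable_const_mul a).comp (measurable_score p δ)),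
      Measure.map_map hadd hps, ← map_consEquiv_toMeasure hp,
      Measure.map_map (hadd.comp hps) (consEquiv d).measurable]
    congr 1
    ext x
    simp [add_comm]
  -- Finiteness, needed for (C0), comes from monotonicity for each summand and the triangle
  -- inequality; no inner product is involved.
  have hfin' : g _ (Ψ₁.density p) δ' ≠ ∞ := by
    refine hg.normSq.add_ne_top (hg.normSq.smul_ne_top ?_ a) (hg.normSq.smul_ne_top ?_ b)
    · exact ne_top_of_le_ne_top hfin (hg.m0 _ _ Ψ₁ p δ)
    · rw [← hp2]
      refine ne_top_of_le_ne_top ?_ (hg.m0 _ _ Ψ₂ gaussDensity gaussTangent)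
      rw [show g _ gaussDensity gaussTangent = 1 from hg.n0]
      exact ENNReal.one_ne_top
  have h1 := hg.le_one_of_scoreLaw (hasScore_of_ae_eq hδ'_ae2) hfin' ha ha0 hst hlaw
  have hp3 : Ψ₃.density (Ψ₁.density p) = p := by
    refine Density.ext (Lp.ext ?_)
    refine (hΨ₃ _ (fun t z => gaussianPDFReal 0 1 t * p.val z) hp).trans (.of_forall fun z => ?_)
    simp only
    rw [integral_mul_const, integral_gaussianPDFReal_eq_one 0 one_ne_zero, one_mul]
  have hδ3 : Ψ₃.tangent δ' = a • δ := by
    refine Subtype.ext (Lp.ext ?_)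
    filter_upwards [hΨ₃ _ (fun t z => (a * score p δ z + b * t) *
      (gaussianPDFReal 0 1 t * p.val z)) hδ'_ae, Lp.coeFn_smul a δ.1, hs.ae_eq] with z h2 h3 h4
    rw [Submodule.coe_smul, h3, Pi.smul_apply, h4, smul_eq_mul]
    refine h2.trans ?_
    have e (t : ℝ) : (a * score p δ z + b * t) * (gaussianPDFReal 0 1 t * p.val z) =
        (a * score p δ z * p.val z) * gaussianPDFReal 0 1 t +
          (b * p.val z) * (t * gaussianPDFReal 0 1 t) := by ring
    -- The shift direction has zero marginal, so only aδ remains.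
    have e2 : ∫ t, t * gaussianPDFReal 0 1 t = 0 := by
      have := integral_gaussianReal_eq_integral_smul (μ := 0) (v := 1) (f := fun t : ℝ => t)
        one_ne_zero
      rw [integral_id_gaussianReal] at this
      simpa [mul_comm] using this.symm
    simp_rw [e]
    rw [integral_add ((integrable_gaussianPDFReal 0 1).const_mul _)
      (integrable_id_mul_gaussianPDFReal.const_mul _), integral_const_mul, integral_const_mul, e2,
      integral_gaussianPDFReal_eq_one 0 one_ne_zero]
    ring
  have h2 := hg.m0 _ _ Ψ₃ (Ψ₁.density p) δ'
  rw [hp3, hδ3, hg.normSq.smul] at h2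
  exact h2.trans h1

theorem SatisfiesAxioms.le_one {g : Metric} (hg : SatisfiesAxioms g) {p : Density (.euclid d)}
    {δ : Tangent (.euclid d)} (h : fisher _ p δ = 1) (hfin : g _ p δ ≠ ∞) : g _ p δ ≤ 1 := by
  have h1 : Tendsto (fun k : ℕ => ENNReal.ofReal ((1 - 1 / ((k : ℝ) + 2)) ^ 2) * g _ p δ) atTop
      (𝓝 (1 * g _ p δ)) := by
    have := ENNReal.tendsto_ofReal (tendsto_one_sub_inv.pow 2)
    rw [one_pow, ENNReal.ofReal_one] at this
    exact ENNReal.Tendsto.mul_const this (.inl one_ne_zero)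
  rw [one_mul] at h1
  exact le_of_tendsto' h1 fun k =>
    hg.sq_mul_le_one h hfin (one_sub_inv_mem k).2 (one_sub_inv_mem k).1

theorem SatisfiesAxioms.eq_fisher_euclid {g : Metric} (hg : SatisfiesAxioms g)
    {p : Density (.euclid d)} {δ : Tangent (.euclid d)} (h : fisher _ p δ ≠ ∞)
    (hfin : g _ p δ ≠ ∞) : g _ p δ = fisher _ p δ := by
  by_cases h0 : δ = 0
  · rw [hg.normSq.eq_zero_iff.2 h0, isNormSq_fisher.eq_zero_iff.2 h0]
  obtain ⟨δ₁, h1, h2⟩ := exists_smul_fisher_eq_one h h0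
  generalize √(fisher _ p δ).toReal = c at h2
  have hc : c ≠ 0 := fun hc => h0 (by rw [h2, hc, zero_smul])
  have hfin1 : g _ p δ₁ ≠ ∞ := by
    have := hg.normSq.smul_ne_top hfin c⁻¹
    rwa [h2, inv_smul_smul₀ hc] at this
  rw [h2, hg.normSq.smul, isNormSq_fisher.smul, h1, le_antisymm (hg.le_one h1 hfin1) (hg.one_le h1)]

end Upper

/-! ### Finite sets -/

section Finite

/-- A channel out of the line that produces a given tangent vector with bounded score, up to a
factor, from the Gaussian shift. -/
theorem exists_channel_of_bounded_score {Ω : DataSpace} {p : Density Ω} {δ : Tangent Ω} {C : ℝ}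
    (hC : ∀ᵐ x ∂Ω.refMeasure, |δ.1 x| ≤ C * p.val x) :
    ∃ (Ψ : Channel (.euclid 1) Ω) (c : ℝ), c ≠ 0 ∧ Ψ.density gaussDensity = p ∧
      Ψ.tangent gaussTangent = c • δ := by
  -- The sign of the observation. The channel sends f to (∫ f) p + K⁻¹ (∫ s f) δ; it is positive
  -- because |∫ s f| ≤ ∫ f for f ≥ 0 and |δ| ≤ K p. Adding 1 to |C| keeps K positive.
  let s : (DataSpace.euclid 1).Carrier → ℝ := fun x => if 0 < lineEquiv x then 1 else -1
  have hs : Measurable s := Measurable.ite (lineEquiv.measurable measurableSet_Ioi)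
    measurable_const measurable_const
  have hs1 (x) : |s x| ≤ 1 := by simp only [s]; split_ifs <;> simp
  have hi (f : L1 (.euclid 1)) := integrable_bdd_mul f hs hs1
  set K := |C| + 1 with hK
  have hK0 : 0 < K := by positivity
  let L : L1 (.euclid 1) →ₗ[ℝ] L1 Ω :=
    { toFun := fun f => (∫ x, f x ∂(DataSpace.euclid 1).refMeasure) • p.val +
        ((∫ x, s x * f x ∂(DataSpace.euclid 1).refMeasure) * K⁻¹) • δ.1
      map_add' := fun f f' => by
        have e1 : ∫ x, (f + f' : L1 (.euclid 1)) x ∂(DataSpace.euclid 1).refMeasure =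
            ∫ x, f x ∂(DataSpace.euclid 1).refMeasure +
              ∫ x, f' x ∂(DataSpace.euclid 1).refMeasure :=
          (integral_congr_ae (Lp.coeFn_add f f')).trans
            (integral_add (L1.integrable_coeFn f) (L1.integrable_coeFn f'))
        have e2 : ∫ x, s x * (f + f' : L1 (.euclid 1)) x ∂(DataSpace.euclid 1).refMeasure =
            ∫ x, s x * f x ∂(DataSpace.euclid 1).refMeasure +
              ∫ x, s x * f' x ∂(DataSpace.euclid 1).refMeasure := by
          rw [← integral_add (hi f) (hi f')]
          refine integral_congr_ae ((Lp.coeFn_add f f').mono fun x hx => ?_)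
          simp only [hx, Pi.add_apply, mul_add]
        rw [e1, e2]
        module
      map_smul' := fun c f => by
        have e1 : ∫ x, (c • f : L1 (.euclid 1)) x ∂(DataSpace.euclid 1).refMeasure =
            c * ∫ x, f x ∂(DataSpace.euclid 1).refMeasure :=
          (integral_congr_ae (Lp.coeFn_smul c f)).trans (integral_const_mul _ _)
        have e2 : ∫ x, s x * (c • f : L1 (.euclid 1)) x ∂(DataSpace.euclid 1).refMeasure =
            c * ∫ x, s x * f x ∂(DataSpace.euclid 1).refMeasure := by
          rw [← integral_const_mul]
          refine integral_congr_ae ((Lp.coeFn_smul c f).mono fun x hx => ?_)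
          simp only [hx, Pi.smul_apply, smul_eq_mul, mul_left_comm]
        rw [e1, e2, RingHom.id_apply]
        module }
  have hL (f : L1 (.euclid 1)) : L f =ᵐ[Ω.refMeasure] fun x =>
      (∫ x, f x ∂(DataSpace.euclid 1).refMeasure) * p.val x +
        ((∫ x, s x * f x ∂(DataSpace.euclid 1).refMeasure) * K⁻¹) * δ.1 x := by
    filter_upwards [Lp.coeFn_add ((∫ x, f x ∂(DataSpace.euclid 1).refMeasure) • p.val)
      (((∫ x, s x * f x ∂(DataSpace.euclid 1).refMeasure) * K⁻¹) • δ.1),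
      Lp.coeFn_smul (∫ x, f x ∂(DataSpace.euclid 1).refMeasure) p.val,
      Lp.coeFn_smul ((∫ x, s x * f x ∂(DataSpace.euclid 1).refMeasure) * K⁻¹) δ.1] with x h1 h2 h3
    refine h1.trans ?_
    rw [Pi.add_apply, h2, h3]
    rfl
  have hint : ∫ x, p.val x ∂Ω.refMeasure = 1 := p.integral_eq_one
  have hint' : ∫ x, δ.1 x ∂Ω.refMeasure = 0 := δ.2
  let Ψ : Channel (.euclid 1) Ω :=
    { toLinearMap := L
      map_nonneg := fun f hf => by
        have h0 := (Lp.coeFn_nonneg f).2 hf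
        have h1 : |∫ x, s x * f x ∂(DataSpace.euclid 1).refMeasure| ≤
            ∫ x, f x ∂(DataSpace.euclid 1).refMeasure := by
          refine abs_integral_le_integral_abs.trans (integral_mono_ae (hi f).abs
            (L1.integrable_coeFn f) ?_)
          filter_upwards [h0] with x hx
          rw [abs_mul, abs_of_nonneg (show 0 ≤ f x from hx)]
          exact mul_le_of_le_one_left hx (hs1 x)
        rw [← Lp.coeFn_nonneg]
        filter_upwards [hL f, hC, p.nonneg_ae] with x h2 h3 h4
        rw [h2, Pi.zero_apply]
        set A := ∫ x, f x ∂(DataSpace.euclid 1).refMeasure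
        set B := ∫ x, s x * f x ∂(DataSpace.euclid 1).refMeasure
        have h5 : |δ.1 x| ≤ K * p.val x :=
          h3.trans (mul_le_mul_of_nonneg_right (by linarith [le_abs_self C]) h4)
        have h6 : |B * K⁻¹ * δ.1 x| ≤ A * p.val x := by
          rw [abs_mul, abs_mul, abs_of_pos (inv_pos.2 hK0)]
          calc |B| * K⁻¹ * |δ.1 x| ≤ A * K⁻¹ * (K * p.val x) := by
                have := (abs_nonneg B).trans h1
                gcongr
            _ = A * p.val x := by field_simp
        linarith [neg_abs_le (B * K⁻¹ * δ.1 x)]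
      integral_map := fun f => by
        rw [integral_congr_ae (hL f), integral_add ((L1.integrable_coeFn p.val).const_mul _)
          ((L1.integrable_coeFn δ.1).const_mul _), integral_const_mul, integral_const_mul, hint,
          hint', mul_one, mul_zero, add_zero] }
  have hγ := isStandardized_gaussianReal
  let σ : ℝ → ℝ := fun y => if 0 < y then 1 else -1
  -- By oddness the Gaussian density goes to p; the shift direction goes to a multiple of δ with
  -- factor E|Z| / K, positive by `eT`.
  have eG : ∫ x, s x * gaussDensity.val x ∂(DataSpace.euclid 1).refMeasure = 0 := by
    have e1 : ∫ x, s x * gaussDensity.val x ∂(DataSpace.euclid 1).refMeasure =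
        ∫ y, σ y * gaussianPDFReal 0 1 y := by
      rw [← measurePreserving_lineEquiv.integral_comp' (fun y => σ y * gaussianPDFReal 0 1 y)]
      refine integral_congr_ae (gaussDensity_ae_eq.mono fun x hx => ?_)
      simp only [hx]
      rfl
    have e2 : ∫ y, σ y * gaussianPDFReal 0 1 y = ∫ y, -(σ y * gaussianPDFReal 0 1 y) := by
      rw [← integral_neg_eq_self (fun y => σ y * gaussianPDFReal 0 1 y)]
      refine integral_congr_ae ?_
      filter_upwards [compl_mem_ae_iff.2 (measure_singleton (0 : ℝ))] with y hy
      have hy' : y ≠ 0 := hy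
      have e3 : gaussianPDFReal 0 1 (-y) = gaussianPDFReal 0 1 y := by
        simp [gaussianPDFReal]
      have e4 : σ (-y) = -σ y := by
        rcases lt_or_gt_of_ne hy' with h | h
        · simp [σ, h, not_lt.2 h.le]
        · simp [σ, h, not_lt.2 h.le]
      rw [e3, e4, neg_mul]
    rw [integral_neg] at e2
    rw [e1]; linarith
  have eT : 0 < ∫ x, s x * gaussTangent.1 x ∂(DataSpace.euclid 1).refMeasure := by
    have e1 : ∫ x, s x * gaussTangent.1 x ∂(DataSpace.euclid 1).refMeasure =
        ∫ y, |y * gaussianPDFReal 0 1 y| := by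
      rw [← measurePreserving_lineEquiv.integral_comp' (fun y => |y * gaussianPDFReal 0 1 y|)]
      refine integral_congr_ae (gaussTangent_ae_eq.mono fun x hx => ?_)
      simp only [hx, abs_mul, abs_of_pos (gaussianPDFReal_pos 0 1 (lineEquiv x) one_ne_zero),
        ← mul_assoc]
      congr 1
      simp only [s]
      split_ifs with h
      · rw [abs_of_pos h, one_mul]
      · rw [abs_of_nonpos (not_lt.1 h), neg_one_mul]
    rw [e1, integral_pos_iff_support_of_nonneg (fun y => abs_nonneg _)
      integrable_id_mul_gaussianPDFReal.abs]
    have : Function.support (fun y : ℝ => |y * gaussianPDFReal 0 1 y|) = {0}ᶜ := by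
      ext y
      simp [(gaussianPDFReal_pos 0 1 y one_ne_zero).ne']
    rw [this, measure_compl (measurableSet_singleton 0) (by simp)]
    simp
  refine ⟨Ψ, (∫ x, s x * gaussTangent.1 x ∂(DataSpace.euclid 1).refMeasure) * K⁻¹,
    (mul_pos eT (inv_pos.2 hK0)).ne', Density.ext ?_, Subtype.ext ?_⟩
  · change (∫ x, gaussDensity.val x ∂(DataSpace.euclid 1).refMeasure) • p.val +
      ((∫ x, s x * gaussDensity.val x ∂(DataSpace.euclid 1).refMeasure) * K⁻¹) • δ.1 = p.val
    rw [eG, gaussDensity.integral_eq_one]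
    simp
  · change (∫ x, gaussTangent.1 x ∂(DataSpace.euclid 1).refMeasure) • p.val +
      ((∫ x, s x * gaussTangent.1 x ∂(DataSpace.euclid 1).refMeasure) * K⁻¹) • δ.1 = _ • δ.1
    rw [show ∫ x, gaussTangent.1 x ∂(DataSpace.euclid 1).refMeasure = 0 from gaussTangent.2]
    simp

theorem SatisfiesAxioms.ne_top_of_bounded_score {g : Metric} (hg : SatisfiesAxioms g)
    {Ω : DataSpace} {p : Density Ω} {δ : Tangent Ω} {C : ℝ}
    (hC : ∀ᵐ x ∂Ω.refMeasure, |δ.1 x| ≤ C * p.val x) : g Ω p δ ≠ ∞ := by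
  obtain ⟨Ψ, c, hc, hp, hδ⟩ := exists_channel_of_bounded_score hC
  have h1 := hg.m0 _ _ Ψ gaussDensity gaussTangent
  rw [hp, hδ, show g _ gaussDensity gaussTangent = 1 from hg.n0] at h1
  have h2 := hg.normSq.smul_ne_top (ne_top_of_le_ne_top ENNReal.one_ne_top h1) c⁻¹
  rwa [inv_smul_smul₀ hc] at h2

theorem HasScore.bounded_of_finite {k : ℕ} {p : Density (.finite k)} {δ : Tangent (.finite k)}
    (h : HasScore p δ) :
    ∃ C, ∀ᵐ x ∂(DataSpace.finite k).refMeasure, |δ.1 x| ≤ C * p.val x := by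
  obtain ⟨C, hC⟩ := (Set.finite_range (fun x : Fin k => |score p δ x|)).bddAbove
  refine ⟨C, ?_⟩
  filter_upwards [h.ae_eq, p.nonneg_ae] with x h1 h2
  rw [h1, abs_mul, abs_of_nonneg h2]
  exact mul_le_mul_of_nonneg_right (hC ⟨x, rfl⟩) h2

/-! ### Finite sets as retracts of the line -/

/-- The class modulo `m + 1` of the integer part of a real number. -/
def floorMod (m : ℕ) (y : ℝ) : Fin (m + 1) := Fin.ofNat (m + 1) ⌊y⌋₊

theorem measurable_floorMod (m : ℕ) : Measurable (floorMod m) :=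
  (measurable_from_top (f := Fin.ofNat (m + 1))).comp Nat.measurable_floor

theorem floorMod_preimage_inter (m : ℕ) (i : Fin (m + 1)) :
    floorMod m ⁻¹' {i} ∩ Set.Ico (0 : ℝ) (m + 1) = Set.Ico (i : ℝ) (i + 1) := by
  ext y
  have hi : (i : ℝ) + 1 ≤ m + 1 := by exact_mod_cast i.2
  have h0 : (0 : ℝ) ≤ i := Nat.cast_nonneg _
  constructor
  · rintro ⟨h1, h2, h3⟩
    have h4 : ⌊y⌋₊ < m + 1 := (Nat.floor_lt h2).2 (by exact_mod_cast h3)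
    have h5 : ⌊y⌋₊ = i := by
      have := congrArg Fin.val (show Fin.ofNat (m + 1) ⌊y⌋₊ = i from h1)
      simpa [Nat.mod_eq_of_lt h4] using this
    exact (Nat.floor_eq_iff h2).1 h5
  · rintro ⟨h1, h2⟩
    have h3 : 0 ≤ y := h0.trans h1
    have h5 : ⌊y⌋₊ = i := (Nat.floor_eq_iff h3).2 ⟨h1, h2⟩
    refine ⟨?_, h3, h2.trans_le hi⟩
    change Fin.ofNat (m + 1) ⌊y⌋₊ = i
    rw [h5]
    exact Fin.ofNat_val_eq_self i

theorem map_floorMod (m : ℕ) :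
    ((volume : Measure ℝ).restrict (Set.Ico (0 : ℝ) (m + 1))).map (floorMod m) = Measure.count := by
  refine Measure.ext_of_singleton fun i => ?_
  have hs : MeasurableSet ({i} : Set (Fin (m + 1))) := measurableSet_singleton i
  rw [Measure.map_apply (measurable_floorMod m) hs,
    Measure.restrict_apply (measurable_floorMod m hs), floorMod_preimage_inter, Real.volume_Ico,
    Measure.count_singleton]
  simp

theorem lintegral_floorMod (m : ℕ) (S : Set (Fin (m + 1))) :
    ∫⁻ y : ℝ, ((Set.Ico (0 : ℝ) (m + 1)).indicator 1 y : ℝ≥0) * S.indicator 1 (floorMod m y) =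
      Measure.count S := by
  have hS : MeasurableSet S := .of_discrete
  rw [← map_floorMod, Measure.map_apply (measurable_floorMod m) hS,
    ← lintegral_indicator_one (measurable_floorMod m hS), ← lintegral_indicator measurableSet_Ico]
  refine lintegral_congr fun y => ?_
  by_cases hy : y ∈ Set.Ico (0 : ℝ) (m + 1)
  · simp only [Set.indicator_of_mem hy, Pi.one_apply, ENNReal.coe_one, one_mul]
    rfl
  · simp [Set.indicator_of_notMem hy]

theorem integral_floorMod (m : ℕ) (i : Fin (m + 1)) (f : Fin (m + 1) → ℝ) :
    ∫ y : ℝ, (((if floorMod m y = i then 1 else 0 : ℝ≥0) : ℝ) *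
      (((Set.Ico (0 : ℝ) (m + 1)).indicator 1 y : ℝ≥0) * f (floorMod m y))) = f i := by
  have e (y : ℝ) : (((if floorMod m y = i then 1 else 0 : ℝ≥0) : ℝ) *
      (((Set.Ico (0 : ℝ) (m + 1)).indicator 1 y : ℝ≥0) * f (floorMod m y))) =
      (Set.Ico (i : ℝ) (i + 1)).indicator (fun _ => f i) y := by
    rw [← floorMod_preimage_inter m i]
    by_cases h1 : floorMod m y = i
    · by_cases h2 : y ∈ Set.Ico (0 : ℝ) (m + 1)
      · rw [Set.indicator_of_mem (show y ∈ floorMod m ⁻¹' {i} ∩ Set.Ico (0 : ℝ) (m + 1) from ⟨h1, h2⟩),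
          if_pos h1, h1, Set.indicator_of_mem h2]
        simp
      · rw [Set.indicator_of_notMem fun h => h2 (Set.mem_of_mem_inter_right h), Set.indicator_of_notMem h2]
        simp
    · rw [if_neg h1, NNReal.coe_zero, zero_mul]
      refine (Set.indicator_of_notMem (f := fun _ : ℝ => f i) fun h => h1 ?_).symm
      exact (show y ∈ floorMod m ⁻¹' {i} from h.1)
  simp_rw [e]
  rw [integral_indicator measurableSet_Ico]
  simp

/-- A finite set is a retract of the line. -/
theorem exists_channel_retract (m : ℕ) : ∃ (A : Channel (.finite (m + 1)) (.euclid 1))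
    (B : Channel (.euclid 1) (.finite (m + 1))), ∀ f, B.toLinearMap (A.toLinearMap f) = f := by
  have hT : Measurable fun x => floorMod m (lineEquiv x) :=
    (measurable_floorMod m).comp lineEquiv.measurable
  -- The point i is spread uniformly over [i, i + 1), and taking integer parts recovers it.
  let K : ℝ → ℝ≥0 := (Set.Ico (0 : ℝ) (m + 1)).indicator 1
  have hK : Measurable K := measurable_one.indicator measurableSet_Ico
  obtain ⟨A, hA⟩ := exists_channel_pullback (Ω := .finite (m + 1)) (Ω' := .euclid 1) hT
    (hK.comp lineEquiv.measurable) fun S hS =>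
      (measurePreserving_lineEquiv.lintegral_comp (hK.coe_nnreal_ennreal.mul
        ((measurable_one.indicator hS).comp (measurable_floorMod m)))).trans
        (lintegral_floorMod m S)
  let k : (DataSpace.euclid 1).Carrier → Fin (m + 1) → ℝ≥0 :=
    fun z i => if floorMod m (lineEquiv z) = i then 1 else 0
  have hk : Measurable fun x : (DataSpace.euclid 1).Carrier ×
      (DataSpace.finite (m + 1)).Carrier => k x.1 x.2 := by
    have : Measurable fun x : Fin (m + 1) × Fin (m + 1) => (if x.1 = x.2 then 1 else 0 : ℝ≥0) :=
      measurable_of_countable _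
    exact this.comp ((hT.comp measurable_fst).prodMk measurable_snd)
  obtain ⟨B, hB⟩ := exists_channel_kernel (Ω := .euclid 1) (Ω' := .finite (m + 1)) hk fun z => by
    change ∫⁻ i : Fin (m + 1), (k z i : ℝ≥0∞) ∂Measure.count = 1
    rw [lintegral_count, tsum_fintype, ← ENNReal.ofNNReal_finsetSum, Finset.sum_ite_eq]
    simp
  refine ⟨A, B, fun f => Lp.ext ?_⟩
  refine (hB _ _ (hA f f ae_eq_rfl)).trans (.of_forall fun i => ?_)
  exact (measurePreserving_lineEquiv.integral_comp' _).trans (integral_floorMod m i f)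

/-- A channel with a left inverse loses nothing, by monotonicity in both directions. Applied to g
and to Fisher information, this moves the finite case to the line. -/
theorem eq_of_retract {g : Metric} (hg : AxiomM0 g) {Ω Ω' : DataSpace} {A : Channel Ω Ω'}
    {B : Channel Ω' Ω} (h : ∀ f, B.toLinearMap (A.toLinearMap f) = f) (p : Density Ω)
    (δ : Tangent Ω) : g Ω' (A.density p) (A.tangent δ) = g Ω p δ := by
  refine le_antisymm (hg _ _ A p δ) ?_
  have := hg _ _ B (A.density p) (A.tangent δ)
  rwa [show B.density (A.density p) = p from Density.ext (h p.val),
    show B.tangent (A.tangent δ) = δ from Subtype.ext (h δ.1)] at this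

theorem SatisfiesAxioms.eq_fisher_finite {g : Metric} (hg : SatisfiesAxioms g) {k : ℕ}
    {p : Density (.finite k)} {δ : Tangent (.finite k)} (h : fisher _ p δ ≠ ∞) :
    g _ p δ = fisher _ p δ := by
  obtain ⟨C, hC⟩ := (hasScore_of_fisher_ne_top h).bounded_of_finite
  have hfin := hg.ne_top_of_bounded_score hC
  cases k with
  -- There is no probability density on the empty set.
  | zero =>
    have h1 : ∫ x, p.val x ∂(DataSpace.finite 0).refMeasure = 0 := by
      have : IsEmpty (DataSpace.finite 0).Carrier := inferInstanceAs (IsEmpty (Fin 0))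
      exact integral_of_isEmpty
    exact absurd (h1.symm.trans p.integral_eq_one) zero_ne_one
  | succ m =>
    obtain ⟨A, B, hAB⟩ := exists_channel_retract m
    rw [← eq_of_retract hg.m0 hAB, ← eq_of_retract axiomM0_fisher hAB]
    refine hg.eq_fisher_euclid ?_ ?_
    · rwa [eq_of_retract axiomM0_fisher hAB]
    · rwa [eq_of_retract hg.m0 hAB]

theorem HasScore.fisher_ne_top {Ω : DataSpace} {p : Density Ω} {δ : Tangent Ω} (h : HasScore p δ)
    (h4 : FiniteFourthMoment p δ) : fisher Ω p δ ≠ ∞ := by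
  rw [h.fisher_eq_scoreLaw, scoreLaw, lintegral_map (by fun_prop) (measurable_score p δ)]
  refine ne_top_of_le_ne_top (b := ∫⁻ x, (1 + ENNReal.ofReal (score p δ x ^ 4)) ∂p.toMeasure) ?_
    (lintegral_mono fun x => ?_)
  · rw [lintegral_add_left measurable_const]
    simpa using h4.ne
  · rw [← ENNReal.ofReal_one, ← ENNReal.ofReal_add zero_le_one (by positivity)]
    -- L² ≤ 1 + L⁴, so a finite fourth moment makes J finite.
    exact ENNReal.ofReal_le_ofReal (by nlinarith [sq_nonneg (score p δ x ^ 2 - 1), sq_nonneg (score p δ x)])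

end Finite

end InfoMetric

end

/-! ### Characterization of Fisher information -/

open InfoMetric

theorem mainTheorem1 :
    (∀ g : Metric, SatisfiesAxioms g →
      ∀ (Ω : DataSpace) (p : Density Ω) (δ : Tangent Ω),
        HasScore p δ →
        FiniteFourthMoment p δ →
        ((∃ k : ℕ, Ω = DataSpace.finite k) ∨
          ((∃ f : ℝ → ℝ, IsScoreDensity p δ f ∧ WVariance p δ f) ∧ g Ω p δ ≠ ∞)) →
        g Ω p δ = fisher Ω p δ) ∧
    SatisfiesAxioms fisher := by
  refine ⟨fun g hg Ω p δ hs h4 h => ?_, satisfiesAxioms_fisher⟩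
  have hJ := hs.fisher_ne_top h4
  cases Ω with
  | finite k => exact hg.eq_fisher_finite hJ
  | euclid d =>
    rcases h with ⟨k, hk⟩ | ⟨_, hfin⟩
    · exact absurd hk (by simp)
    · exact hg.eq_fisher_euclid hJ hfin
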